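/- Fix $q\in(0,1)$, $\zeta_-<0<\zeta_+$ and let $\mathbb L=\{\zeta_-q^m:m\in\mathbb Z\}\sqcup\{\zeta_+q^n:n\in\mathbb Z\}\subset\mathbb R$. For $N\ge1$ let $\mathbb G_N$ be the set of $N$-point subsets $X=(x_1<\dots<x_N)$ of $\mathbb L$, and let $\mathbb G_\infty$ be the set of infinite bounded subsets of $\mathbb L$. For a nonempty bounded $X\subset\mathbb L$ let $I(X)$ be the smallest closed segment of $\mathbb R$ containing $X$. For $a<b$ in $\mathbb L$ let $I(a,b)$ be $[a,b)\cap\mathbb L$ if $b<0$, $[a,b]\cap\mathbb L$ if $a<0<b$, and $(a,b]\cap\mathbb L$ if $a>0$. For $X\in\mathbb G_{N+1}$, $Y\in\mathbb G_N$ write $Y\prec X$ if $y_i\in I(x_i,x_{i+1})$ for $i=1,\dots,N$, and put $$\Lambda^{N+1}_N(X,Y)=\prod_{i=1}^N|y_i|\cdot\prod_{k=1}^N(1-q^k)\cdot\frac{\prod_{1\le i<j\le N}(y_j-y_i)}{\prod_{1\le i<j\le N+1}(x_j-x_i)}\quad\text{if }Y\prec X,$$ and $\Lambda^{N+1}_N(X,Y)=0$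 otherwise. For $N>K$ let $\Lambda^N_K=\Lambda^N_{N-1}\cdots\Lambda^{K+1}_K$. The variational series $(x_{(1)},x_{(2)},\dots)$ of a bounded $X\subset\mathbb L$ lists the points of $X$ in decreasing order of absolute value (of two points with equal absolute value the positive one comes first), completed by zeros if $X$ is finite. A sequence $X(N)\in\mathbb G_N$ stabilizes to $X\in\mathbb G_\infty$ if for every $k$ one has $x_{(k)}(N)=x_{(k)}$ for all sufficiently large $N$. For $X\in\mathbb G_\infty$ let $M^{(X)}_K$ be the probability distribution on $\mathbb G_K$ which is the weak limit of $\Lambda^N_K(X(N),\,\cdot\,)$ as $N\to\infty$ for every sequence $X(N)\in\mathbb G_N$ stabilizing to $X$. For a partition $\nu$ of length at most $N$ and pairwise distinct $u_1,\dots,u_N$ let $S_{\nu|N}(u_1,\dots,u_N)=\det[u_j^{\nu_i+N-i}]_{i,j=1}^N/\prod_{i<j}(u_i-u_j)$ be the Schur polynomial (put $S_{\nu|N}=0$ if the length of $\nu$ exceeds $N$), and for an infinite collection $X$ of reals let $S_\nu(X)$ be the value at $X$ of the Schur function, i.e. the limit of the values of the Schur polynomials at the finite subcollections of $X$. Put $$\widetilde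 S_{\nu|K}(Y)=\frac{S_{\nu|K}(y_1,\dots,y_K)}{S_{\nu|K}(1,q,\dots,q^{K-1})}\quad(Y\in\mathbb G_K),\qquad \widetilde S_\nu(X)=\frac{S_\nu(X)}{S_\nu(1,q,q^2,\dots)}.$$ **Theorem.** Let $X\in\mathbb G_\infty$ and $K\ge1$. The distribution $M^{(X)}_K$ is well defined (it exists and is unique), and so are the quantities $\widetilde S_\nu(X)$ for all partitions $\nu$ (the limits defining $S_\nu(X)$ and $S_\nu(1,q,q^2,\dots)$ exist, and the latter is nonzero). For $Y\in\mathbb G_K$, $M^{(X)}_K(Y)$ vanishes unless $I(Y)\subseteq I(X)$, and for every partition $\nu$ of length at most $K$ $$\sum_{Y\in\mathbb G_K,\ I(Y)\subseteq I(X)}M^{(X)}_K(Y)\,\widetilde S_{\nu|K}(Y)=\widetilde S_\nu(X)$$ (the series converges absolutely). Moreover, $M^{(X)}_K$ is the only probability distribution on $\mathbb G_K$ with these two properties. -/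

import Mathlib

open Filter Topology

noncomputable section

namespace QGT

/-- The double `q`-lattice `{ζ₋ qᵐ : m ∈ ℤ} ∪ {ζ₊ qⁿ : n ∈ ℤ}`. -/
def lattice (q ζm ζp : ℝ) : Set ℝ :=
  {x | ∃ m : ℤ, x = ζm * q ^ m} ∪ {x | ∃ n : ℤ, x = ζp * q ^ n}

/-- `𝔾_N`: the `N`-particle configurations on the lattice. -/
abbrev Level (q ζm ζp : ℝ) (N : ℕ) : Type :=
  {Y : Finset ℝ // (Y : Set ℝ) ⊆ lattice q ζm ζp ∧ Y.card = N}

/-- `𝔾_∞`: the infinite bounded configurations on the lattice. -/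
def InfConfig (q ζm ζp : ℝ) : Set (Set ℝ) :=
  {X | X ⊆ lattice q ζm ζp ∧ X.Infinite ∧ ∃ a b : ℝ, X ⊆ Set.Icc a b}

/-- `I(X)`: the smallest closed segment containing a nonempty bounded configuration. -/
def segment (X : Set ℝ) : Set ℝ := Set.Icc (sInf X) (sSup X)

variable {q ζm ζp : ℝ}

/-- The particles of a finite configuration in increasing order: `x_1 < ⋯ < x_N`
(indexed by `0, …, N - 1`). -/
def Level.particle {N : ℕ} (X : Level q ζm ζp N) : Fin N → ℝ :=
  X.1.orderEmbOfFin X.2.2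

/-! ### The extended Gelfand–Tsetlin graph and its `q`-links -/

/-- The interval `I(a, b)` between two lattice points `a < b`. -/
def interval (q ζm ζp a b : ℝ) : Set ℝ :=
  if b < 0 then Set.Ico a b ∩ lattice q ζm ζp
  else if a < 0 then Set.Icc a b ∩ lattice q ζm ζp
  else Set.Ioc a b ∩ lattice q ζm ζp

/-- Interlacing `Y ≺ X`. -/
def Interlace {N : ℕ} (X : Level q ζm ζp (N + 1)) (Y : Level q ζm ζp N) : Prop :=
  ∀ i : Fin N, Y.particle i ∈ interval q ζm ζp (X.particle i.castSucc) (X.particle i.succ)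

/-- `∏_{i < j} (u_j - u_i)`. -/
def vandermonde {N : ℕ} (u : Fin N → ℝ) : ℝ :=
  ∏ i : Fin N, ∏ j ∈ Finset.Ioi i, (u j - u i)

open Classical in
/-- The cotransition probabilities `Λ^{N+1}_N(X, Y)`. -/
def link {N : ℕ} (X : Level q ζm ζp (N + 1)) (Y : Level q ζm ζp N) : ℝ :=
  if Interlace X Y then
    (∏ i : Fin N, |Y.particle i|) * (∏ k ∈ Finset.Icc 1 N, (1 - q ^ k)) *
      (vandermonde Y.particle / vandermonde X.particle)
  else 0

open Classical in
/-- The composite link `Λ^{K+d}_K = Λ^{K+d}_{K+d-1} ⋯ Λ^{K+1}_K`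
(the identity matrix for `d = 0`). -/
def iterLink (K : ℕ) : (d : ℕ) → Level q ζm ζp (K + d) → Level q ζm ζp K → ℝ
  | 0, X, Y => if X = Y then 1 else 0
  | d + 1, X, Y => ∑' Z : Level q ζm ζp (K + d), link X Z * iterLink K d Z Y

/-! ### Variational series, stabilization, boundary measures -/

/-- The order of the variational series: larger absolute value first, and of two particles with the
same absolute value the positive one first. -/
def Precedes (y x : ℝ) : Prop := |x| < |y| ∨ (|y| = |x| ∧ x < y)

open Classical in
/-- The variational series `x_{(1)}, x_{(2)}, …` of a configuration, indexed by `0, 1, …`: the term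
with index `k` is the particle that is preceded by exactly `k` particles, and it is `0` if the
configuration has at most `k` particles. -/
def varSeries (X : Set ℝ) (k : ℕ) : ℝ :=
  if h : ∃ x ∈ X, {y ∈ X | Precedes y x}.encard = k then h.choose else 0

/-- A sequence `X(N) ∈ 𝔾_N` stabilizes to the configuration `X`: every term of the variational
series of `X(N)` is eventually equal to that of `X`. -/
def Stabilizes (Xs : (N : ℕ) → Level q ζm ζp N) (X : Set ℝ) : Prop :=
  ∀ k : ℕ, ∀ᶠ N in atTop, varSeries (Xs N).1 k = varSeries X k

/-- `M` is a probability distribution on `𝔾_K`. -/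
def IsProbability {K : ℕ} (M : Level q ζm ζp K → ℝ) : Prop :=
  (∀ Y, 0 ≤ M Y) ∧ HasSum M 1

/-- `M` is the measure `M^{(X)}_K` that the configuration `X`, as a point of the Martin boundary,
induces on `𝔾_K`: it is a probability distribution, and for every sequence `X(N) ∈ 𝔾_N` that
stabilizes to `X` the distributions `Λ^N_K(X(N), ·)` converge to `M` weakly, that is, on every
subset of the discrete space `𝔾_K`. -/
def IsBoundaryMeasure (X : Set ℝ) (K : ℕ) (M : Level q ζm ζp K → ℝ) : Prop :=
  IsProbability M ∧
    ∀ Xs : (N : ℕ) → Level q ζm ζp N, Stabilizes Xs X →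
      ∀ A : Set (Level q ζm ζp K),
        Tendsto (fun d : ℕ => ∑' Y : A, iterLink K d (Xs (K + d)) Y) atTop (𝓝 (∑' Y : A, M Y))

/-! ### Schur polynomials and Schur functions -/

/-- The length (number of nonzero parts) of a partition. -/
def length (ν : YoungDiagram) : ℕ := ν.colLen 0

/-- The Schur polynomial `S_{ν|N}(u_1, …, u_N)` at a point with pairwise distinct coordinates, as
the ratio of alternants `det[u_j^{ν_i + N - i}] / ∏_{i<j} (u_i - u_j)`; it is `0` if the length
of `ν` exceeds `N`. -/
def schurPoly (ν : YoungDiagram) (N : ℕ) (u : Fin N → ℝ) : ℝ :=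
  if length ν ≤ N then
    (Matrix.of fun i j : Fin N => u j ^ (ν.rowLen i + (N - 1 - i))).det /
      ∏ i : Fin N, ∏ j ∈ Finset.Ioi i, (u i - u j)
  else 0

/-- The value of the Schur polynomial indexed by `ν` at a finite subcollection of `X`. -/
def schurPartial (ν : YoungDiagram) (X : Set ℝ) (F : Finset X) : ℝ :=
  schurPoly ν (F.map (Function.Embedding.subtype _)).card
    ((F.map (Function.Embedding.subtype _)).orderEmbOfFin rfl)

/-- The value `S_ν(X)` of the Schur function (the stable limit of the Schur polynomials `S_{ν|N}`)
at the collection of real numbers `X`: the limit of the values of the Schur polynomials at the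
finite subcollections of `X`, directed by inclusion. -/
def schurFun (ν : YoungDiagram) (X : Set ℝ) : ℝ :=
  limUnder atTop (schurPartial ν X)

/-- The limit which defines `S_ν(X)` exists. -/
def SchurConverges (ν : YoungDiagram) (X : Set ℝ) : Prop :=
  Tendsto (schurPartial ν X) atTop (𝓝 (schurFun ν X))

/-- The collection `1, q, q², …`. -/
def geomSet (q : ℝ) : Set ℝ := Set.range fun n : ℕ => q ^ n

/-- `S̃_{ν|K}(Y) = S_{ν|K}(Y) / S_{ν|K}(1, q, …, q^{K-1})`. -/
def normSchurPoly (ν : YoungDiagram) {K : ℕ} (Y : Level q ζm ζp K) : ℝ :=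
  schurPoly ν K Y.particle / schurPoly ν K (fun i => q ^ (i : ℕ))

/-- `S̃_ν(X) = S_ν(X) / S_ν(1, q, q², …)`. -/
def normSchurFun (q : ℝ) (ν : YoungDiagram) (X : Set ℝ) : ℝ :=
  schurFun ν X / schurFun ν (geomSet q)

/-- `M(Y)` vanishes unless `I(Y) ⊆ I(X)`. -/
def VanishesOutside (X : Set ℝ) {K : ℕ} (M : Level q ζm ζp K → ℝ) : Prop :=
  ∀ Y : Level q ζm ζp K, ¬ segment (Y.1 : Set ℝ) ⊆ segment X → M Y = 0

/-- `∑_{Y ∈ 𝔾_K, I(Y) ⊆ I(X)} M(Y) S̃_{ν|K}(Y) = S̃_ν(X)` for all partitions `ν` of length at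
most `K`. -/
def SchurRelations (X : Set ℝ) {K : ℕ} (M : Level q ζm ζp K → ℝ) : Prop :=
  ∀ ν : YoungDiagram, length ν ≤ K →
    HasSum (fun Y : {Y : Level q ζm ζp K // segment (Y.1 : Set ℝ) ⊆ segment X} =>
      M Y.1 * normSchurPoly ν Y.1) (normSchurFun q ν X)

end QGT

end

noncomputable section

namespace QGT

/-! ### Complete homogeneous sums through partial fractions -/

/-! Distributions on a level are tested against the alternant ratios `altRatio α`. Such a ratio is a
Schur polynomial up to sign, or zero when two exponents coincide. Up to Vandermonde factors, a link
is a determinant of q-integration kernels over the intervals I(x_i, x_{i+1}). By the Cauchy–Binet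
identity `hasSum_det_mul_det` it therefore sends an alternant ratio to a scalar times the same Schur
polynomial in one more variable (`hasSum_link_mul_altRatio`). The product of the scalars tends to
`limitFactor`. By `altRatio_eq_jacobiTrudi` the Schur polynomial is a continuous function of the
power sums, insensitive to the number of variables. Stabilization forces the power sums to converge,
so all moments of the composite links converge.

The limiting moments are realized by an explicit object, `boundaryMeasure`. Partial fractions write
h_m of a finite set as a sum of c_x x^m, also for negative m exceeding minus the number of points,
where it vanishes. For infinite X the limiting coefficients decay at 0 faster than every power of x,
so the identity survives in every integer degree (`hasSum_limitCoeff_mul_zpow`). Spreading the mass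
at x over x, xq, xq², … by Euler's distribution multiplies the n-th moment by (1 - q)⋯(1 - qⁿ), and
a second use of Cauchy–Binet yields exactly the required determinants. Points xqᵐ lie between x and
0, and 0 belongs to I(X); this gives the vanishing property.

These moments determine a measure of bounded support (`tendsto_zero_of_altRatio_moments`):
symmetrized polynomials are combinations of alternant ratios, lattice configurations are isolated,
and Stone–Weierstrass applies. Used along a stabilizing sequence, this gives pointwise convergence
of the links to `boundaryMeasure`, and hence its positivity, which the determinant does not show.
Used on a constant family, it gives uniqueness. Scheffé's argument upgrades pointwise convergence to
convergence on every subset.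

Finally, the scalars of the links are ratios of principal specializations
(`linkFactor_mul_altRatio_geom`), so the moment identities are precisely the relations between
normalized Schur functions. -/

/-- The partial fraction coefficient `∏_{y ∈ F, y ≠ x} x / (x - y)`. -/
def lagrangeCoeff (F : Finset ℝ) (x : ℝ) : ℝ := ∏ y ∈ F.erase x, x / (x - y)

/-- The complete homogeneous symmetric function of degree `m` of the points of `F`, as a sum of
partial fractions. -/
def hsum (F : Finset ℝ) (m : ℤ) : ℝ := ∑ x ∈ F, lagrangeCoeff F x * x ^ m

/-- The shifted sequence of power sums `∑ x, ∑ x², …`. -/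
def psums (F : Finset ℝ) (k : ℕ) : ℝ := ∑ x ∈ F, x ^ (k + 1)

/-- Elementary symmetric functions in terms of power sums. -/
def newtonE (p : ℕ → ℝ) : ℕ → ℝ
  | 0 => 1
  | n + 1 => (-1) ^ n / (n + 1) * ∑ i : Fin (n + 1), (-1) ^ (i : ℕ) * newtonE p i * p (n - i)

/-- Complete homogeneous symmetric functions in terms of power sums. -/
def newtonH (p : ℕ → ℝ) : ℕ → ℝ
  | 0 => 1
  | n + 1 => ∑ i : Fin (n + 1), (-1) ^ (n - i) * newtonE p (n + 1 - i) * newtonH p i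

/-- `newtonH` extended by zero to negative degrees. -/
def newtonHZ (p : ℕ → ℝ) (m : ℤ) : ℝ := if 0 ≤ m then newtonH p m.toNat else 0

/-- Continuity is for the product topology: convergence of each power sum separately suffices. The
degree-zero power sum, which counts points and diverges, does not occur. -/
theorem continuous_newtonE (n : ℕ) : Continuous fun p : ℕ → ℝ => newtonE p n := by
  induction n using Nat.strong_induction_on with
  | _ n ih =>
    cases n with
    | zero => simpa [newtonE] using continuous_const
    | succ n =>
      simp only [newtonE]
      refine continuous_const.mul (continuous_finsetSum _ fun i _ => ?_)
      exact (continuous_const.mul (ih i i.2)).mul (continuous_apply _)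

theorem continuous_newtonH (n : ℕ) : Continuous fun p : ℕ → ℝ => newtonH p n := by
  induction n using Nat.strong_induction_on with
  | _ n ih =>
    cases n with
    | zero => simpa [newtonH] using continuous_const
    | succ n =>
      simp only [newtonH]
      refine continuous_finsetSum _ fun i _ => ?_
      exact (continuous_const.mul (continuous_newtonE _)).mul (ih i i.2)

theorem continuous_newtonHZ (m : ℤ) : Continuous fun p : ℕ → ℝ => newtonHZ p m := by
  unfold newtonHZ
  split_ifs
  · exact continuous_newtonH _
  · exact continuous_const

theorem newtonE_psums (F : Finset ℝ) (n : ℕ) : newtonE (psums F) n = F.val.esymm n := by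
  have key : ∀ k, MvPolynomial.aeval (fun x : F => (x : ℝ)) (MvPolynomial.esymm F ℝ k)
      = F.val.esymm k := by
    intro k
    rw [MvPolynomial.aeval_esymm_eq_multiset_esymm]
    congr 1
    exact Multiset.attach_map_val F.val
  have keyp : ∀ k, MvPolynomial.aeval (fun x : F => (x : ℝ)) (MvPolynomial.psum F ℝ (k + 1))
      = psums F k := by
    intro k
    simp only [MvPolynomial.psum, map_sum, map_pow, MvPolynomial.aeval_X, psums]
    exact Finset.sum_coe_sort F (fun x => x ^ (k + 1))
  induction n using Nat.strong_induction_on with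
  | _ n ih =>
    cases n with
    | zero => simp [newtonE, Multiset.esymm]
    | succ n =>
      have h := congrArg (MvPolynomial.aeval (fun x : F => (x : ℝ)))
        (MvPolynomial.mul_esymm_eq_sum F ℝ (n + 1))
      simp only [map_mul, map_natCast, map_pow, map_neg, map_one, map_sum, key] at h
      have hs : ∑ a ∈ Finset.HasAntidiagonal.antidiagonal (n + 1) with a.1 < n + 1,
          (-1 : ℝ) ^ a.1 * F.val.esymm a.1 *
            MvPolynomial.aeval (fun x : F => (x : ℝ)) (MvPolynomial.psum F ℝ a.2)
          = ∑ i : Fin (n + 1), (-1) ^ (i : ℕ) * newtonE (psums F) i * psums F (n - i) := by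
        rw [Finset.sum_filter, Finset.Nat.sum_antidiagonal_eq_sum_range_succ_mk,
          Finset.sum_range_succ, Finset.sum_range]
        simp only [lt_irrefl, if_false, add_zero]
        refine Finset.sum_congr rfl fun i _ => ?_
        rw [if_pos i.2, ih i i.2, ← keyp, show n - (i : ℕ) + 1 = n + 1 - i by omega]
      rw [hs] at h
      have h0 : ((n : ℝ) + 1) ≠ 0 := by positivity
      simp only [newtonE]
      push_cast at h
      have h2 : F.val.esymm (n + 1) = (-1) ^ (n + 1 + 1) *
          (∑ i : Fin (n + 1), (-1) ^ (i : ℕ) * newtonE (psums F) i * psums F (n - i)) /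
            ((n : ℝ) + 1) := by
        rw [← h]; field_simp
      rw [h2]
      ring

/-- Lagrange interpolation at the nodes F reproduces the monomial of degree `F.card - 1 - s`;
comparing coefficients in degree `F.card - 1` gives the value. -/
theorem hsum_aux (F : Finset ℝ) (h0 : (0 : ℝ) ∉ F) {s : ℕ} (hs : s < F.card) :
    hsum F (-(s : ℤ)) = if s = 0 then 1 else 0 := by
  have hdeg : (Polynomial.X ^ (F.card - 1 - s) : Polynomial ℝ).degree < F.card := by
    rw [Polynomial.degree_X_pow]
    exact_mod_cast (by omega)
  have h := Lagrange.coeff_eq_sum (s := F) (v := fun x : ℝ => x) (Function.injective_id.injOn) hdeg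
  rw [Polynomial.coeff_X_pow] at h
  have h1 : (if F.card - 1 = F.card - 1 - s then (1 : ℝ) else 0) = if s = 0 then 1 else 0 := by
    congr 1; simp only [eq_iff_iff]; omega
  rw [h1] at h
  rw [h, hsum]
  refine Finset.sum_congr rfl fun x hx => ?_
  have hx0 : x ≠ 0 := fun h => h0 (h ▸ hx)
  rw [lagrangeCoeff, Finset.prod_div_distrib, Finset.prod_const, Finset.card_erase_of_mem hx,
    Polynomial.eval_pow, Polynomial.eval_X, div_mul_eq_mul_div]
  congr 1
  rw [← zpow_natCast, ← zpow_natCast, ← zpow_add₀ hx0]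
  congr 1
  omega

/-- Each x in F is a root of the product of the T - t over t in F; multiply this relation by the
coefficient of x and a power of x, then sum over x. -/
theorem hsum_recursion (F : Finset ℝ) (h0 : (0 : ℝ) ∉ F) (m : ℤ) :
    ∑ j ∈ Finset.range (F.card + 1), (-1) ^ j * F.val.esymm j * hsum F (m - j) = 0 := by
  simp only [hsum, Finset.mul_sum]
  rw [Finset.sum_comm]
  refine Finset.sum_eq_zero fun x hx => ?_
  have hx0 : x ≠ 0 := fun h => h0 (h ▸ hx)
  have h := congrArg (Polynomial.eval x) (Multiset.prod_X_sub_X_eq_sum_esymm F.val)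
  have hz : Polynomial.eval x (F.val.map fun t => Polynomial.X - Polynomial.C t).prod = 0 := by
    have : (F.val.map fun t => Polynomial.X - Polynomial.C t).prod
        = ∏ t ∈ F, (Polynomial.X - Polynomial.C t) := rfl
    rw [this, Polynomial.eval_prod]
    exact Finset.prod_eq_zero hx (by simp)
  rw [hz, Polynomial.eval_finsetSum] at h
  have hc : Multiset.card F.val = F.card := rfl
  rw [hc] at h
  have := congrArg (fun t => t * (lagrangeCoeff F x * x ^ (m - F.card))) h
  simp only [zero_mul, Finset.sum_mul] at this
  rw [this]
  refine Finset.sum_congr rfl fun j hj => ?_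
  simp only [Polynomial.eval_mul, Polynomial.eval_pow, Polynomial.eval_neg, Polynomial.eval_one,
    Polynomial.eval_C, Polynomial.eval_X]
  have hj' : j ≤ F.card := by simpa [Nat.lt_succ_iff] using hj
  have e : x ^ (m - j) = x ^ (F.card - j) * x ^ (m - F.card) := by
    rw [← zpow_natCast, ← zpow_add₀ hx0]
    congr 1
    omega
  rw [e]; ring

theorem hsum_natCast (F : Finset ℝ) (h0 : (0 : ℝ) ∉ F) (hF : F.Nonempty) (n : ℕ) :
    hsum F n = newtonH (psums F) n := by
  have hc : 0 < F.card := hF.card_pos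
  induction n using Nat.strong_induction_on with
  | _ n ih =>
    cases n with
    | zero => simpa [newtonH] using hsum_aux F h0 hc
    | succ n =>
      have h := hsum_recursion F h0 ((n + 1 : ℕ) : ℤ)
      set g : ℕ → ℝ := fun j => (-1) ^ j * F.val.esymm j * hsum F (((n + 1 : ℕ) : ℤ) - j) with hg
      -- The sums up to `F.card` and up to `n + 1` are compared through a common longer range.
      -- Beyond `F.card` the elementary functions vanish; between `n + 1` and `F.card` the `hsum`
      -- factor has negative degree and vanishes by `hsum_aux`.
      have e1 : ∑ j ∈ Finset.range (F.card + 1), g j = ∑ j ∈ Finset.range (F.card + n + 2), g j := by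
        refine Finset.sum_subset (Finset.range_mono (by omega)) fun j _ hj => ?_
        have : F.val.esymm j = 0 := by
          have hlt : Multiset.card F.val < j := by
            simp at hj; simpa using (by omega : F.card < j)
          simp [Multiset.esymm, Multiset.powersetCard_eq_empty _ hlt]
        simp [hg, this]
      have e2 : ∑ j ∈ Finset.range (n + 2), g j = ∑ j ∈ Finset.range (F.card + n + 2), g j := by
        have hge : ∀ j, F.card < j → g j = 0 := by
          intro j hlt
          have hlt : Multiset.card F.val < j := by simpa using hlt
          simp [hg, Multiset.esymm, Multiset.powersetCard_eq_empty _ hlt]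
        refine Finset.sum_subset (Finset.range_mono (by omega)) fun j _ hj => ?_
        by_cases hlt : F.card < j
        · exact hge j hlt
        simp only [Finset.mem_range, not_lt] at hj hlt
        have h3 := hsum_aux F h0 (s := j - (n + 1)) (by omega)
        rw [if_neg (by omega)] at h3
        have : ((n + 1 : ℕ) : ℤ) - j = -((j - (n + 1) : ℕ) : ℤ) := by omega
        simp only [hg, this, h3, mul_zero]
      rw [e1, ← e2, Finset.sum_range_succ'] at h
      have h4 : hsum F ((n + 1 : ℕ) : ℤ) = g 0 := by simp [hg, Multiset.esymm]
      rw [h4, newtonH, eq_neg_of_add_eq_zero_right h, ← Finset.sum_neg_distrib,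
        ← Finset.sum_range_reflect, Finset.sum_range]
      refine Finset.sum_congr rfl fun i _ => ?_
      have hi := i.2
      have e3 : n + 1 - 1 - (i : ℕ) + 1 = n + 1 - i := by omega
      have e4 : ((n + 1 : ℕ) : ℤ) - ((n + 1 - (i : ℕ) : ℕ) : ℤ) = ((i : ℕ) : ℤ) := by omega
      simp only [hg]
      rw [e3, e4, ih i i.2, newtonE_psums, show n + 1 - (i : ℕ) = (n - i) + 1 by omega]
      ring

theorem hsum_eq_newtonHZ (F : Finset ℝ) (h0 : (0 : ℝ) ∉ F) (hF : F.Nonempty) {m : ℤ}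
    (hm : -(F.card : ℤ) < m) :
    hsum F m = newtonHZ (psums F) m := by
  unfold newtonHZ
  split_ifs with h
  · lift m to ℕ using h
    simpa using hsum_natCast F h0 hF m
  · have h1 := hsum_aux F h0 (s := (-m).toNat) (by omega)
    rw [if_neg (by omega)] at h1
    rw [← h1]; congr 1; omega

/-! ### Ratios of alternants and the Jacobi–Trudi determinant -/

/-- The ratio `det[u_j ^ α_i] / V(u)`. -/
def altRatio {N : ℕ} (α : Fin N → ℕ) (u : Fin N → ℝ) : ℝ :=
  (Matrix.of fun i j => u j ^ α i).det / vandermonde u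

/-- The Jacobi–Trudi determinant `det[h_{α_i - j}]`. -/
def jacobiTrudi {N : ℕ} (p : ℕ → ℝ) (α : Fin N → ℕ) : ℝ :=
  (Matrix.of fun i j : Fin N => newtonHZ p ((α i : ℤ) - (j : ℕ))).det

theorem vandermonde_eq_det {N : ℕ} (u : Fin N → ℝ) :
    vandermonde u = (Matrix.of fun i j : Fin N => u j ^ (i : ℕ)).det := by
  rw [vandermonde, ← Matrix.det_vandermonde, ← Matrix.det_transpose]
  rfl

theorem vandermonde_ne_zero {N : ℕ} {u : Fin N → ℝ} (hu : Function.Injective u) :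
    vandermonde u ≠ 0 := by
  rw [vandermonde, ← Matrix.det_vandermonde]
  exact Matrix.det_vandermonde_ne_zero_iff.2 hu

theorem continuous_jacobiTrudi {N : ℕ} (α : Fin N → ℕ) :
    Continuous fun p => jacobiTrudi p α := by
  unfold jacobiTrudi
  refine Continuous.matrix_det ?_
  refine continuous_matrix fun i j => ?_
  exact continuous_newtonHZ _

theorem jacobiTrudi_id {N : ℕ} (p : ℕ → ℝ) : jacobiTrudi p (fun i : Fin N => (i : ℕ)) = 1 := by
  unfold jacobiTrudi
  rw [Matrix.det_of_isLowerTriangular]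
  · refine Finset.prod_eq_one fun i _ => ?_
    simp [newtonHZ, newtonH]
  · intro i j hij
    have : (i : ℕ) < j := by simpa using hij
    simp only [Matrix.of_apply, newtonHZ]
    rw [if_neg (by omega)]

/-- The first row is (1, 0, …, 0), and deleting it with the first column leaves the smaller
determinant. This is the stability of Schur polynomials under adding a variable. -/
theorem jacobiTrudi_cons {N : ℕ} (p : ℕ → ℝ) (α : Fin N → ℕ) :
    jacobiTrudi p (Fin.cons 0 (fun i => α i + 1) : Fin (N + 1) → ℕ) = jacobiTrudi p α := by
  unfold jacobiTrudi
  rw [Matrix.det_succ_row_zero, Fin.sum_univ_succ, Finset.sum_eq_zero, add_zero]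
  · simp only [Fin.val_zero, pow_zero, one_mul, Matrix.of_apply, Fin.cons_zero, newtonHZ,
      Nat.cast_zero, sub_zero, le_refl, if_true, Int.toNat_zero, newtonH]
    congr 1
    ext i j
    simp [Matrix.submatrix]
  · intro j _
    simp only [Matrix.of_apply, Fin.cons_zero, newtonHZ]
    rw [if_neg (by simp; omega)]
    ring

/-- The matrix of the h_{α_i - j} factors as the alternant matrix times a matrix B independent of α.
For α = (0, 1, …, N - 1) the left side is 1, so det B is the inverse Vandermonde determinant. -/
theorem altRatio_eq_jacobiTrudi {N : ℕ} (hN : 0 < N) {u : Fin N → ℝ} (hu : Function.Injective u)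
    (h0 : ∀ i, u i ≠ 0) (α : Fin N → ℕ) :
    altRatio α u = jacobiTrudi (psums (Finset.univ.image u)) α := by
  set F := Finset.univ.image u with hF
  have hcard : F.card = N := by rw [hF, Finset.card_image_of_injective _ hu]; simp
  have hF0 : (0 : ℝ) ∉ F := by
    simp only [hF, Finset.mem_image, Finset.mem_univ, true_and, not_exists]
    exact h0
  have hne : F.Nonempty := Finset.card_pos.1 (hcard ▸ hN)
  set B : Matrix (Fin N) (Fin N) ℝ :=
    Matrix.of fun k j => u k ^ (-((j : ℕ) : ℤ)) * lagrangeCoeff F (u k) with hB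
  have key : ∀ β : Fin N → ℕ,
      (Matrix.of fun i j => u j ^ β i).det * B.det = jacobiTrudi (psums F) β := by
    intro β
    rw [← Matrix.det_mul, jacobiTrudi]
    congr 1
    ext i j
    -- The column index is below N, so the degree exceeds -N, as the partial fraction formula
    -- requires.
    rw [Matrix.mul_apply, Matrix.of_apply, ← hsum_eq_newtonHZ F hF0 hne (by have := j.2; omega),
      hsum, hF, Finset.sum_image (fun a _ b _ h => hu h)]
    refine Finset.sum_congr rfl fun k _ => ?_
    simp only [hB, Matrix.of_apply]
    rw [sub_eq_add_neg, zpow_add₀ (h0 k), zpow_natCast]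
    ring
  have h1 := key fun i => (i : ℕ)
  rw [jacobiTrudi_id, ← vandermonde_eq_det] at h1
  rw [altRatio, ← key, div_eq_iff (vandermonde_ne_zero hu), mul_assoc, mul_comm B.det, h1, mul_one]

/-! ### The lattice -/

section Lattice

variable {q ζm ζp : ℝ}

theorem lattice_sign (hq0 : 0 < q) (hζm : ζm < 0) (hζp : 0 < ζp) {x : ℝ}
    (hx : x ∈ lattice q ζm ζp) :
    (x < 0 ∧ ∃ m : ℤ, x = ζm * q ^ m) ∨ (0 < x ∧ ∃ m : ℤ, x = ζp * q ^ m) := by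
  rcases hx with ⟨m, rfl⟩ | ⟨m, rfl⟩
  · exact Or.inl ⟨mul_neg_of_neg_of_pos hζm (zpow_pos hq0 m), m, rfl⟩
  · exact Or.inr ⟨mul_pos hζp (zpow_pos hq0 m), m, rfl⟩

theorem lattice_ne_zero (hq0 : 0 < q) (hζm : ζm < 0) (hζp : 0 < ζp) {x : ℝ}
    (hx : x ∈ lattice q ζm ζp) : x ≠ 0 := by
  rcases lattice_sign hq0 hζm hζp hx with h | h
  · exact h.1.ne
  · exact h.1.ne'

theorem mul_zpow_mem_lattice (hq0 : 0 < q) {x : ℝ} (hx : x ∈ lattice q ζm ζp) (m : ℤ) :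
    x * q ^ m ∈ lattice q ζm ζp := by
  rcases hx with ⟨n, rfl⟩ | ⟨n, rfl⟩
  · exact Or.inl ⟨n + m, by rw [zpow_add₀ hq0.ne']; ring⟩
  · exact Or.inr ⟨n + m, by rw [zpow_add₀ hq0.ne']; ring⟩

theorem mul_pow_mem_lattice (hq0 : 0 < q) {x : ℝ} (hx : x ∈ lattice q ζm ζp) (m : ℕ) :
    x * q ^ m ∈ lattice q ζm ζp := by
  simpa using mul_zpow_mem_lattice hq0 hx (m : ℤ)

theorem exists_eq_mul_zpow (hq0 : 0 < q) (hζm : ζm < 0) (hζp : 0 < ζp) {x y : ℝ}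
    (hx : x ∈ lattice q ζm ζp) (hy : y ∈ lattice q ζm ζp) (hxy : 0 < x * y) :
    ∃ m : ℤ, y = x * q ^ m := by
  rcases lattice_sign hq0 hζm hζp hx with ⟨hx, m, rfl⟩ | ⟨hx, m, rfl⟩ <;>
  rcases lattice_sign hq0 hζm hζp hy with ⟨hy, n, rfl⟩ | ⟨hy, n, rfl⟩
  · exact ⟨n - m, by rw [mul_assoc, ← zpow_add₀ hq0.ne']; congr 2; ring⟩
  · exact absurd hxy (mul_neg_of_neg_of_pos hx hy).not_gt
  · exact absurd hxy (mul_neg_of_pos_of_neg hx hy).not_gt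
  · exact ⟨n - m, by rw [mul_assoc, ← zpow_add₀ hq0.ne']; congr 2; ring⟩

theorem mem_orbit_iff (hq0 : 0 < q) (hq1 : q < 1) (hζm : ζm < 0) (hζp : 0 < ζp) {x y : ℝ}
    (hx : x ∈ lattice q ζm ζp) (hy : y ∈ lattice q ζm ζp) :
    (∃ m : ℕ, y = x * q ^ m) ↔ (0 < y ∧ y ≤ x) ∨ (x ≤ y ∧ y < 0) := by
  constructor
  · rintro ⟨m, rfl⟩
    have h1 : q ^ m ≤ 1 := pow_le_one₀ hq0.le hq1.le
    have h2 : 0 < q ^ m := pow_pos hq0 m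
    rcases lattice_sign hq0 hζm hζp hx with ⟨hx, -⟩ | ⟨hx, -⟩
    · exact Or.inr ⟨by nlinarith, mul_neg_of_neg_of_pos hx h2⟩
    · exact Or.inl ⟨mul_pos hx h2, by nlinarith⟩
  · intro h
    have hxy : 0 < x * y := by
      rcases h with h | h
      · exact mul_pos (h.1.trans_le h.2) h.1
      · exact mul_pos_of_neg_of_neg (h.1.trans_lt h.2) h.2
    obtain ⟨m, rfl⟩ := exists_eq_mul_zpow hq0 hζm hζp hx hy hxy
    have hm : q ^ m ≤ 1 := by
      rcases h with h | h
      · have : 0 < x := h.1.trans_le h.2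
        exact (mul_le_iff_le_one_right this).1 h.2
      · have : x < 0 := h.1.trans_lt h.2
        nlinarith [h.1]
    have hm0 : 0 ≤ m := by
      by_contra hneg
      have := one_lt_zpow_of_neg₀ hq0 hq1 (not_le.1 hneg)
      linarith
    lift m to ℕ using hm0
    exact ⟨m, by simp⟩

theorem orbit_injective (hq0 : 0 < q) (hq1 : q < 1) {x : ℝ} (hx : x ≠ 0) :
    Function.Injective fun m : ℤ => x * q ^ m := fun _ _ h =>
  (zpow_right_strictAnti₀ hq0 hq1).injective (mul_left_cancel₀ hx h)

theorem orbit_injective_nat (hq0 : 0 < q) (hq1 : q < 1) {x : ℝ} (hx : x ≠ 0) :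
    Function.Injective fun m : ℕ => x * q ^ m := fun _ _ h =>
  (pow_right_strictAnti₀ hq0 hq1).injective (mul_left_cancel₀ hx h)

theorem hasSum_lattice_of_orbit (hq0 : 0 < q) (hq1 : q < 1) (hζm : ζm < 0) (hζp : 0 < ζp) {x : ℝ}
    (hx : x ∈ lattice q ζm ζp) {g : ℝ → ℝ} {s : ℝ}
    (hg : ∀ y ∈ lattice q ζm ζp, (∀ m : ℕ, y ≠ x * q ^ m) → g y = 0)
    (hs : HasSum (fun m : ℕ => g (x * q ^ m)) s) :
    HasSum (fun y : lattice q ζm ζp => g y) s := by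
  have hinj : Function.Injective
      (fun m : ℕ => (⟨x * q ^ m, mul_pow_mem_lattice hq0 hx m⟩ : lattice q ζm ζp)) := fun _ _ h =>
    orbit_injective_nat hq0 hq1 (lattice_ne_zero hq0 hζm hζp hx) (congrArg Subtype.val h)
  refine (hinj.hasSum_iff ?_).1 hs
  intro y hy
  refine hg y y.2 fun m hm => hy ⟨m, Subtype.ext hm.symm⟩

/-- A geometric series: up to normalization, the q-integral of a monomial from 0 to x. The orbit is
described by inequalities so that the sum over I(a, b) becomes a difference of two orbit sums. -/
theorem hasSum_orbit_pow (hq0 : 0 < q) (hq1 : q < 1) (hζm : ζm < 0) (hζp : 0 < ζp) {x : ℝ}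
    (hx : x ∈ lattice q ζm ζp) (n : ℕ) :
    HasSum (fun y : lattice q ζm ζp =>
      if (0 < (y : ℝ) ∧ y ≤ x) ∨ (x ≤ y ∧ (y : ℝ) < 0) then (y : ℝ) ^ (n + 1) else 0)
      (x ^ (n + 1) / (1 - q ^ (n + 1))) := by
  refine hasSum_lattice_of_orbit hq0 hq1 hζm hζp hx (g := fun y =>
    if (0 < (y : ℝ) ∧ y ≤ x) ∨ (x ≤ y ∧ (y : ℝ) < 0) then (y : ℝ) ^ (n + 1) else 0) ?_ ?_
  · intro y hy h
    rw [if_neg]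
    rw [← mem_orbit_iff hq0 hq1 hζm hζp hx hy]
    push Not
    exact h
  · have h1 : ∀ m : ℕ, (if (0 < x * q ^ m ∧ x * q ^ m ≤ x) ∨ (x ≤ x * q ^ m ∧ x * q ^ m < 0)
        then (x * q ^ m) ^ (n + 1) else 0) = x ^ (n + 1) * (q ^ (n + 1)) ^ m := by
      intro m
      rw [if_pos ((mem_orbit_iff hq0 hq1 hζm hζp hx (mul_pow_mem_lattice hq0 hx m)).1 ⟨m, rfl⟩)]
      ring
    simp only [h1]
    rw [div_eq_mul_inv]
    exact (hasSum_geometric_of_lt_one (pow_nonneg hq0.le _)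
      (pow_lt_one₀ hq0.le hq1 (by omega))).mul_left _

theorem exists_lattice_bounds (hq0 : 0 < q) (hq1 : q < 1) (hζm : ζm < 0) (hζp : 0 < ζp) (R : ℝ) :
    ∃ a ∈ lattice q ζm ζp, ∃ b ∈ lattice q ζm ζp, a < -R ∧ R < b := by
  have ht : Tendsto (fun n : ℕ => (q⁻¹) ^ n) atTop atTop :=
    tendsto_pow_atTop_atTop_of_one_lt ((one_lt_inv₀ hq0).2 hq1)
  obtain ⟨n, h1, h2⟩ := ((ht.const_mul_atTop hζp).eventually_gt_atTop R |>.and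
    ((ht.const_mul_atTop (neg_pos.2 hζm)).eventually_gt_atTop R)).exists
  refine ⟨ζm * q ^ (-(n : ℤ)), Or.inl ⟨_, rfl⟩, ζp * q ^ (-(n : ℤ)), Or.inr ⟨_, rfl⟩, ?_, ?_⟩
  · rw [zpow_neg, zpow_natCast, ← inv_pow]; linarith
  · rw [zpow_neg, zpow_natCast, ← inv_pow]; linarith

/-- The lattice points in [-R, R] lie on two orbits tending to 0, one started below -R and one above
R. This series dominates the later limits of power sums. -/
theorem summable_lattice_abs (hq0 : 0 < q) (hq1 : q < 1) (hζm : ζm < 0) (hζp : 0 < ζp) (R : ℝ) :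
    Summable fun y : lattice q ζm ζp => if |(y : ℝ)| ≤ R then |(y : ℝ)| else 0 := by
  obtain ⟨a, ha, b, hb, h1, h2⟩ := exists_lattice_bounds hq0 hq1 hζm hζp R
  refine Summable.of_nonneg_of_le (fun y => by split_ifs <;> positivity) (fun y => ?_)
    ((hasSum_orbit_pow hq0 hq1 hζm hζp ha 0).summable.abs.add
      (hasSum_orbit_pow hq0 hq1 hζm hζp hb 0).summable.abs)
  split_ifs with h h3 h4 h4
  · simp
  · simp
  · simp
  · exfalso
    rw [abs_le] at h
    rcases lattice_sign hq0 hζm hζp y.2 with h5 | h5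
    · exact h3 (Or.inr ⟨by linarith, h5.1⟩)
    · exact h4 (Or.inl ⟨h5.1, by linarith⟩)
  all_goals positivity

theorem finite_lattice_annulus (hq0 : 0 < q) (hq1 : q < 1) (hζm : ζm < 0) (hζp : 0 < ζp)
    {ε : ℝ} (hε : 0 < ε) (R : ℝ) : {y ∈ lattice q ζm ζp | ε ≤ |y| ∧ |y| ≤ R}.Finite := by
  have h := (summable_lattice_abs hq0 hq1 hζm hζp R).tendsto_cofinite_zero
  have h2 := (h.eventually_lt_const hε)
  rw [Filter.eventually_cofinite] at h2
  refine (h2.image Subtype.val).subset ?_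
  rintro y ⟨hy, h3, h4⟩
  refine ⟨⟨y, hy⟩, ?_, rfl⟩
  simpa [h4] using h3

/-- For equal signs the quotient y / x is a nontrivial power of q, at distance at least 1 - q from
1; for opposite signs |x - y| is already at least |x|. -/
theorem lattice_gap (hq0 : 0 < q) (hq1 : q < 1) (hζm : ζm < 0) (hζp : 0 < ζp) {x y : ℝ}
    (hx : x ∈ lattice q ζm ζp) (hy : y ∈ lattice q ζm ζp) (hxy : x ≠ y) :
    |x| * (1 - q) ≤ |x - y| := by
  have hx0 := lattice_ne_zero hq0 hζm hζp hx
  have hy0 := lattice_ne_zero hq0 hζm hζp hy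
  rcases lt_or_ge 0 (x * y) with h | h
  · obtain ⟨m, rfl⟩ := exists_eq_mul_zpow hq0 hζm hζp hx hy h
    have : x - x * q ^ m = x * (1 - q ^ m) := by ring
    rw [this, abs_mul]
    refine mul_le_mul_of_nonneg_left ?_ (abs_nonneg _)
    rcases lt_trichotomy m 0 with hm | hm | hm
    · have h1 : q ^ (-1 : ℤ) ≤ q ^ m := (zpow_le_zpow_iff_right_of_lt_one₀ hq0 hq1).2 (by omega)
      rw [zpow_neg_one] at h1
      have h2 : 2 - q ≤ q⁻¹ := by
        rw [inv_eq_one_div, le_div_iff₀ hq0]; nlinarith [sq_nonneg (1 - q)]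
      rw [abs_sub_comm]
      exact le_trans (by linarith) (le_abs_self _)
    · simp [hm] at hxy
    · have h1 : q ^ m ≤ q ^ (1 : ℤ) := (zpow_le_zpow_iff_right_of_lt_one₀ hq0 hq1).2 (by omega)
      rw [zpow_one] at h1
      exact le_trans (by linarith) (le_abs_self _)
  · have h1 : |x| ≤ |x - y| := by
      rw [← sq_le_sq]
      nlinarith [sq_nonneg y]
    nlinarith [abs_nonneg x]

end Lattice

/-! ### Infinite bounded configurations -/

section Config

variable {q ζm ζp : ℝ} {X : Set ℝ}

theorem InfConfig.exists_bound (hX : X ∈ InfConfig q ζm ζp) : ∃ R : ℝ, 0 < R ∧ ∀ x ∈ X, |x| ≤ R := by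
  obtain ⟨-, -, a, b, h⟩ := hX
  refine ⟨max 1 (max (-a) b), by positivity, fun x hx => ?_⟩
  have := h hx
  rw [abs_le]
  constructor
  · have h1 : -a ≤ max 1 (max (-a) b) := le_trans (le_max_left _ _) (le_max_right _ _)
    linarith [this.1]
  · exact this.2.trans (le_trans (le_max_right _ _) (le_max_right _ _))

theorem InfConfig.finite_ge (hq0 : 0 < q) (hq1 : q < 1) (hζm : ζm < 0) (hζp : 0 < ζp)
    (hX : X ∈ InfConfig q ζm ζp) {ε : ℝ} (hε : 0 < ε) : {x ∈ X | ε ≤ |x|}.Finite := by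
  obtain ⟨R, -, hR⟩ := InfConfig.exists_bound hX
  exact (finite_lattice_annulus hq0 hq1 hζm hζp hε R).subset
    fun x hx => ⟨hX.1 hx.1, hx.2, hR x hx.1⟩

theorem InfConfig.exists_lt (hq0 : 0 < q) (hq1 : q < 1) (hζm : ζm < 0) (hζp : 0 < ζp)
    (hX : X ∈ InfConfig q ζm ζp) {ε : ℝ} (hε : 0 < ε) : ∃ x ∈ X, |x| < ε := by
  by_contra! h
  exact hX.2.1 ((InfConfig.finite_ge hq0 hq1 hζm hζp hX hε).subset fun x hx => ⟨hx, h x hx⟩)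

theorem InfConfig.summable_abs (hq0 : 0 < q) (hq1 : q < 1) (hζm : ζm < 0) (hζp : 0 < ζp)
    (hX : X ∈ InfConfig q ζm ζp) : Summable fun x : X => |(x : ℝ)| := by
  obtain ⟨R, -, hR⟩ := InfConfig.exists_bound hX
  have h := (summable_lattice_abs hq0 hq1 hζm hζp R).comp_injective
    (Set.inclusion_injective hX.1)
  refine h.congr fun x => ?_
  simp [hR x x.2]

theorem InfConfig.summable_pow (hq0 : 0 < q) (hq1 : q < 1) (hζm : ζm < 0) (hζp : 0 < ζp)
    (hX : X ∈ InfConfig q ζm ζp) (k : ℕ) : Summable fun x : X => (x : ℝ) ^ (k + 1) := by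
  obtain ⟨R, -, hR⟩ := InfConfig.exists_bound hX
  refine Summable.of_norm_bounded ((InfConfig.summable_abs hq0 hq1 hζm hζp hX).mul_left (R ^ k)) fun x => ?_
  rw [Real.norm_eq_abs, abs_pow, pow_succ]
  gcongr
  exact hR x x.2

/-- The shifted power sums of a configuration. -/
def psumsInf (X : Set ℝ) (k : ℕ) : ℝ := ∑' x : X, (x : ℝ) ^ (k + 1)

/-- An infinite bounded configuration has points arbitrarily close to 0, so 0 lies in its segment.
-/
theorem InfConfig.sInf_le_zero (hq0 : 0 < q) (hq1 : q < 1) (hζm : ζm < 0) (hζp : 0 < ζp)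
    (hX : X ∈ InfConfig q ζm ζp) : sInf X ≤ 0 ∧ 0 ≤ sSup X := by
  obtain ⟨R, hR0, hR⟩ := InfConfig.exists_bound hX
  have hb : BddBelow X := ⟨-R, fun x hx => (abs_le.1 (hR x hx)).1⟩
  have ha : BddAbove X := ⟨R, fun x hx => (abs_le.1 (hR x hx)).2⟩
  constructor
  · refine le_of_forall_pos_le_add fun ε hε => ?_
    obtain ⟨x, hx, hxε⟩ := InfConfig.exists_lt hq0 hq1 hζm hζp hX hε
    linarith [csInf_le hb hx, (abs_lt.1 hxε).2]
  · refine le_of_forall_pos_le_add fun ε hε => ?_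
    obtain ⟨x, hx, hxε⟩ := InfConfig.exists_lt hq0 hq1 hζm hζp hX hε
    linarith [le_csSup ha hx, (abs_lt.1 hxε).1]

end Config

/-! ### A Cauchy–Binet formula for infinite sums -/

theorem hasSum_of_eq {ι : Type*} {f g : ι → ℝ} {a b : ℝ} (h : HasSum f a) (hfg : ∀ x, g x = f x)
    (hab : b = a) : HasSum g b := by
  rw [hab, funext hfg]
  exact h

theorem hasSum_pi_prod {ι : Type*} {K : ℕ} {f : Fin K → ι → ℝ} {a : Fin K → ℝ}
    (h : ∀ i, HasSum (f i) (a i)) :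
    HasSum (fun y : Fin K → ι => ∏ i, f i (y i)) (∏ i, a i) := by
  induction K with
  | zero =>
    have h1 := hasSum_single (f := fun y : Fin 0 → ι => ∏ i, f i (y i)) (fun i => i.elim0)
      fun y hy => absurd (Subsingleton.elim _ _) hy
    rw [Fin.prod_univ_zero]
    rwa [Fin.prod_univ_zero] at h1
  | succ n ih =>
    have h1 := ih (f := fun i => f i.succ) (a := fun i => a i.succ) fun i => h i.succ
    have h2 := summable_mul_of_summable_norm (f := f 0)
      (g := fun y : Fin n → ι => ∏ i : Fin n, f i.succ (y i)) (h 0).summable.norm h1.summable.norm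
    have h3 : HasSum (fun x : ι × (Fin n → ι) => f 0 x.1 * ∏ i : Fin n, f i.succ (x.2 i))
      (a 0 * ∏ i : Fin n, a i.succ) := by
      have e := HasSum.mul_eq (f := f 0) (g := fun y : Fin n → ι => ∏ i : Fin n, f i.succ (y i))
        (h 0) h1 h2.hasSum
      rw [e]
      exact h2.hasSum
    rw [Fin.prod_univ_succ]
    refine (Equiv.hasSum_iff (Fin.consEquiv fun _ : Fin (n + 1) => ι)).1 ?_
    convert h3 using 2 with x
    simp [Fin.prod_univ_succ, Fin.consEquiv]

section Levels

variable {q ζm ζp : ℝ} {K : ℕ}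

theorem Level.particle_mem (Y : Level q ζm ζp K) (i : Fin K) : Y.particle i ∈ Y.1 :=
  Finset.orderEmbOfFin_mem _ _ _

theorem Level.particle_mem_lattice (Y : Level q ζm ζp K) (i : Fin K) :
    Y.particle i ∈ lattice q ζm ζp := Y.2.1 (Y.particle_mem i)

theorem Level.particle_strictMono (Y : Level q ζm ζp K) : StrictMono Y.particle :=
  (Y.1.orderEmbOfFin Y.2.2).strictMono

theorem Level.range_particle (Y : Level q ζm ζp K) : Set.range Y.particle = Y.1 :=
  Finset.range_orderEmbOfFin _ _

theorem Level.image_particle (Y : Level q ζm ζp K) : Finset.univ.image Y.particle = Y.1 := by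
  apply Finset.coe_injective
  rw [Finset.coe_image, Finset.coe_univ, Set.image_univ, Y.range_particle]

/-- The particles as points of the lattice. -/
def Level.point (Y : Level q ζm ζp K) (i : Fin K) : lattice q ζm ζp :=
  ⟨Y.particle i, Y.particle_mem_lattice i⟩

/-- Together with `Level.exists_point_comp` this identifies injective tuples with pairs of a
configuration and a permutation, which turns sums over tuples into sums over configurations. -/
theorem Level.point_comp_injective :
    Function.Injective fun x : Level q ζm ζp K × Equiv.Perm (Fin K) => x.1.point ∘ x.2 := by
  rintro ⟨Y, σ⟩ ⟨Y', σ'⟩ h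
  have h1 : ∀ i, Y.particle (σ i) = Y'.particle (σ' i) := fun i => congrArg Subtype.val (congrFun h i)
  have hY : Y = Y' := by
    apply Subtype.ext
    apply Finset.coe_injective
    rw [← Y.range_particle, ← Y'.range_particle, ← σ.surjective.range_comp Y.particle,
      ← σ'.surjective.range_comp Y'.particle]
    congr 1
    exact funext h1
  subst hY
  congr 1
  ext i
  rw [Y.particle_strictMono.injective (h1 i)]

theorem Level.exists_point_comp {y : Fin K → lattice q ζm ζp} (hy : Function.Injective y) :
    ∃ x : Level q ζm ζp K × Equiv.Perm (Fin K), x.1.point ∘ x.2 = y := by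
  have hy' : Function.Injective fun i => (y i : ℝ) := Subtype.val_injective.comp hy
  let Y : Level q ζm ζp K := ⟨Finset.univ.image fun i => (y i : ℝ), by
    intro z hz
    obtain ⟨i, -, rfl⟩ := Finset.mem_image.1 (Finset.mem_coe.1 hz)
    exact (y i).2, by rw [Finset.card_image_of_injective _ hy']; simp⟩
  have hmem : ∀ i, ∃ j, Y.particle j = y i := by
    intro i
    have : (y i : ℝ) ∈ Set.range Y.particle := by
      rw [Y.range_particle]
      exact Finset.mem_coe.2 (Finset.mem_image_of_mem _ (Finset.mem_univ i))
    exact this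
  choose s hs using hmem
  have hsinj : Function.Injective s := fun a b h => hy' (by simp only; rw [← hs, ← hs, h])
  refine ⟨⟨Y, Equiv.ofBijective s (Finite.injective_iff_bijective.1 hsinj)⟩, ?_⟩
  ext i
  exact hs i

/-- Andréief's identity. Expanding det s gives a sum over all tuples of ∏ φ_i(y_i) · det[ψ_i(y_j)].
Tuples with a repetition drop out because of equal columns, and summing over the orderings of a
configuration rebuilds det[φ_i(y_j)]. -/
theorem hasSum_det_mul_det {φ ψ : Fin K → ℝ → ℝ} {s : Fin K → Fin K → ℝ}
    (h : ∀ i j, HasSum (fun y : lattice q ζm ζp => φ i y * ψ j y) (s i j)) :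
    HasSum (fun Y : Level q ζm ζp K =>
      (Matrix.of fun i j => φ i (Y.particle j)).det * (Matrix.of fun i j => ψ i (Y.particle j)).det)
      (Matrix.of s).det := by
  set G : (Fin K → lattice q ζm ζp) → ℝ := fun y =>
    (∏ i, φ i (y i)) * (Matrix.of fun i j => ψ i (y j)).det with hG
  have h1 : HasSum G (Matrix.of s).det := by
    have h2 : ∀ τ : Equiv.Perm (Fin K), HasSum
        (fun y : Fin K → lattice q ζm ζp =>
          ((τ.sign : ℤ) : ℝ) * ∏ i, (φ i (y i) * ψ (τ i) (y i)))
        (((τ.sign : ℤ) : ℝ) * ∏ i, s i (τ i)) := fun τ =>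
      (hasSum_pi_prod fun i => h i (τ i)).mul_left _
    have h3 := hasSum_sum fun τ (_ : τ ∈ (Finset.univ : Finset (Equiv.Perm (Fin K)))) => h2 τ
    rw [← Matrix.det_transpose, Matrix.det_apply']
    simp only [Matrix.transpose_apply, Matrix.of_apply]
    convert h3 using 2 with y
    simp only [hG, Matrix.det_apply', Finset.mul_sum, Matrix.of_apply, Finset.prod_mul_distrib]
    refine Finset.sum_congr rfl fun τ _ => ?_
    ring
  have h4 : HasSum (fun x : Level q ζm ζp K × Equiv.Perm (Fin K) => G (x.1.point ∘ x.2))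
      (Matrix.of s).det := by
    have h7 : ∀ y ∉ Set.range
        (fun x : Level q ζm ζp K × Equiv.Perm (Fin K) => x.1.point ∘ x.2), G y = 0 := ?_
    · exact (Function.Injective.hasSum_iff Level.point_comp_injective h7).2 h1
    intro y hy
    have hy' : ¬ Function.Injective y := fun hinj => hy (Level.exists_point_comp hinj)
    simp only [Function.Injective, not_forall] at hy'
    obtain ⟨a, b, hab, hne⟩ := hy'
    simp only [hG]
    rw [Matrix.det_zero_of_column_eq hne, mul_zero]
    intro i
    simp [hab]
  have h6 : ∀ Y : Level q ζm ζp K, HasSum (fun σ : Equiv.Perm (Fin K) => G (Y.point ∘ σ))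
      (∑ σ : Equiv.Perm (Fin K), G (Y.point ∘ σ)) := fun Y => hasSum_fintype _
  convert HasSum.prod_fiberwise h4 h6 using 2 with Y
  simp only [hG, Function.comp_apply]
  have h5 : ∀ σ : Equiv.Perm (Fin K),
      (Matrix.of fun i j => ψ i (Y.point (σ j))).det
        = ((σ.sign : ℤ) : ℝ) * (Matrix.of fun i j => ψ i (Y.particle j)).det := fun σ =>
    Matrix.det_permute' σ (Matrix.of fun i j => ψ i (Y.particle j))
  simp only [h5]
  rw [← Matrix.det_transpose (Matrix.of fun i j => φ i (Y.particle j)), Matrix.det_apply',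
    Finset.sum_mul]
  refine Finset.sum_congr rfl fun σ _ => ?_
  simp only [Matrix.transpose_apply, Matrix.of_apply, Level.point]
  ring

end Levels

/-! ### The links in determinantal form -/

section Links

variable {q ζm ζp : ℝ}

open Classical in
/-- The weight `|y|` restricted to the interval `I(a, b)`. -/
def linkWeight (q ζm ζp a b y : ℝ) : ℝ := if y ∈ interval q ζm ζp a b then |y| else 0

theorem interval_subset_Icc {a b : ℝ} : interval q ζm ζp a b ⊆ Set.Icc a b := by
  unfold interval
  split_ifs
  · exact fun y hy => Set.Ico_subset_Icc_self hy.1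
  · exact fun y hy => hy.1
  · exact fun y hy => Set.Ioc_subset_Icc_self hy.1

/-- The half-open conventions ensure this even when b = c: a negative common endpoint is excluded on
the left, a positive one on the right. -/
theorem lt_of_mem_interval {a b c d y z : ℝ} (hb : b ≠ 0) (hbc : b ≤ c) (hcd : c < d)
    (hy : y ∈ interval q ζm ζp a b) (hz : z ∈ interval q ζm ζp c d) : y < z := by
  rcases lt_or_gt_of_ne hb with h | h
  · have h1 := (interval_subset_Icc hz).1
    rw [interval, if_pos h] at hy
    exact hy.1.2.trans_le (hbc.trans h1)
  · have h1 := (interval_subset_Icc hy).2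
    rw [interval, if_neg (by linarith), if_neg (by linarith)] at hz
    exact h1.trans_lt (hbc.trans_lt hz.1.1)

/-- In every sign pattern of a and b, the weight |y| on I(a, b) equals y on the orbit of b minus y
on the orbit of a, endpoints included; the conventions for I(a, b) make this exact. -/
theorem hasSum_linkWeight (hq0 : 0 < q) (hq1 : q < 1) (hζm : ζm < 0) (hζp : 0 < ζp) {a b : ℝ}
    (ha : a ∈ lattice q ζm ζp) (hb : b ∈ lattice q ζm ζp) (hab : a < b) (n : ℕ) :
    HasSum (fun y : lattice q ζm ζp => linkWeight q ζm ζp a b y * (y : ℝ) ^ n)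
      ((b ^ (n + 1) - a ^ (n + 1)) / (1 - q ^ (n + 1))) := by
  rw [sub_div]
  refine hasSum_of_eq ((hasSum_orbit_pow hq0 hq1 hζm hζp hb n).sub
    (hasSum_orbit_pow hq0 hq1 hζm hζp ha n)) (fun y => ?_) rfl
  obtain ⟨y, hy⟩ := y
  simp only [linkWeight]
  have hy0 := lattice_ne_zero hq0 hζm hζp hy
  have ha0 := lattice_ne_zero hq0 hζm hζp ha
  have hb0 := lattice_ne_zero hq0 hζm hζp hb
  rcases lt_or_gt_of_ne hb0 with hb' | hb'
  · have hk : y ∈ interval q ζm ζp a b ↔ a ≤ y ∧ y < b := by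
      rw [interval, if_pos hb']
      simp [hy]
    simp only [hk]
    rcases lt_or_gt_of_ne hy0 with hy' | hy'
    · rw [abs_of_neg hy']
      simp only [hy'.not_gt, false_and, false_or, hy', and_true]
      by_cases h1 : a ≤ y <;> by_cases h2 : b ≤ y
      · simp [h1, h2]
      · simp only [h1, h2, not_le.1 h2, and_self, if_true, if_false]; ring
      · linarith
      · simp [h1, h2]
    · simp [hy', hy'.not_gt, (hb'.trans hy').not_ge, (hb'.trans hy').not_gt,
        ((hab.trans hb').trans hy').not_ge]
  · rcases lt_or_gt_of_ne ha0 with ha' | ha'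
    · have hk : y ∈ interval q ζm ζp a b ↔ a ≤ y ∧ y ≤ b := by
        rw [interval, if_neg hb'.not_gt, if_pos ha']
        simp [hy]
      simp only [hk]
      rcases lt_or_gt_of_ne hy0 with hy' | hy'
      · rw [abs_of_neg hy']
        simp only [hy'.not_gt, false_and, false_or, hy', and_true, (hy'.trans hb').not_ge,
          (hy'.trans hb').le, if_false]
        by_cases h1 : a ≤ y
        · simp only [h1, if_true]; ring
        · simp [h1]
      · rw [abs_of_pos hy']
        simp only [hy', true_and, hy'.not_gt, and_false, or_false, (ha'.trans hy').le,
          (ha'.trans hy').not_ge, if_false, sub_zero]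
        by_cases h1 : y ≤ b
        · simp only [h1, if_true]; ring
        · simp [h1]
    · have hk : y ∈ interval q ζm ζp a b ↔ a < y ∧ y ≤ b := by
        rw [interval, if_neg hb'.not_gt, if_neg ha'.not_gt]
        simp [hy]
      simp only [hk]
      rcases lt_or_gt_of_ne hy0 with hy' | hy'
      · simp [hy', hy'.not_gt, (hy'.trans ha').not_gt, (hy'.trans hb').not_ge,
          (hy'.trans ha').not_ge]
      · rw [abs_of_pos hy']
        simp only [hy', true_and, hy'.not_gt, and_false, or_false]
        by_cases h1 : y ≤ a <;> by_cases h2 : y ≤ b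
        · simp [h1, h2]
        · linarith
        · simp only [h1, h2, not_le.1 h1, and_self, if_true, if_false]; ring
        · simp [h1, h2]

/-- The intervals are disjoint and ordered from left to right, so σ is increasing, and only the
identity is an increasing permutation. -/
theorem interlace_of_perm (hq0 : 0 < q) (hζm : ζm < 0) (hζp : 0 < ζp)
    {N : ℕ} (X : Level q ζm ζp (N + 1)) (Y : Level q ζm ζp N)
    (σ : Equiv.Perm (Fin N)) (h : ∀ i : Fin N, Y.particle i ∈
      interval q ζm ζp (X.particle (σ i).castSucc) (X.particle (σ i).succ)) : σ = 1 := by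
  have hmono : StrictMono σ := by
    intro i j hij
    by_contra hle
    rcases (not_lt.1 hle).lt_or_eq with hlt | heq
    · have h1 := lt_of_mem_interval
        (lattice_ne_zero hq0 hζm hζp (X.particle_mem_lattice _))
        (X.particle_strictMono.monotone (Fin.succ_le_castSucc_iff.2 hlt))
        (X.particle_strictMono (Fin.castSucc_lt_succ)) (h j) (h i)
      exact absurd h1 (Y.particle_strictMono hij).not_gt
    · exact hij.ne' (σ.injective heq)
  have := (hmono.range_inj strictMono_id).1
    (by rw [σ.surjective.range_eq, Function.surjective_id.range_eq])
  exact Equiv.ext fun i => congrFun this i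

/-- Under interlacing the matrix is diagonal. Conversely, a nonzero term of the Leibniz expansion
places the particles in the intervals through a permutation, which must be the identity. -/
theorem det_linkWeight (hq0 : 0 < q) (hζm : ζm < 0) (hζp : 0 < ζp)
    {N : ℕ} (X : Level q ζm ζp (N + 1)) (Y : Level q ζm ζp N) :
    (Matrix.of fun i j => linkWeight q ζm ζp (X.particle i.castSucc) (X.particle i.succ)
      (Y.particle j)).det = by
      classical exact if Interlace X Y then ∏ i, |Y.particle i| else 0 := by
  classical
  split_ifs with h
  · rw [← Matrix.det_diagonal]
    congr 1
    ext i j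
    rw [Matrix.of_apply, Matrix.diagonal_apply, linkWeight]
    split_ifs with h1 h2 h2
    · rw [h2]
    · exfalso
      have h3 := h j
      rcases lt_or_gt_of_ne h2 with hlt | hlt
      · exact lt_irrefl _ (lt_of_mem_interval
          (lattice_ne_zero hq0 hζm hζp (X.particle_mem_lattice _))
          (X.particle_strictMono.monotone (Fin.succ_le_castSucc_iff.2 hlt))
          (X.particle_strictMono (Fin.castSucc_lt_succ)) h1 h3)
      · exact lt_irrefl _ (lt_of_mem_interval
          (lattice_ne_zero hq0 hζm hζp (X.particle_mem_lattice _))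
          (X.particle_strictMono.monotone (Fin.succ_le_castSucc_iff.2 hlt))
          (X.particle_strictMono (Fin.castSucc_lt_succ)) h3 h1)
    · exact absurd (h2 ▸ h j) h1
    · rfl
  · by_contra hne
    rw [Matrix.det_apply] at hne
    obtain ⟨σ, -, hσ⟩ := Finset.exists_ne_zero_of_sum_ne_zero hne
    have hσ' : ∀ i, linkWeight q ζm ζp (X.particle (σ i).castSucc) (X.particle (σ i).succ)
        (Y.particle i) ≠ 0 := by
      intro i hi
      apply hσ
      rw [Finset.prod_eq_zero (Finset.mem_univ i) (by simpa using hi), smul_zero]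
    have hmem : ∀ i : Fin N, Y.particle i ∈
        interval q ζm ζp (X.particle (σ i).castSucc) (X.particle (σ i).succ) := by
      intro i
      by_contra hi
      exact hσ' i (by rw [linkWeight, if_neg hi])
    have h1 := interlace_of_perm hq0 hζm hζp X Y σ hmem
    subst h1
    exact h hmem

theorem prod_Icc_eq_prod_fin (N : ℕ) :
    ∏ k ∈ Finset.Icc 1 N, (1 - q ^ k) = ∏ j : Fin N, (1 - q ^ ((j : ℕ) + 1)) := by
  rw [Fin.prod_univ_eq_prod_range (fun j => 1 - q ^ (j + 1)), Finset.range_eq_Ico,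
    Finset.prod_Ico_add' (fun j => 1 - q ^ j) 0 N 1]
  rfl

theorem link_eq_det (hq0 : 0 < q) (hζm : ζm < 0) (hζp : 0 < ζp)
    {N : ℕ} (X : Level q ζm ζp (N + 1)) (Y : Level q ζm ζp N) :
    link X Y = (∏ j : Fin N, (1 - q ^ ((j : ℕ) + 1))) *
      (vandermonde Y.particle / vandermonde X.particle) *
      (Matrix.of fun i j => linkWeight q ζm ζp (X.particle i.castSucc) (X.particle i.succ)
        (Y.particle j)).det := by
  rw [det_linkWeight hq0 hζm hζp, link, prod_Icc_eq_prod_fin]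
  split_ifs
  · ring
  · ring

theorem vandermonde_pos {N : ℕ} {u : Fin N → ℝ} (hu : StrictMono u) : 0 < vandermonde u :=
  Finset.prod_pos fun _ _ => Finset.prod_pos fun _ hj => sub_pos.2 (hu (Finset.mem_Ioi.1 hj))

theorem one_sub_pow_pos (hq0 : 0 < q) (hq1 : q < 1) (n : ℕ) : 0 < 1 - q ^ (n + 1) :=
  sub_pos.2 (pow_lt_one₀ hq0.le hq1 n.succ_ne_zero)

theorem link_nonneg (hq0 : 0 < q) (hq1 : q < 1) {N : ℕ} (X : Level q ζm ζp (N + 1))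
    (Y : Level q ζm ζp N) : 0 ≤ link X Y := by
  rw [link, prod_Icc_eq_prod_fin]
  split_ifs
  · exact mul_nonneg (mul_nonneg (Finset.prod_nonneg fun _ _ => abs_nonneg _)
      (Finset.prod_nonneg fun _ _ => (one_sub_pow_pos hq0 hq1 _).le))
      (div_nonneg (vandermonde_pos Y.particle_strictMono).le
        (vandermonde_pos X.particle_strictMono).le)
  · exact le_rfl

/-- After transposition, subtract from each row its predecessor; the column of ones becomes (1, 0,
…, 0), and the expansion along it leaves the differences. -/
theorem det_cons_one {N : ℕ} (g : Fin N → ℝ → ℝ) (x : Fin (N + 1) → ℝ) :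
    (Matrix.of fun i j : Fin (N + 1) => (Fin.cons 1 (fun k => g k (x j)) : Fin (N + 1) → ℝ) i).det
      = (Matrix.of fun i j : Fin N => g j (x i.succ) - g j (x i.castSucc)).det := by
  rw [← Matrix.det_transpose]
  set A := (Matrix.of fun i j : Fin (N + 1) =>
    (Fin.cons 1 (fun k => g k (x j)) : Fin (N + 1) → ℝ) i).transpose with hA
  set B : Matrix (Fin (N + 1)) (Fin (N + 1)) ℝ := Matrix.of fun i j =>
    (Fin.cons (A 0 j) (fun k : Fin N => A k.succ j - A k.castSucc j) : Fin (N + 1) → ℝ) i with hB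
  have h1 : A.det = B.det :=
    Matrix.det_eq_of_forall_row_eq_smul_add_pred (fun _ => 1) (fun j => by simp [hB])
      (fun i j => by simp [hB])
  rw [h1, Matrix.det_succ_column_zero, Fin.sum_univ_succ, Finset.sum_eq_zero, add_zero]
  · simp only [hB, hA, Fin.val_zero, pow_zero, one_mul, Matrix.of_apply, Fin.cons_zero,
      Matrix.transpose_apply]
    congr 1
  · intro i _
    simp [hB, hA]

/-- The factor by which one link multiplies a ratio of alternants. -/
def linkFactor (q : ℝ) {N : ℕ} (β : Fin N → ℕ) : ℝ :=
  ∏ j : Fin N, (1 - q ^ ((j : ℕ) + 1)) / (1 - q ^ (β j + 1))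

/-- The exponents `0, α_0 + 1, α_1 + 1, …`. -/
def shiftExp {N : ℕ} (β : Fin N → ℕ) : Fin (N + 1) → ℕ := Fin.cons 0 fun i => β i + 1

/-- The Vandermonde factor of Y in the link cancels the denominator of `altRatio`, leaving a product
of two determinants to which Cauchy–Binet applies. The resulting determinant of differences is, by
`det_cons_one`, an alternant with exponents 0, β_0 + 1, β_1 + 1, …. -/
theorem hasSum_link_mul_altRatio (hq0 : 0 < q) (hq1 : q < 1) (hζm : ζm < 0) (hζp : 0 < ζp)
    {N : ℕ} (X : Level q ζm ζp (N + 1)) (β : Fin N → ℕ) :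
    HasSum (fun Y : Level q ζm ζp N => link X Y * altRatio β Y.particle)
      (linkFactor q β * altRatio (shiftExp β) X.particle) := by
  have h1 := hasSum_det_mul_det (q := q) (ζm := ζm) (ζp := ζp)
    (φ := fun i => linkWeight q ζm ζp (X.particle i.castSucc) (X.particle i.succ))
    (ψ := fun j y => y ^ β j) fun i j =>
      hasSum_linkWeight hq0 hq1 hζm hζp (X.particle_mem_lattice i.castSucc)
        (X.particle_mem_lattice i.succ) (X.particle_strictMono (Fin.castSucc_lt_succ)) (β j)
  have h2 := h1.mul_left ((∏ j : Fin N, (1 - q ^ ((j : ℕ) + 1))) / vandermonde X.particle)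
  refine hasSum_of_eq h2 (fun Y => ?_) ?_
  · rw [link_eq_det hq0 hζm hζp, altRatio]
    have := (vandermonde_pos Y.particle_strictMono).ne'
    field_simp
  · have h3 : (Matrix.of fun i j : Fin N => (X.particle i.succ ^ (β j + 1) -
        X.particle i.castSucc ^ (β j + 1)) / (1 - q ^ (β j + 1))).det
        = (∏ j, (1 - q ^ (β j + 1))⁻¹) * (Matrix.of fun i j : Fin N =>
          X.particle i.succ ^ (β j + 1) - X.particle i.castSucc ^ (β j + 1)).det := by
      rw [← Matrix.det_mul_row]
      congr 1
      ext i j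
      simp [div_eq_inv_mul]
    have h4 : (Matrix.of fun i j : Fin (N + 1) => X.particle j ^ shiftExp β i).det
        = (Matrix.of fun i j : Fin N =>
          X.particle i.succ ^ (β j + 1) - X.particle i.castSucc ^ (β j + 1)).det := by
      rw [← det_cons_one (fun j x => x ^ (β j + 1))]
      congr 1
      ext i j
      refine Fin.cases ?_ (fun i => ?_) i
      · simp [shiftExp]
      · simp [shiftExp]
    rw [h3, altRatio, h4, linkFactor, Finset.prod_div_distrib, Finset.prod_inv_distrib]
    ring

end Links

/-! ### Composite links -/

section IterLinks

variable {q ζm ζp : ℝ}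

/-- The exponents `0, …, d - 1, α_0 + d, α_1 + d, …`. -/
def iterShiftExp {K : ℕ} (α : Fin K → ℕ) : (d : ℕ) → Fin (K + d) → ℕ
  | 0 => α
  | d + 1 => shiftExp (iterShiftExp α d)

/-- The factor by which the composite link multiplies a ratio of alternants. -/
def iterLinkFactor (q : ℝ) {K : ℕ} (α : Fin K → ℕ) (d : ℕ) : ℝ :=
  ∏ t ∈ Finset.range d, linkFactor q (iterShiftExp α t)

theorem jacobiTrudi_iterShiftExp {K : ℕ} (p : ℕ → ℝ) (α : Fin K → ℕ) (d : ℕ) :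
    jacobiTrudi p (iterShiftExp α d) = jacobiTrudi p α := by
  induction d with
  | zero => rfl
  | succ d ih => exact (jacobiTrudi_cons p (iterShiftExp α d)).trans ih

theorem Level.altRatio_particle (hq0 : 0 < q) (hζm : ζm < 0) (hζp : 0 < ζp)
    {N : ℕ} (hN : 0 < N) (Y : Level q ζm ζp N) (α : Fin N → ℕ) :
    altRatio α Y.particle = jacobiTrudi (psums Y.1) α := by
  rw [altRatio_eq_jacobiTrudi hN Y.particle_strictMono.injective
    (fun i => lattice_ne_zero hq0 hζm hζp (Y.particle_mem_lattice i)), Y.image_particle]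

theorem iterLink_nonneg (hq0 : 0 < q) (hq1 : q < 1) (K d : ℕ) (X : Level q ζm ζp (K + d))
    (Y : Level q ζm ζp K) : 0 ≤ iterLink K d X Y := by
  induction d with
  | zero =>
    rw [iterLink]
    split_ifs <;> norm_num
  | succ d ih =>
    rw [iterLink]
    exact tsum_nonneg fun Z => mul_nonneg (link_nonneg hq0 hq1 X Z) (ih Z)

theorem abs_le_of_link_ne_zero {N : ℕ} {X : Level q ζm ζp (N + 1)} {Y : Level q ζm ζp N} {R : ℝ}
    (hX : ∀ x ∈ X.1, |x| ≤ R) (h : link X Y ≠ 0) : ∀ y ∈ Y.1, |y| ≤ R := by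
  have hI : Interlace X Y := by
    by_contra hI
    exact h (by rw [link, if_neg hI])
  intro y hy
  obtain ⟨i, rfl⟩ : y ∈ Set.range Y.particle := by rw [Y.range_particle]; exact hy
  have h1 := interval_subset_Icc (hI i)
  have h2 := abs_le.1 (hX _ (X.particle_mem i.castSucc))
  have h3 := abs_le.1 (hX _ (X.particle_mem i.succ))
  exact abs_le.2 ⟨h2.1.trans h1.1, h1.2.trans h3.2⟩

theorem abs_le_of_iterLink_ne_zero {K d : ℕ} {X : Level q ζm ζp (K + d)} {Y : Level q ζm ζp K}
    {R : ℝ} (hX : ∀ x ∈ X.1, |x| ≤ R) (h : iterLink K d X Y ≠ 0) : ∀ y ∈ Y.1, |y| ≤ R := by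
  induction d with
  | zero =>
    rw [iterLink] at h
    have : X = Y := by
      by_contra hne
      exact h (if_neg hne)
    exact this ▸ hX
  | succ d ih =>
    rw [iterLink] at h
    obtain ⟨Z, hZ⟩ : ∃ Z : Level q ζm ζp (K + d), link X Z * iterLink K d Z Y ≠ 0 := by
      by_contra! hall
      exact h (by simp [hall])
    exact ih (abs_le_of_link_ne_zero hX (left_ne_zero_of_mul hZ)) (right_ne_zero_of_mul hZ)

/-- The quotient has a denominator without a uniform lower bound, so it is bounded through
Jacobi–Trudi: the power sums range over a compact product of intervals, on which the determinant is
continuous. -/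
theorem exists_bound_altRatio (hq0 : 0 < q) (hζm : ζm < 0) (hζp : 0 < ζp) {K : ℕ} (hK : 0 < K)
    (α : Fin K → ℕ) (R : ℝ) :
    ∃ B : ℝ, ∀ Y : Level q ζm ζp K, (∀ y ∈ Y.1, |y| ≤ R) → |altRatio α Y.particle| ≤ B := by
  have hcpt : IsCompact (Set.univ.pi fun k : ℕ => Set.Icc (-(K * R ^ (k + 1))) (K * R ^ (k + 1))) :=
    isCompact_univ_pi fun k => isCompact_Icc
  obtain ⟨B, hB⟩ := (hcpt.image (continuous_jacobiTrudi α)).isBounded.exists_norm_le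
  refine ⟨B, fun Y hY => ?_⟩
  rw [Y.altRatio_particle hq0 hζm hζp hK]
  refine hB _ ⟨psums Y.1, ?_, rfl⟩
  intro k _
  rw [Set.mem_Icc, ← abs_le, psums]
  refine (Finset.abs_sum_le_sum_abs _ _).trans ((Finset.sum_le_card_nsmul _ _ (R ^ (k + 1)) ?_).trans
    (by rw [Y.2.2, nsmul_eq_mul]))
  intro y hy
  rw [abs_pow]
  exact pow_le_pow_left₀ (abs_nonneg _) (hY y hy) _

theorem linkFactor_id (hq0 : 0 < q) (hq1 : q < 1) {N : ℕ} :
    linkFactor q (fun i : Fin N => (i : ℕ)) = 1 :=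
  Finset.prod_eq_one fun _ _ => div_self (one_sub_pow_pos hq0 hq1 _).ne'

theorem iterShiftExp_id (K d : ℕ) :
    iterShiftExp (fun i : Fin K => (i : ℕ)) d = fun i : Fin (K + d) => (i : ℕ) := by
  induction d with
  | zero => rfl
  | succ d ih =>
    rw [iterShiftExp, ih, shiftExp]
    ext i
    refine Fin.cases ?_ (fun i => ?_) i
    · simp
    · simp

theorem iterLinkFactor_id (hq0 : 0 < q) (hq1 : q < 1) (K d : ℕ) :
    iterLinkFactor q (fun i : Fin K => (i : ℕ)) d = 1 :=
  Finset.prod_eq_one fun t _ => by rw [iterShiftExp_id, linkFactor_id hq0 hq1]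

theorem altRatio_id {N : ℕ} {u : Fin N → ℝ} (hu : Function.Injective u) :
    altRatio (fun i => (i : ℕ)) u = 1 := by
  rw [altRatio, ← vandermonde_eq_det, div_self (vandermonde_ne_zero hu)]

theorem hasSum_link (hq0 : 0 < q) (hq1 : q < 1) (hζm : ζm < 0) (hζp : 0 < ζp)
    {N : ℕ} (X : Level q ζm ζp (N + 1)) : HasSum (fun Y : Level q ζm ζp N => link X Y) 1 := by
  have h := hasSum_link_mul_altRatio hq0 hq1 hζm hζp X fun i => (i : ℕ)
  have h2 : shiftExp (fun i : Fin N => (i : ℕ)) = fun i : Fin (N + 1) => (i : ℕ) := iterShiftExp_id N 1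
  rw [linkFactor_id hq0 hq1, h2, altRatio_id X.particle_strictMono.injective] at h
  refine hasSum_of_eq h (fun Y => ?_) (by norm_num)
  rw [altRatio_id Y.particle_strictMono.injective, mul_one]

/-- The inductive step, by Fubini for the double sum over Z and Y. Total mass one is a hypothesis,
needed for absolute convergence; the step is thus used first with exponents 0, …, K - 1 to establish
total mass one, then with arbitrary α. -/
theorem hasSum_iterLink_mul_altRatio_of_hasSum_one (hq0 : 0 < q) (hq1 : q < 1) (hζm : ζm < 0)
    (hζp : 0 < ζp) {K d : ℕ} (hK : 0 < K) (X : Level q ζm ζp (K + (d + 1))) (α : Fin K → ℕ)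
    (h1 : ∀ Z : Level q ζm ζp (K + d), HasSum (iterLink K d Z) 1)
    (hα : ∀ Z : Level q ζm ζp (K + d), HasSum (fun Y => iterLink K d Z Y * altRatio α Y.particle)
      (iterLinkFactor q α d * jacobiTrudi (psums Z.1) α)) :
    HasSum (fun Y : Level q ζm ζp K => iterLink K (d + 1) X Y * altRatio α Y.particle)
      (iterLinkFactor q α (d + 1) * jacobiTrudi (psums X.1) α) := by
  -- Any bound on the points of X would do; interlacing hands it down to all lower levels.
  set R : ℝ := ∑ x ∈ X.1, |x| with hR
  have hXR : ∀ x ∈ X.1, |x| ≤ R := fun x hx =>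
    Finset.single_le_sum (f := fun x : ℝ => |x|) (fun _ _ => abs_nonneg _) hx
  obtain ⟨B, hB⟩ := exists_bound_altRatio (q := q) (ζm := ζm) (ζp := ζp) hq0 hζm hζp hK α R
  set F : Level q ζm ζp (K + d) × Level q ζm ζp K → ℝ := fun z =>
    link (N := K + d) X z.1 * (iterLink K d z.1 z.2 * altRatio α z.2.particle) with hF
  have hbound : ∀ z, ‖F z‖ ≤ (link (N := K + d) X z.1 * iterLink K d z.1 z.2) * B := by
    rintro ⟨Z, Y⟩
    have e1 := link_nonneg (N := K + d) hq0 hq1 X Z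
    have e2 := iterLink_nonneg hq0 hq1 K d Z Y
    simp only [hF]
    rw [Real.norm_eq_abs, abs_mul, abs_mul, abs_of_nonneg e1, abs_of_nonneg e2, ← mul_assoc]
    by_cases hz : link (N := K + d) X Z * iterLink K d Z Y = 0
    · rw [hz, zero_mul, zero_mul]
    · refine mul_le_mul_of_nonneg_left (hB Y ?_) (mul_nonneg e1 e2)
      exact abs_le_of_iterLink_ne_zero
        (abs_le_of_link_ne_zero (N := K + d) hXR (left_ne_zero_of_mul hz)) (right_ne_zero_of_mul hz)
  have hsum0 : Summable fun z : Level q ζm ζp (K + d) × Level q ζm ζp K =>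
      link (N := K + d) X z.1 * iterLink K d z.1 z.2 := by
    have e1 : ∀ Z : Level q ζm ζp (K + d), HasSum
        (fun Y => link (N := K + d) X Z * iterLink K d Z Y) (link (N := K + d) X Z) := fun Z =>
      hasSum_of_eq ((h1 Z).mul_left (link (N := K + d) X Z)) (fun _ => rfl) (mul_one _).symm
    refine (summable_prod_of_nonneg fun z => mul_nonneg (link_nonneg (N := K + d) hq0 hq1 X z.1)
      (iterLink_nonneg hq0 hq1 K d z.1 z.2)).2 ⟨fun Z => (e1 Z).summable, ?_⟩
    simp only [(e1 _).tsum_eq]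
    exact (hasSum_link (N := K + d) hq0 hq1 hζm hζp X).summable
  have hsum : Summable F := Summable.of_norm_bounded (hsum0.mul_right B) hbound
  have hval : HasSum (fun Z : Level q ζm ζp (K + d) => link (N := K + d) X Z *
      (iterLinkFactor q α d * jacobiTrudi (psums Z.1) α)) (∑' z, F z) :=
    HasSum.prod_fiberwise hsum.hasSum fun Z => (hα Z).mul_left _
  have hval2 : HasSum (fun Z : Level q ζm ζp (K + d) => link (N := K + d) X Z *
      (iterLinkFactor q α d * jacobiTrudi (psums Z.1) α))
      (iterLinkFactor q α (d + 1) * jacobiTrudi (psums X.1) α) := by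
    refine hasSum_of_eq ((hasSum_link_mul_altRatio (N := K + d) hq0 hq1 hζm hζp X
      (iterShiftExp α d)).mul_left (iterLinkFactor q α d)) (fun Z => ?_) ?_
    · rw [Z.altRatio_particle hq0 hζm hζp (by omega), jacobiTrudi_iterShiftExp]
      ring
    · rw [Level.altRatio_particle (N := K + d + 1) hq0 hζm hζp (by omega) X,
        ← jacobiTrudi_iterShiftExp _ α (d + 1), iterLinkFactor, iterLinkFactor,
        Finset.prod_range_succ, mul_assoc]
      rfl
  rw [← hval.unique hval2]
  have hswap : HasSum (fun z : Level q ζm ζp K × Level q ζm ζp (K + d) => F (z.2, z.1))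
      (∑' z, F z) :=
    (Equiv.hasSum_iff (Equiv.prodComm (Level q ζm ζp K) (Level q ζm ζp (K + d)))).2 hsum.hasSum
  have hinner : ∀ Y, HasSum (fun Z : Level q ζm ζp (K + d) => F (Z, Y))
      (iterLink K (d + 1) X Y * altRatio α Y.particle) := by
    intro Y
    have hs : Summable fun Z : Level q ζm ζp (K + d) =>
        link (N := K + d) X Z * iterLink K d Z Y :=
      hsum0.comp_injective (i := fun Z : Level q ζm ζp (K + d) => (Z, Y))
        fun _ _ h => congrArg Prod.fst h
    refine hasSum_of_eq (hs.hasSum.mul_right (altRatio α Y.particle)) (fun Z => ?_) ?_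
    · simp only [hF]; ring
    · rw [iterLink]
  exact HasSum.prod_fiberwise hswap hinner

theorem hasSum_iterLink (hq0 : 0 < q) (hq1 : q < 1) (hζm : ζm < 0) (hζp : 0 < ζp) {K : ℕ}
    (hK : 0 < K) (d : ℕ) (X : Level q ζm ζp (K + d)) :
    HasSum (fun Y : Level q ζm ζp K => iterLink K d X Y) 1 := by
  induction d with
  | zero =>
    refine hasSum_of_eq (hasSum_ite_eq X (1 : ℝ)) (fun Y => ?_) rfl
    rw [iterLink]
    by_cases h : X = Y
    · rw [if_pos h, if_pos h.symm]
    · rw [if_neg h, if_neg fun h' => h h'.symm]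
  | succ d ih =>
    have h := hasSum_iterLink_mul_altRatio_of_hasSum_one hq0 hq1 hζm hζp hK X (fun i => (i : ℕ)) ih
      fun Z => hasSum_of_eq (ih Z)
        (fun Y => by rw [altRatio_id Y.particle_strictMono.injective, mul_one])
        (by rw [iterLinkFactor_id hq0 hq1, jacobiTrudi_id, mul_one])
    refine hasSum_of_eq h
        (fun Y => by rw [altRatio_id Y.particle_strictMono.injective, mul_one])
        (by rw [iterLinkFactor_id hq0 hq1, jacobiTrudi_id, mul_one])

theorem hasSum_iterLink_mul_altRatio (hq0 : 0 < q) (hq1 : q < 1) (hζm : ζm < 0) (hζp : 0 < ζp)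
    {K : ℕ} (hK : 0 < K) (α : Fin K → ℕ) (d : ℕ) (X : Level q ζm ζp (K + d)) :
    HasSum (fun Y : Level q ζm ζp K => iterLink K d X Y * altRatio α Y.particle)
      (iterLinkFactor q α d * jacobiTrudi (psums X.1) α) := by
  induction d with
  | zero =>
    have h := hasSum_single (f := fun Y : Level q ζm ζp K =>
      iterLink K 0 X Y * altRatio α Y.particle) X fun Y hY => by
        rw [iterLink, if_neg fun h => hY h.symm, zero_mul]
    refine hasSum_of_eq h (fun _ => rfl) ?_
    rw [iterLink, if_pos rfl, one_mul, iterLinkFactor, Finset.prod_range_zero, one_mul]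
    exact (X.altRatio_particle hq0 hζm hζp hK α).symm
  | succ d ih =>
    exact hasSum_iterLink_mul_altRatio_of_hasSum_one hq0 hq1 hζm hζp hK X α
      (hasSum_iterLink hq0 hq1 hζm hζp hK d) ih

/-! ### The limit of the factors -/

/-- The product `(1 - q) (1 - q²) ⋯ (1 - qⁿ)`. -/
def qfac (q : ℝ) (n : ℕ) : ℝ := ∏ k ∈ Finset.range n, (1 - q ^ (k + 1))

theorem qfac_pos (hq0 : 0 < q) (hq1 : q < 1) (n : ℕ) : 0 < qfac q n :=
  Finset.prod_pos fun _ _ => one_sub_pow_pos hq0 hq1 _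

theorem linkFactor_iterShiftExp (hq0 : 0 < q) (hq1 : q < 1) {K : ℕ} (α : Fin K → ℕ) (d : ℕ) :
    linkFactor q (iterShiftExp α d) =
      ∏ j : Fin K, (1 - q ^ ((j : ℕ) + d + 1)) / (1 - q ^ (α j + d + 1)) := by
  -- The shift s is kept general because removing the leading exponent 0, whose factor is 1, raises
  -- all the remaining exponents by one.
  have key : ∀ s : ℕ, ∏ j : Fin (K + d), (1 - q ^ ((j : ℕ) + s + 1)) /
      (1 - q ^ (iterShiftExp α d j + s + 1)) =
      ∏ j : Fin K, (1 - q ^ ((j : ℕ) + (d + s) + 1)) / (1 - q ^ (α j + (d + s) + 1)) := by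
    induction d with
    | zero => intro s; simp [iterShiftExp]
    | succ d ih =>
      intro s
      have h := ih (s + 1)
      have e : ∏ j : Fin (K + (d + 1)), (1 - q ^ ((j : ℕ) + s + 1)) /
          (1 - q ^ (iterShiftExp α (d + 1) j + s + 1)) =
          ∏ j : Fin (K + d + 1), (1 - q ^ ((j : ℕ) + s + 1)) /
          (1 - q ^ (shiftExp (iterShiftExp α d) j + s + 1)) := rfl
      rw [e, Fin.prod_univ_succ]
      simp only [shiftExp, Fin.cons_zero, Fin.cons_succ, Fin.val_zero, Fin.val_succ]
      rw [div_self (by rw [zero_add]; exact (one_sub_pow_pos hq0 hq1 s).ne'), one_mul]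
      convert h using 3 <;> · congr 2; ring
  have := key 0
  simpa [linkFactor] using this

theorem iterLinkFactor_eq (hq0 : 0 < q) (hq1 : q < 1) {K : ℕ} (α : Fin K → ℕ) (d : ℕ) :
    iterLinkFactor q α d = ∏ j : Fin K, (qfac q (d + j) / qfac q (d + α j)) *
      (qfac q (α j) / qfac q j) := by
  have h : ∀ a d : ℕ, ∏ t ∈ Finset.range d, (1 - q ^ (a + t + 1)) = qfac q (d + a) / qfac q a := by
    intro a d
    rw [eq_div_iff (qfac_pos hq0 hq1 a).ne', mul_comm, add_comm d a, qfac, qfac,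
      Finset.prod_range_add]
  rw [iterLinkFactor]
  simp only [linkFactor_iterShiftExp hq0 hq1]
  rw [Finset.prod_comm]
  refine Finset.prod_congr rfl fun j _ => ?_
  rw [Finset.prod_div_distrib, h, h]
  have := (qfac_pos hq0 hq1 (α j)).ne'
  have := (qfac_pos hq0 hq1 j).ne'
  have := (qfac_pos hq0 hq1 (d + α j)).ne'
  field_simp

/-- The limit of the factors of the composite links. -/
def limitFactor (q : ℝ) {K : ℕ} (α : Fin K → ℕ) : ℝ := ∏ j : Fin K, qfac q (α j) / qfac q j

theorem limitFactor_pos (hq0 : 0 < q) (hq1 : q < 1) {K : ℕ} (α : Fin K → ℕ) :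
    0 < limitFactor q α :=
  Finset.prod_pos fun _ _ => div_pos (qfac_pos hq0 hq1 _) (qfac_pos hq0 hq1 _)

theorem tendsto_iterLinkFactor (hq0 : 0 < q) (hq1 : q < 1) {K : ℕ} (α : Fin K → ℕ) :
    Tendsto (iterLinkFactor q α) atTop (𝓝 (limitFactor q α)) := by
  have h1 : ∀ a : ℕ, Tendsto (fun d => qfac q (d + a) / qfac q d) atTop (𝓝 1) := by
    intro a
    have e : ∀ d, qfac q (d + a) / qfac q d = ∏ k ∈ Finset.range a, (1 - q ^ (d + k + 1)) := by
      intro d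
      rw [div_eq_iff (qfac_pos hq0 hq1 d).ne', mul_comm, qfac, qfac, Finset.prod_range_add]
    simp only [e]
    have h3 : ∀ k ∈ Finset.range a, Tendsto (fun d : ℕ => 1 - q ^ (d + k + 1)) atTop
        (𝓝 (1 - 0)) := fun k _ => tendsto_const_nhds.sub
      ((tendsto_pow_atTop_nhds_zero_of_lt_one hq0.le hq1).comp (tendsto_add_atTop_nat (k + 1)))
    simpa using tendsto_finsetProd _ h3
  have h2 : ∀ d, iterLinkFactor q α d = ∏ j : Fin K, ((qfac q (d + j) / qfac q d) /
      (qfac q (d + α j) / qfac q d)) * (qfac q (α j) / qfac q j) := by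
    intro d
    rw [iterLinkFactor_eq hq0 hq1]
    refine Finset.prod_congr rfl fun j _ => ?_
    rw [div_div_div_cancel_right₀ (qfac_pos hq0 hq1 d).ne']
  rw [show iterLinkFactor q α = _ from funext h2]
  refine tendsto_finsetProd _ fun j _ => ?_
  have := ((h1 j).div (h1 (α j)) one_ne_zero).mul_const (qfac q (α j) / qfac q j)
  simpa using this

end IterLinks

/-! ### Euler's distribution on `{qᵐ}` -/

section Euler

variable {q : ℝ}

/-- `∑ₘ zᵐ / (q; q)ₘ` at `z = qⁿ⁺¹`. -/
def eulerSum (q : ℝ) (n : ℕ) : ℝ := ∑' m : ℕ, (q ^ (n + 1)) ^ m / qfac q m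

theorem qfac_succ (n : ℕ) : qfac q (n + 1) = qfac q n * (1 - q ^ (n + 1)) :=
  Finset.prod_range_succ _ _

theorem summable_eulerSum (hq0 : 0 < q) (hq1 : q < 1) (n : ℕ) :
    Summable fun m : ℕ => (q ^ (n + 1)) ^ m / qfac q m := by
  have h1 : q ^ (n + 1) < 1 := pow_lt_one₀ hq0.le hq1 n.succ_ne_zero
  refine summable_of_ratio_test_tendsto_lt_one h1
    (Eventually.of_forall fun m => (div_pos (by positivity) (qfac_pos hq0 hq1 m)).ne') ?_
  have h2 : ∀ m : ℕ, ‖(q ^ (n + 1)) ^ (m + 1) / qfac q (m + 1)‖ / ‖(q ^ (n + 1)) ^ m / qfac q m‖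
      = q ^ (n + 1) / (1 - q ^ (m + 1)) := by
    intro m
    have e1 := qfac_pos hq0 hq1 m
    have e2 := one_sub_pow_pos hq0 hq1 m
    rw [← norm_div, qfac_succ, Real.norm_of_nonneg]
    · field_simp
      ring
    · positivity
  simp only [h2]
  have h3 : Tendsto (fun m : ℕ => q ^ (n + 1) / (1 - q ^ (m + 1))) atTop
      (𝓝 (q ^ (n + 1) / (1 - 0))) :=
    tendsto_const_nhds.div (tendsto_const_nhds.sub
      ((tendsto_pow_atTop_nhds_zero_of_lt_one hq0.le hq1).comp (tendsto_add_atTop_nat 1)))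
      (by norm_num)
  simpa using h3

/-- Subtracting the two series puts a factor 1 - qᵐ in the m-th term, which cancels the last factor
of `qfac q m` and shifts the index by one. -/
theorem eulerSum_succ (hq0 : 0 < q) (hq1 : q < 1) (n : ℕ) :
    eulerSum q (n + 1) = (1 - q ^ (n + 1)) * eulerSum q n := by
  have h1 := (summable_eulerSum hq0 hq1 n).hasSum.sub (summable_eulerSum hq0 hq1 (n + 1)).hasSum
  have h2 : HasSum (fun m : ℕ => (q ^ (n + 1)) ^ m / qfac q m - (q ^ (n + 1 + 1)) ^ m / qfac q m)
      (q ^ (n + 1) * eulerSum q n) := by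
    rw [← hasSum_nat_add_iff' 1]
    refine hasSum_of_eq ((summable_eulerSum hq0 hq1 n).hasSum.mul_left (q ^ (n + 1))) (fun m => ?_)
      (by simp [eulerSum])
    have e1 := qfac_pos hq0 hq1 m
    have e2 := one_sub_pow_pos hq0 hq1 m
    rw [qfac_succ]
    field_simp
    ring
  have h3 := h1.unique h2
  change eulerSum q n - eulerSum q (n + 1) = _ at h3
  linarith

theorem eulerSum_zero_pos (hq0 : 0 < q) (hq1 : q < 1) : 0 < eulerSum q 0 := by
  have h := (summable_eulerSum hq0 hq1 0).sum_le_tsum {0} fun m _ =>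
    (div_pos (by positivity) (qfac_pos hq0 hq1 m)).le
  have : (0 : ℝ) < ∑ m ∈ ({0} : Finset ℕ), (q ^ (0 + 1)) ^ m / qfac q m := by simp [qfac]
  exact this.trans_le h

theorem eulerSum_eq (hq0 : 0 < q) (hq1 : q < 1) (n : ℕ) :
    eulerSum q n = qfac q n * eulerSum q 0 := by
  induction n with
  | zero => simp [qfac]
  | succ n ih => rw [eulerSum_succ hq0 hq1, ih, qfac_succ]; ring

/-- The probability distribution on `ℕ` whose moments at `q ^ m` are the products `qfac q n`. -/
def eulerWeight (q : ℝ) (m : ℕ) : ℝ := q ^ m / (qfac q m * eulerSum q 0)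

theorem eulerWeight_nonneg (hq0 : 0 < q) (hq1 : q < 1) (m : ℕ) : 0 ≤ eulerWeight q m :=
  div_nonneg (by positivity) (mul_pos (qfac_pos hq0 hq1 m) (eulerSum_zero_pos hq0 hq1)).le

theorem hasSum_eulerWeight (hq0 : 0 < q) (hq1 : q < 1) (n : ℕ) :
    HasSum (fun m => eulerWeight q m * (q ^ m) ^ n) (qfac q n) := by
  have h0 := (eulerSum_zero_pos hq0 hq1).ne'
  refine hasSum_of_eq ((summable_eulerSum hq0 hq1 n).hasSum.mul_right (eulerSum q 0)⁻¹)
    (fun m => ?_) ?_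
  · rw [eulerWeight, ← pow_mul, ← pow_mul]
    have := (qfac_pos hq0 hq1 m).ne'
    field_simp
    ring
  · change _ = eulerSum q n * _
    rw [eulerSum_eq hq0 hq1]
    field_simp

/-- Euler's distribution transported to the points `x, xq, xq², …`. -/
def eulerKernel (q x : ℝ) : ℝ → ℝ := Function.extend (fun m : ℕ => x * q ^ m) (eulerWeight q) 0

theorem eulerKernel_apply (hq0 : 0 < q) (hq1 : q < 1) {x : ℝ} (hx : x ≠ 0) (m : ℕ) :
    eulerKernel q x (x * q ^ m) = eulerWeight q m :=
  (orbit_injective_nat hq0 hq1 hx).extend_apply _ _ m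

theorem eulerKernel_eq_zero {x y : ℝ} (h : ∀ m : ℕ, y ≠ x * q ^ m) : eulerKernel q x y = 0 :=
  Function.extend_apply' _ _ _ fun ⟨m, hm⟩ => h m hm.symm

theorem eulerKernel_nonneg (hq0 : 0 < q) (hq1 : q < 1) {x : ℝ} (hx : x ≠ 0) (y : ℝ) :
    0 ≤ eulerKernel q x y := by
  by_cases h : ∃ m : ℕ, y = x * q ^ m
  · obtain ⟨m, rfl⟩ := h
    rw [eulerKernel_apply hq0 hq1 hx]
    exact eulerWeight_nonneg hq0 hq1 m
  · push Not at h
    rw [eulerKernel_eq_zero h]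

/-- Only homogeneity of h along the orbit of x is assumed, so that both yⁿ and |y|ⁿ are covered; the
latter supplies absolute convergence. -/
theorem hasSum_eulerKernel {ζm ζp : ℝ} (hq0 : 0 < q) (hq1 : q < 1) (hζm : ζm < 0) (hζp : 0 < ζp)
    {x : ℝ} (hx : x ∈ lattice q ζm ζp) (n : ℕ) {h : ℝ → ℝ}
    (hh : ∀ m : ℕ, h (x * q ^ m) = h x * (q ^ m) ^ n) :
    HasSum (fun y : lattice q ζm ζp => eulerKernel q x y * h y) (h x * qfac q n) := by
  refine hasSum_lattice_of_orbit hq0 hq1 hζm hζp hx (g := fun y => eulerKernel q x y * h y) ?_ ?_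
  · intro y _ hy
    rw [eulerKernel_eq_zero hy, zero_mul]
  · refine hasSum_of_eq ((hasSum_eulerWeight hq0 hq1 n).mul_left (h x)) (fun m => ?_) rfl
    rw [eulerKernel_apply hq0 hq1 (lattice_ne_zero hq0 hζm hζp hx), hh]
    ring

end Euler

/-! ### Bounds for the partial fraction coefficients -/

section Coefficients

variable {q ζm ζp : ℝ}

/-- A summable kernel that controls the factors `x / (x - y)`. -/
def gapKernel (q x : ℝ) : ℝ → ℝ :=
  Function.extend (fun m : ℤ => x * q ^ m) (fun m => q ^ m.natAbs / (1 - q)) 0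

theorem summable_gap (hq0 : 0 < q) (hq1 : q < 1) :
    Summable fun m : ℤ => q ^ m.natAbs / (1 - q) := by
  refine Summable.div_const ?_ _
  refine Summable.of_nat_of_neg ?_ ?_
  · simpa using summable_geometric_of_lt_one hq0.le hq1
  · simpa using summable_geometric_of_lt_one hq0.le hq1

theorem gapKernel_nonneg (hq0 : 0 < q) (hq1 : q < 1) {x : ℝ} (hx : x ≠ 0) (y : ℝ) :
    0 ≤ gapKernel q x y := by
  by_cases h : ∃ m : ℤ, x * q ^ m = y
  · obtain ⟨m, rfl⟩ := h
    have e : gapKernel q x (x * q ^ m) = q ^ m.natAbs / (1 - q) :=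
      (orbit_injective hq0 hq1 hx).extend_apply _ _ m
    rw [e]
    exact div_nonneg (by positivity) (by linarith)
  · rw [gapKernel, Function.extend_apply' _ _ _ h]
    rfl

theorem sum_gapKernel_le (hq0 : 0 < q) (hq1 : q < 1) {x : ℝ} (hx : x ≠ 0) (F : Finset ℝ) :
    ∑ y ∈ F, gapKernel q x y ≤ ∑' m : ℤ, q ^ m.natAbs / (1 - q) := by
  have h := (hasSum_extend_zero (orbit_injective hq0 hq1 hx)).2 (summable_gap hq0 hq1).hasSum
  have h2 := sum_le_hasSum F (fun y _ => gapKernel_nonneg hq0 hq1 hx y) h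
  exact h2

theorem inv_one_sub_le_exp (hq1 : q < 1) {u : ℝ} (hu0 : 0 ≤ u) (hu : u ≤ q) :
    1 / (1 - u) ≤ Real.exp (u / (1 - q)) := by
  have h1 : 0 < 1 - u := by linarith
  have h2 : 0 < 1 - q := by linarith
  have h3 : 1 / (1 - u) = 1 + u / (1 - u) := by field_simp; ring
  have h4 : u / (1 - u) ≤ u / (1 - q) := by gcongr
  rw [h3]
  linarith [Real.add_one_le_exp (u / (1 - q))]

/-- For y = xqᵐ put u = q^|m|. The quotient has modulus 1/(1 - u) if m > 0 and u/(1 - u) if m < 0,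
where u = |x|/|y|; moreover 1/(1 - u) ≤ exp(u/(1 - q)). For opposite signs |x - y| is at least both
|x| and |y|. -/
theorem abs_div_sub_le (hq0 : 0 < q) (hq1 : q < 1) (hζm : ζm < 0) (hζp : 0 < ζp) {x y : ℝ}
    (hx : x ∈ lattice q ζm ζp) (hy : y ∈ lattice q ζm ζp) (hxy : y ≠ x) :
    |x / (x - y)| ≤ Real.exp (gapKernel q x y) * if |x| < |y| then |x| / |y| else 1 := by
  have hx0 := lattice_ne_zero hq0 hζm hζp hx
  have hy0 := lattice_ne_zero hq0 hζm hζp hy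
  rcases lt_or_ge 0 (x * y) with h | h
  · obtain ⟨m, rfl⟩ := exists_eq_mul_zpow hq0 hζm hζp hx hy h
    have e : gapKernel q x (x * q ^ m) = q ^ m.natAbs / (1 - q) :=
      (orbit_injective hq0 hq1 hx0).extend_apply _ _ m
    have e2 : x / (x - x * q ^ m) = 1 / (1 - q ^ m) := by
      rw [show x - x * q ^ m = x * (1 - q ^ m) by ring, div_mul_eq_div_div, div_self hx0]
    have hm0 : m ≠ 0 := by rintro rfl; simp at hxy
    have hu : q ^ m.natAbs ≤ q := by
      simpa using pow_le_pow_of_le_one hq0.le hq1.le (show 1 ≤ m.natAbs by omega)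
    have hu0 : 0 < q ^ m.natAbs := pow_pos hq0 _
    have hb := inv_one_sub_le_exp hq1 hu0.le hu
    rw [e, e2, abs_mul, abs_of_pos (zpow_pos hq0 m)]
    rcases lt_or_gt_of_ne hm0 with hm | hm
    · have e3 : q ^ m = (q ^ m.natAbs)⁻¹ := by
        rw [← zpow_natCast, ← zpow_neg]; congr 1; omega
      have h1 : 1 < q ^ m := one_lt_zpow_of_neg₀ hq0 hq1 hm
      rw [if_pos (by nlinarith [abs_pos.2 hx0]), div_mul_eq_div_div, div_self (abs_pos.2 hx0).ne',
        abs_of_neg (one_div_neg.2 (by linarith)), e3]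
      have hv : q ^ m.natAbs ≠ 0 := hu0.ne'
      have hv1 : 1 - q ^ m.natAbs ≠ 0 := by linarith
      have e4 : -(1 / (1 - (q ^ m.natAbs)⁻¹)) = 1 / (1 - q ^ m.natAbs) * q ^ m.natAbs := by
        have hv2 : 1 - (q ^ m.natAbs)⁻¹ ≠ 0 := by rw [← e3]; linarith
        have hv3 : q ^ m.natAbs - 1 ≠ 0 := by linarith
        have e5 : 1 - (q ^ m.natAbs)⁻¹ = -(1 - q ^ m.natAbs) * (q ^ m.natAbs)⁻¹ := by
          field_simp
          ring
        rw [e5]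
        field_simp
      rw [e4, one_div (q ^ m.natAbs)⁻¹, inv_inv]
      exact mul_le_mul_of_nonneg_right hb hu0.le
    · have e3 : q ^ m = q ^ m.natAbs := by
        rw [← zpow_natCast]; congr 1; omega
      rw [e3, abs_of_pos (one_div_pos.2 (by linarith)), if_neg, mul_one]
      · exact hb
      · nlinarith [abs_pos.2 hx0]
  · have h1 : 1 ≤ Real.exp (gapKernel q x y) :=
      Real.one_le_exp (gapKernel_nonneg hq0 hq1 hx0 y)
    have h2 : |x| ≤ |x - y| := by
      rw [← sq_le_sq]; nlinarith [sq_nonneg y]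
    have h3 : |y| ≤ |x - y| := by
      rw [← sq_le_sq]; nlinarith [sq_nonneg x]
    rw [abs_div]
    refine le_trans ?_ (le_mul_of_one_le_left (by split_ifs <;> positivity) h1)
    split_ifs
    · exact div_le_div_of_nonneg_left (abs_nonneg _) (abs_pos.2 hy0) h3
    · exact div_le_one_of_le₀ h2 (abs_nonneg _)

theorem abs_lagrangeCoeff_le (hq0 : 0 < q) (hq1 : q < 1) (hζm : ζm < 0) (hζp : 0 < ζp) {x : ℝ}
    (hx : x ∈ lattice q ζm ζp) {F : Finset ℝ} (hF : (F : Set ℝ) ⊆ lattice q ζm ζp) :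
    |lagrangeCoeff F x| ≤ Real.exp (∑' m : ℤ, q ^ m.natAbs / (1 - q)) *
      ∏ y ∈ F.erase x, if |x| < |y| then |x| / |y| else 1 := by
  rw [lagrangeCoeff, Finset.abs_prod]
  calc ∏ y ∈ F.erase x, |x / (x - y)|
      ≤ ∏ y ∈ F.erase x, (Real.exp (gapKernel q x y) * if |x| < |y| then |x| / |y| else 1) :=
        Finset.prod_le_prod (fun _ _ => abs_nonneg _) fun y hy =>
          abs_div_sub_le hq0 hq1 hζm hζp hx (hF (Finset.mem_of_mem_erase hy))
            (Finset.ne_of_mem_erase hy)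
    _ = Real.exp (∑ y ∈ F.erase x, gapKernel q x y) *
        ∏ y ∈ F.erase x, if |x| < |y| then |x| / |y| else 1 := by
        rw [Finset.prod_mul_distrib, Real.exp_sum]
    _ ≤ _ := by
        refine mul_le_mul_of_nonneg_right (Real.exp_le_exp.2
          (sum_gapKernel_le hq0 hq1 (lattice_ne_zero hq0 hζm hζp hx) _))
          (Finset.prod_nonneg fun y _ => by split_ifs <;> positivity)

/-- Fix k points of X, all of modulus at least δ. If |x| < δ, each contributes a factor at most
|x|/δ and the other factors are at most 1; if |x| ≥ δ, then (|x|/δ)^k is at least 1. The exponential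
factor is bounded uniformly in x and F. -/
theorem exists_abs_lagrangeCoeff_le (hq0 : 0 < q) (hq1 : q < 1) (hζm : ζm < 0) (hζp : 0 < ζp)
    {X : Set ℝ} (hX : X ∈ InfConfig q ζm ζp) (k : ℕ) :
    ∃ C : ℝ, 0 ≤ C ∧ ∀ᶠ F : Finset X in atTop, ∀ x ∈ X,
      |lagrangeCoeff (F.map (Function.Embedding.subtype _)) x| ≤ C * |x| ^ k := by
  have : Infinite X := hX.2.1.to_subtype
  obtain ⟨G, hG⟩ := Infinite.exists_subset_card_eq X k
  obtain ⟨δ, hδ, hGδ⟩ : ∃ δ : ℝ, 0 < δ ∧ ∀ y ∈ G, δ ≤ |(y : ℝ)| := by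
    rcases G.eq_empty_or_nonempty with rfl | hne
    · exact ⟨1, one_pos, by simp⟩
    · obtain ⟨y, hy, hmin⟩ := G.exists_min_image (fun y : X => |(y : ℝ)|) hne
      exact ⟨|(y : ℝ)|, abs_pos.2 (lattice_ne_zero hq0 hζm hζp (hX.1 y.2)), hmin⟩
  refine ⟨Real.exp (∑' m : ℤ, q ^ m.natAbs / (1 - q)) * (δ⁻¹) ^ k, by positivity, ?_⟩
  filter_upwards [eventually_ge_atTop G] with F hF x hx
  have hFL : ((F.map (Function.Embedding.subtype _) : Finset ℝ) : Set ℝ) ⊆ lattice q ζm ζp := by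
    intro y hy
    obtain ⟨z, -, rfl⟩ := Finset.mem_map.1 (Finset.mem_coe.1 hy)
    exact hX.1 z.2
  refine (abs_lagrangeCoeff_le hq0 hq1 hζm hζp (hX.1 hx) hFL).trans ?_
  rw [mul_assoc, ← mul_pow]
  refine mul_le_mul_of_nonneg_left ?_ (Real.exp_pos _).le
  have hfac0 : ∀ y : ℝ, 0 ≤ if |x| < |y| then |x| / |y| else 1 := fun y => by
    split_ifs <;> positivity
  have hfac1 : ∀ y : ℝ, (if |x| < |y| then |x| / |y| else 1) ≤ 1 := fun y => by
    split_ifs with h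
    · exact div_le_one_of_le₀ h.le (abs_nonneg _)
    · exact le_rfl
  rcases lt_or_ge |x| δ with hlt | hge
  · have hsub : G.map (Function.Embedding.subtype _) ⊆
        (F.map (Function.Embedding.subtype _)).erase x := by
      intro y hy
      obtain ⟨z, hz, rfl⟩ := Finset.mem_map.1 hy
      refine Finset.mem_erase.2 ⟨?_, Finset.mem_map.2 ⟨z, hF hz, rfl⟩⟩
      rintro rfl
      exact absurd (hGδ z hz) (not_le.2 hlt)
    rw [← Finset.prod_sdiff hsub]
    refine (mul_le_of_le_one_left (Finset.prod_nonneg fun y _ => hfac0 y)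
      (Finset.prod_le_one (fun y _ => hfac0 y) fun y _ => hfac1 y)).trans ?_
    rw [Finset.prod_map, ← hG, ← Finset.prod_const]
    refine Finset.prod_le_prod (fun y _ => hfac0 y) fun y hy => ?_
    have h1 := hGδ y hy
    refine (if_pos (hlt.trans_le h1)).le.trans ?_
    rw [div_eq_inv_mul]
    exact mul_le_mul_of_nonneg_right (inv_anti₀ hδ h1) (abs_nonneg _)
  · refine (Finset.prod_le_one (fun y _ => hfac0 y) fun y _ => hfac1 y).trans ?_
    apply one_le_pow₀
    rw [inv_mul_eq_div, one_le_div hδ]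
    exact hge

/-- The infinite product `∏_{y ∈ X, y ≠ x} x / (x - y)`. -/
def limitCoeff (X : Set ℝ) (x : ℝ) : ℝ := ∏' y : X, if (y : ℝ) = x then 1 else x / (x - y)

/-- Write x/(x - y) = 1 + y/(x - y). By `lattice_gap` the second term is at most |y| divided by a
positive constant depending on x, and the |y| are summable. -/
theorem tendsto_lagrangeCoeff (hq0 : 0 < q) (hq1 : q < 1) (hζm : ζm < 0) (hζp : 0 < ζp)
    {X : Set ℝ} (hX : X ∈ InfConfig q ζm ζp) {x : ℝ} (hx : x ∈ X) :
    Tendsto (fun F : Finset X => lagrangeCoeff (F.map (Function.Embedding.subtype _)) x) atTop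
      (𝓝 (limitCoeff X x)) := by
  have hx0 := lattice_ne_zero hq0 hζm hζp (hX.1 hx)
  have hpos : 0 < |x| * (1 - q) := mul_pos (abs_pos.2 hx0) (by linarith)
  have h1 : Multipliable fun y : X => if (y : ℝ) = x then 1 else x / (x - y) := by
    have h2 : Summable fun y : X => if (y : ℝ) = x then (0 : ℝ) else y / (x - y) := by
      refine Summable.of_norm_bounded
        ((InfConfig.summable_abs hq0 hq1 hζm hζp hX).div_const (|x| * (1 - q))) fun y => ?_
      split_ifs with h
      · rw [norm_zero]; positivity
      · rw [Real.norm_eq_abs, abs_div]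
        exact div_le_div_of_nonneg_left (abs_nonneg _) hpos
          (lattice_gap hq0 hq1 hζm hζp (hX.1 hx) (hX.1 y.2) (Ne.symm h))
    refine (multipliable_one_add_of_summable h2.norm).congr fun y => ?_
    split_ifs with h
    · rw [add_zero]
    · have : x - y ≠ 0 := sub_ne_zero.2 (Ne.symm h)
      field_simp
      ring
  refine h1.hasProd.congr fun F => ?_
  rw [lagrangeCoeff]
  have e : ∏ y ∈ (F.map (Function.Embedding.subtype (· ∈ X))).erase x, x / (x - y) =
      ∏ y ∈ (F.map (Function.Embedding.subtype (· ∈ X))).erase x,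
        if y = x then 1 else x / (x - y) :=
    Finset.prod_congr rfl fun y hy => by rw [if_neg (Finset.ne_of_mem_erase hy)]
  rw [e, Finset.prod_erase (f := fun y : ℝ => if y = x then 1 else x / (x - y)) _ (if_pos rfl),
    Finset.prod_map]
  rfl

theorem tendsto_psums (hq0 : 0 < q) (hq1 : q < 1) (hζm : ζm < 0) (hζp : 0 < ζp)
    {X : Set ℝ} (hX : X ∈ InfConfig q ζm ζp) :
    Tendsto (fun F : Finset X => psums (F.map (Function.Embedding.subtype _))) atTop
      (𝓝 (psumsInf X)) := by
  rw [tendsto_pi_nhds]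
  intro k
  refine ((InfConfig.summable_pow hq0 hq1 hζm hζp hX k).hasSum).congr fun F => ?_
  rw [psums, Finset.sum_map]
  rfl

theorem exists_abs_limitCoeff_le (hq0 : 0 < q) (hq1 : q < 1) (hζm : ζm < 0) (hζp : 0 < ζp)
    {X : Set ℝ} (hX : X ∈ InfConfig q ζm ζp) (k : ℕ) :
    ∃ C : ℝ, 0 ≤ C ∧ ∀ x ∈ X, |limitCoeff X x| ≤ C * |x| ^ k := by
  obtain ⟨C, hC0, hC⟩ := exists_abs_lagrangeCoeff_le hq0 hq1 hζm hζp hX k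
  refine ⟨C, hC0, fun x hx => ?_⟩
  exact le_of_tendsto (tendsto_lagrangeCoeff hq0 hq1 hζm hζp hX hx).abs
    (hC.mono fun F hF => hF x hx)

/-- Dominated convergence along the finite subsets of X in the partial fraction formula. Negative
degrees are allowed because the coefficients decay faster than every power. -/
theorem hasSum_limitCoeff_mul_zpow (hq0 : 0 < q) (hq1 : q < 1) (hζm : ζm < 0) (hζp : 0 < ζp)
    {X : Set ℝ} (hX : X ∈ InfConfig q ζm ζp) (m : ℤ) :
    HasSum (fun x : X => limitCoeff X x * (x : ℝ) ^ m) (newtonHZ (psumsInf X) m) := by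
  have : Infinite X := hX.2.1.to_subtype
  have hne : ∀ x : X, (x : ℝ) ≠ 0 := fun x => lattice_ne_zero hq0 hζm hζp (hX.1 x.2)
  -- Decay of order k turns x^m into |x|^(n + 1), a positive power and hence summable over X.
  obtain ⟨n, k, hk⟩ : ∃ n k : ℕ, (k : ℤ) + m = n + 1 :=
    ⟨m.toNat, (-m).toNat + 1, by omega⟩
  obtain ⟨C, hC0, hC⟩ := exists_abs_lagrangeCoeff_le hq0 hq1 hζm hζp hX k
  obtain ⟨C', hC0', hC'⟩ := exists_abs_limitCoeff_le hq0 hq1 hζm hζp hX k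
  have hpsum : Summable fun x : X => |(x : ℝ) ^ (n + 1)| :=
    (InfConfig.summable_pow hq0 hq1 hζm hζp hX n).abs
  have hpow : ∀ x : X, ∀ a c : ℝ, |a| ≤ c * |(x : ℝ)| ^ k →
      ‖a * (x : ℝ) ^ m‖ ≤ c * |(x : ℝ) ^ (n + 1)| := by
    intro x a c h
    have e : |(x : ℝ) ^ (n + 1)| = |(x : ℝ)| ^ k * |(x : ℝ) ^ m| := by
      rw [abs_zpow, ← zpow_natCast |(x : ℝ)| k, ← zpow_add₀ (abs_pos.2 (hne x)).ne', hk, abs_pow]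
      norm_cast
    rw [Real.norm_eq_abs, abs_mul, e, ← mul_assoc]
    exact mul_le_mul_of_nonneg_right h (abs_nonneg _)
  have hlim := Summable.of_norm_bounded (hpsum.mul_left C') fun x =>
    hpow x (limitCoeff X x) C' (hC' x x.2)
  classical
  have hdom := tendsto_tsum_of_dominated_convergence (𝓕 := (atTop : Filter (Finset X)))
    (f := fun F (x : X) => if x ∈ F then
      lagrangeCoeff (F.map (Function.Embedding.subtype _)) x * (x : ℝ) ^ m else 0)
    (g := fun x : X => limitCoeff X x * (x : ℝ) ^ m)
    (bound := fun x => C * |(x : ℝ) ^ (n + 1)|) (hpsum.mul_left C)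
    (fun x => by
      refine ((tendsto_lagrangeCoeff hq0 hq1 hζm hζp hX x.2).mul_const ((x : ℝ) ^ m)).congr' ?_
      filter_upwards [eventually_ge_atTop {x}] with F hF
      rw [if_pos (hF (Finset.mem_singleton_self x))])
    (by
      filter_upwards [hC] with F hF x
      split_ifs
      · exact hpow x _ C (hF x x.2)
      · rw [norm_zero]; positivity)
  have hlim2 : Tendsto (fun F : Finset X =>
      newtonHZ (psums (F.map (Function.Embedding.subtype _))) m) atTop
      (𝓝 (newtonHZ (psumsInf X) m)) :=
    ((continuous_newtonHZ m).tendsto _).comp (tendsto_psums hq0 hq1 hζm hζp hX)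
  -- The partial fraction formula in degree m requires more than -m points.
  have hcard : ∀ᶠ F : Finset X in atTop, (-m).toNat + 1 ≤ F.card := by
    obtain ⟨G, hG⟩ := Infinite.exists_subset_card_eq X ((-m).toNat + 1)
    filter_upwards [eventually_ge_atTop G] with F hF
    rw [← hG]
    exact Finset.card_le_card hF
  have heq : ∀ᶠ F : Finset X in atTop, newtonHZ (psums (F.map (Function.Embedding.subtype _))) m =
      ∑' x : X, if x ∈ F then
        lagrangeCoeff (F.map (Function.Embedding.subtype _)) x * (x : ℝ) ^ m else 0 := by
    filter_upwards [hcard] with F hF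
    have h0 : (0 : ℝ) ∉ F.map (Function.Embedding.subtype (· ∈ X)) := by
      intro h
      obtain ⟨z, -, hz⟩ := Finset.mem_map.1 h
      exact hne z hz
    have hc : (F.map (Function.Embedding.subtype (· ∈ X))).card = F.card := Finset.card_map _
    rw [← hsum_eq_newtonHZ _ h0 (Finset.card_pos.1 (by omega)) (by omega), hsum, Finset.sum_map,
      tsum_eq_sum (s := F) fun x hx => if_neg hx]
    exact Finset.sum_congr rfl fun x hx => by rw [if_pos hx]; rfl
  have := tendsto_nhds_unique (hlim2.congr' heq) hdom
  rw [this]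
  exact hlim.hasSum

end Coefficients

/-! ### The boundary measure of an infinite configuration -/

section Boundary

variable {q ζm ζp : ℝ} {X : Set ℝ}

/-- The functions whose moments are `qfac q n * h_{n - j}(X)`. -/
def boundaryWeight (q : ℝ) (X : Set ℝ) (j : ℕ) (y : ℝ) : ℝ :=
  ∑' x : X, limitCoeff X x * (x : ℝ) ^ (-(j : ℤ)) * eulerKernel q x y

/-- Fubini: for fixed x the Euler kernel has n-th moment xⁿ · `qfac q n`, and the remaining sum over
x is the partial fraction series in degree n - j. -/
theorem hasSum_boundaryWeight (hq0 : 0 < q) (hq1 : q < 1) (hζm : ζm < 0) (hζp : 0 < ζp)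
    (hX : X ∈ InfConfig q ζm ζp) (j n : ℕ) :
    HasSum (fun y : lattice q ζm ζp => boundaryWeight q X j y * (y : ℝ) ^ n)
      (qfac q n * newtonHZ (psumsInf X) ((n : ℤ) - j)) := by
  have hne : ∀ x : X, (x : ℝ) ≠ 0 := fun x => lattice_ne_zero hq0 hζm hζp (hX.1 x.2)
  set c : X → ℝ := fun x => limitCoeff X x * (x : ℝ) ^ (-(j : ℤ)) with hc
  set F : X × lattice q ζm ζp → ℝ :=
    fun z => c z.1 * (eulerKernel q z.1 z.2 * (z.2 : ℝ) ^ n) with hF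
  have hzpow : ∀ x : X, c x * (x : ℝ) ^ n = limitCoeff X x * (x : ℝ) ^ ((n : ℤ) - j) := by
    intro x
    simp only [hc]
    rw [mul_assoc, ← zpow_natCast, ← zpow_add₀ (hne x), neg_add_eq_sub]
  have hmom := hasSum_limitCoeff_mul_zpow hq0 hq1 hζm hζp hX ((n : ℤ) - j)
  have hrow : ∀ x : X, HasSum (fun y : lattice q ζm ζp => F (x, y))
      (c x * ((x : ℝ) ^ n * qfac q n)) := fun x =>
    (hasSum_eulerKernel hq0 hq1 hζm hζp (hX.1 x.2) n (h := fun y => y ^ n)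
      fun m => mul_pow _ _ _).mul_left (c x)
  have hrowabs : ∀ x : X, HasSum (fun y : lattice q ζm ζp => ‖F (x, y)‖)
      (|c x| * (|(x : ℝ)| ^ n * qfac q n)) := by
    intro x
    refine hasSum_of_eq ((hasSum_eulerKernel hq0 hq1 hζm hζp (hX.1 x.2) n (h := fun y => |y| ^ n)
      fun m => ?_).mul_left |c x|) (fun y => ?_) rfl
    · rw [abs_mul, mul_pow, abs_of_pos (pow_pos hq0 m)]
    · simp only [hF]
      rw [Real.norm_eq_abs, abs_mul, abs_mul (eulerKernel q x y), abs_pow,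
        abs_of_nonneg (eulerKernel_nonneg hq0 hq1 (hne x) y)]
  have hsum : Summable F := by
    refine Summable.of_norm ((summable_prod_of_nonneg fun z => norm_nonneg _).2
      ⟨fun x => (hrowabs x).summable, ?_⟩)
    simp only [(hrowabs _).tsum_eq]
    refine (hmom.summable.abs.mul_right (qfac q n)).congr fun x => ?_
    rw [← hzpow, abs_mul, abs_pow, mul_assoc]
  have htot : HasSum (fun x : X => c x * ((x : ℝ) ^ n * qfac q n)) (∑' z, F z) :=
    HasSum.prod_fiberwise hsum.hasSum hrow
  have htot2 : HasSum (fun x : X => c x * ((x : ℝ) ^ n * qfac q n))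
      (qfac q n * newtonHZ (psumsInf X) ((n : ℤ) - j)) := by
    refine hasSum_of_eq (hmom.mul_left (qfac q n)) (fun x => ?_) rfl
    rw [← hzpow]
    ring
  rw [← htot.unique htot2]
  have hswap : HasSum (fun z : lattice q ζm ζp × X => F (z.2, z.1)) (∑' z, F z) :=
    (Equiv.hasSum_iff (Equiv.prodComm (lattice q ζm ζp) X)).2 hsum.hasSum
  refine HasSum.prod_fiberwise hswap fun y => ?_
  have hs : Summable fun x : X => F (x, y) :=
    hsum.comp_injective (i := fun x : X => (x, y)) fun _ _ h => congrArg Prod.fst h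
  refine hasSum_of_eq hs.hasSum (fun _ => rfl) ?_
  rw [boundaryWeight, ← tsum_mul_right]
  refine tsum_congr fun x => ?_
  simp only [hF, hc]
  ring

/-- The boundary measure on the level `K` in determinantal form. -/
def boundaryMeasure (X : Set ℝ) (K : ℕ) (Y : Level q ζm ζp K) : ℝ :=
  (∏ j : Fin K, (qfac q j)⁻¹) * vandermonde Y.particle *
    (Matrix.of fun i j : Fin K => boundaryWeight q X i (Y.particle j)).det

/-- Cauchy–Binet gives the determinant of `qfac q (α j)` · h_{α_j - i}; taking the column factors
out leaves Jacobi–Trudi, and with the prefactor they form `limitFactor`. -/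
theorem hasSum_boundaryMeasure_mul_altRatio (hq0 : 0 < q) (hq1 : q < 1) (hζm : ζm < 0)
    (hζp : 0 < ζp) (hX : X ∈ InfConfig q ζm ζp) {K : ℕ} (α : Fin K → ℕ) :
    HasSum (fun Y : Level q ζm ζp K => boundaryMeasure X K Y * altRatio α Y.particle)
      (limitFactor q α * jacobiTrudi (psumsInf X) α) := by
  have h1 := hasSum_det_mul_det (q := q) (ζm := ζm) (ζp := ζp)
    (φ := fun i : Fin K => boundaryWeight q X i) (ψ := fun j y => y ^ α j) fun i j =>
      hasSum_boundaryWeight hq0 hq1 hζm hζp hX i (α j)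
  refine hasSum_of_eq (h1.mul_left (∏ j : Fin K, (qfac q j)⁻¹)) (fun Y => ?_) ?_
  · rw [boundaryMeasure, altRatio]
    have := (vandermonde_pos Y.particle_strictMono).ne'
    field_simp
  · have h2 : (Matrix.of fun i j : Fin K =>
        qfac q (α j) * newtonHZ (psumsInf X) ((α j : ℤ) - (i : ℕ))).det =
        (∏ j, qfac q (α j)) * jacobiTrudi (psumsInf X) α := by
      rw [jacobiTrudi, ← Matrix.det_transpose (Matrix.of fun i j : Fin K =>
        newtonHZ (psumsInf X) ((α i : ℤ) - (j : ℕ))), ← Matrix.det_mul_row]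
      rfl
    rw [h2, limitFactor, ← mul_assoc, ← Finset.prod_mul_distrib]
    congr 1
    exact Finset.prod_congr rfl fun j _ => by rw [div_eq_inv_mul]

theorem hasSum_boundaryMeasure (hq0 : 0 < q) (hq1 : q < 1) (hζm : ζm < 0)
    (hζp : 0 < ζp) (hX : X ∈ InfConfig q ζm ζp) (K : ℕ) :
    HasSum (fun Y : Level q ζm ζp K => boundaryMeasure X K Y) 1 := by
  refine hasSum_of_eq (hasSum_boundaryMeasure_mul_altRatio hq0 hq1 hζm hζp hX
    (fun i : Fin K => (i : ℕ))) (fun Y => ?_) ?_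
  · rw [altRatio_id Y.particle_strictMono.injective, mul_one]
  · rw [jacobiTrudi_id, mul_one, limitFactor]
    exact (Finset.prod_eq_one fun j _ => div_self (qfac_pos hq0 hq1 _).ne').symm

/-- A particle outside all the orbits x, xq, xq², … gives a zero column in the determinant. -/
theorem exists_eq_mul_pow_of_boundaryMeasure_ne_zero {K : ℕ} {Y : Level q ζm ζp K}
    (h : boundaryMeasure X K Y ≠ 0) : ∀ y ∈ Y.1, ∃ x ∈ X, ∃ m : ℕ, y = x * q ^ m := by
  intro y hy
  obtain ⟨j, rfl⟩ : y ∈ Set.range Y.particle := by rw [Y.range_particle]; exact hy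
  by_contra! hall
  refine h ?_
  rw [boundaryMeasure, Matrix.det_eq_zero_of_column_eq_zero j, mul_zero]
  intro i
  rw [Matrix.of_apply, boundaryWeight]
  refine (tsum_congr fun x : X => ?_).trans tsum_zero
  rw [eulerKernel_eq_zero (hall x x.2), mul_zero]

theorem vanishesOutside_boundaryMeasure (hq0 : 0 < q) (hq1 : q < 1) (hζm : ζm < 0)
    (hζp : 0 < ζp) (hX : X ∈ InfConfig q ζm ζp) {K : ℕ} (hK : 0 < K) :
    VanishesOutside X (boundaryMeasure (q := q) (ζm := ζm) (ζp := ζp) X K) := by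
  intro Y hY
  by_contra hne
  refine hY ?_
  obtain ⟨R, hR0, hR⟩ := InfConfig.exists_bound hX
  obtain ⟨hinf, hsup⟩ := InfConfig.sInf_le_zero hq0 hq1 hζm hζp hX
  have hb : BddBelow X := ⟨-R, fun x hx => (abs_le.1 (hR x hx)).1⟩
  have ha : BddAbove X := ⟨R, fun x hx => (abs_le.1 (hR x hx)).2⟩
  have hmem : ∀ y ∈ (Y.1 : Set ℝ), y ∈ Set.Icc (sInf X) (sSup X) := by
    intro y hy
    obtain ⟨x, hx, m, rfl⟩ := exists_eq_mul_pow_of_boundaryMeasure_ne_zero hne y hy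
    have h1 := csInf_le hb hx
    have h2 := le_csSup ha hx
    have h3 : q ^ m ≤ 1 := pow_le_one₀ hq0.le hq1.le
    have h4 : 0 < q ^ m := pow_pos hq0 m
    rcases le_total 0 x with h | h
    · exact ⟨hinf.trans (by positivity), (mul_le_of_le_one_right h h3).trans h2⟩
    · exact ⟨h1.trans (by nlinarith), (mul_nonpos_of_nonpos_of_nonneg h h4.le).trans hsup⟩
  have hYne : (Y.1 : Set ℝ).Nonempty := Finset.coe_nonempty.2 (Finset.card_pos.1 (hK.trans_eq Y.2.2.symm))
  refine Set.Icc_subset_Icc ?_ ?_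
  · exact le_csInf hYne fun y hy => (hmem y hy).1
  · exact csSup_le hYne fun y hy => (hmem y hy).2

theorem abs_le_of_segment_subset {R : ℝ} (hR : ∀ x ∈ X, |x| ≤ R) (hX : X.Nonempty) {K : ℕ}
    {Y : Level q ζm ζp K} (h : segment (Y.1 : Set ℝ) ⊆ segment X) : ∀ y ∈ Y.1, |y| ≤ R := by
  intro y hy
  have h1 : y ∈ segment (Y.1 : Set ℝ) :=
    ⟨csInf_le Y.1.finite_toSet.bddBelow hy, le_csSup Y.1.finite_toSet.bddAbove hy⟩
  have h2 := h h1
  exact abs_le.2 ⟨(le_csInf hX fun x hx => (abs_le.1 (hR x hx)).1).trans h2.1,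
    h2.2.trans (csSup_le hX fun x hx => (abs_le.1 (hR x hx)).2)⟩

end Boundary

/-! ### Determinacy by Schur moments -/

section Determinacy

variable {q ζm ζp : ℝ} {K : ℕ}

theorem vandermonde_comp_perm (u : Fin K → ℝ) (σ : Equiv.Perm (Fin K)) :
    vandermonde (u ∘ σ) = ((σ.sign : ℤ) : ℝ) * vandermonde u := by
  rw [vandermonde_eq_det, vandermonde_eq_det, ← Matrix.det_permute']
  rfl

/-- The Vandermonde polynomial. -/
def vandermondePoly (K : ℕ) : MvPolynomial (Fin K) ℝ :=
  ∏ i : Fin K, ∏ j ∈ Finset.Ioi i, (MvPolynomial.X j - MvPolynomial.X i)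

theorem eval_vandermondePoly (u : Fin K → ℝ) :
    MvPolynomial.eval u (vandermondePoly K) = vandermonde u := by
  simp [vandermondePoly, vandermonde, map_prod]

/-- Multiplying by the Vandermonde determinant turns symmetrization of P into antisymmetrization of
the Vandermonde polynomial times P, and each monomial of that product antisymmetrizes to an
alternant. -/
theorem sum_perm_eval_eq {u : Fin K → ℝ} (hu : Function.Injective u)
    (P : MvPolynomial (Fin K) ℝ) :
    ∑ σ : Equiv.Perm (Fin K), MvPolynomial.eval (u ∘ σ) P =
      ∑ d ∈ (vandermondePoly K * P).support, (vandermondePoly K * P).coeff d * altRatio d u := by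
  have h1 : ∀ σ : Equiv.Perm (Fin K), vandermonde u * MvPolynomial.eval (u ∘ σ) P =
      ((σ.sign : ℤ) : ℝ) * MvPolynomial.eval (u ∘ σ) (vandermondePoly K * P) := by
    intro σ
    have hs : ((σ.sign : ℤ) : ℝ) * ((σ.sign : ℤ) : ℝ) = 1 := by
      rcases Int.units_eq_one_or σ.sign with h | h <;> simp [h]
    rw [map_mul, eval_vandermondePoly, vandermonde_comp_perm]
    linear_combination (-(vandermonde u * MvPolynomial.eval (u ∘ σ) P)) * hs
  have hV := vandermonde_ne_zero hu
  apply mul_left_cancel₀ hV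
  rw [Finset.mul_sum, Finset.mul_sum]
  simp only [h1]
  have h2 : ∀ d : Fin K →₀ ℕ, vandermonde u * ((vandermondePoly K * P).coeff d * altRatio d u) =
      (vandermondePoly K * P).coeff d * ∑ σ : Equiv.Perm (Fin K),
        ((σ.sign : ℤ) : ℝ) * ∏ i, u (σ i) ^ d i := by
    intro d
    rw [altRatio, ← Matrix.det_transpose, Matrix.det_apply']
    simp only [Matrix.transpose_apply, Matrix.of_apply]
    field_simp
  simp only [h2, Finset.mul_sum]
  rw [Finset.sum_comm]
  refine Finset.sum_congr rfl fun σ _ => ?_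
  rw [MvPolynomial.eval_eq', Finset.mul_sum]
  refine Finset.sum_congr rfl fun d _ => ?_
  simp only [Function.comp_apply]
  ring

theorem exists_mvPolynomial_near (R : ℝ) {f : (Fin K → ℝ) → ℝ} (hf : Continuous f) {ε : ℝ}
    (hε : 0 < ε) : ∃ P : MvPolynomial (Fin K) ℝ, ∀ u : Fin K → ℝ, (∀ i, |u i| ≤ R) →
      |MvPolynomial.eval u P - f u| < ε := by
  set s : Set (Fin K → ℝ) := Set.univ.pi fun _ => Set.Icc (-R) R with hs
  have : CompactSpace s := isCompact_iff_compactSpace.1 (isCompact_univ_pi fun _ => isCompact_Icc)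
  let coord : Fin K → C(s, ℝ) := fun i => ⟨fun u => u.1 i, (continuous_apply i).comp continuous_subtype_val⟩
  have hsep : (MvPolynomial.aeval coord : MvPolynomial (Fin K) ℝ →ₐ[ℝ] C(s, ℝ)).range.SeparatesPoints
      := by
    intro x y hxy
    obtain ⟨i, hi⟩ : ∃ i, x.1 i ≠ y.1 i := by
      by_contra! h
      exact hxy (Subtype.ext (funext h))
    exact ⟨_, ⟨coord i, ⟨MvPolynomial.X i, by simp⟩, rfl⟩, hi⟩
  obtain ⟨⟨_, P, rfl⟩, hP⟩ := ContinuousMap.exists_mem_subalgebra_near_continuous_of_separatesPoints _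
    hsep (fun u : s => f u) (by fun_prop) ε hε
  refine ⟨P, fun u hu => ?_⟩
  have h1 : ‖(MvPolynomial.aeval coord P) ⟨u, fun i _ => abs_le.1 (hu i)⟩ - f u‖ < ε :=
    hP ⟨u, fun i _ => abs_le.1 (hu i)⟩
  have h2 : ∀ p : MvPolynomial (Fin K) ℝ, (MvPolynomial.aeval coord p)
      ⟨u, fun i _ => abs_le.1 (hu i)⟩ = MvPolynomial.eval u p := by
    intro p
    induction p using MvPolynomial.induction_on with
    | C a => simp
    | add p r hp hr => rw [map_add, map_add, ContinuousMap.add_apply, hp, hr]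
    | mul_X p i hp =>
      rw [map_mul, map_mul, ContinuousMap.mul_apply, hp, MvPolynomial.aeval_X, MvPolynomial.eval_X]
      rfl
  rwa [Real.norm_eq_abs, h2] at h1

/-- A continuous function on tuples that detects a given configuration. -/
theorem exists_bump (hq0 : 0 < q) (hq1 : q < 1) (hζm : ζm < 0) (hζp : 0 < ζp)
    (Y₀ : Level q ζm ζp K) : ∃ f : (Fin K → ℝ) → ℝ, Continuous f ∧ f Y₀.particle = 1 ∧
      ∀ u : Fin K → ℝ, (∀ i, u i ∈ lattice q ζm ζp) → u ≠ Y₀.particle → f u = 0 := by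
  -- By `lattice_gap`, every other lattice tuple is at sup-distance at least δ.
  obtain ⟨δ, hδ, hδ'⟩ : ∃ δ : ℝ, 0 < δ ∧ ∀ i, δ ≤ |Y₀.particle i| * (1 - q) := by
    have hpos : ∀ i, 0 < |Y₀.particle i| * (1 - q) := fun i =>
      mul_pos (abs_pos.2 (lattice_ne_zero hq0 hζm hζp (Y₀.particle_mem_lattice i))) (by linarith)
    rcases isEmpty_or_nonempty (Fin K) with h | h
    · exact ⟨1, one_pos, fun i => h.elim i⟩
    · obtain ⟨i, hi⟩ := Finite.exists_min fun i => |Y₀.particle i| * (1 - q)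
      exact ⟨_, hpos i, hi⟩
  refine ⟨fun u => max 0 (1 - dist u Y₀.particle / δ), by fun_prop, by simp, fun u hu hne => ?_⟩
  obtain ⟨i, hi⟩ : ∃ i, u i ≠ Y₀.particle i := by
    by_contra! h
    exact hne (funext h)
  have h1 := lattice_gap hq0 hq1 hζm hζp (Y₀.particle_mem_lattice i) (hu i) hi.symm
  have h2 := dist_le_pi_dist u Y₀.particle i
  rw [dist_comm, Real.dist_eq] at h2
  have h3 : 1 ≤ dist u Y₀.particle / δ := by
    rw [one_le_div hδ]
    linarith [hδ' i]
  exact max_eq_left (by linarith)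

theorem sum_perm_bump {Y₀ : Level q ζm ζp K} {f : (Fin K → ℝ) → ℝ} (h1 : f Y₀.particle = 1)
    (h0 : ∀ u : Fin K → ℝ, (∀ i, u i ∈ lattice q ζm ζp) → u ≠ Y₀.particle → f u = 0)
    (Y : Level q ζm ζp K) :
    ∑ σ : Equiv.Perm (Fin K), f (Y.particle ∘ σ) = by
      classical exact if Y = Y₀ then 1 else 0 := by
  classical
  have hinj : ∀ σ : Equiv.Perm (Fin K), Y.particle ∘ σ = Y₀.particle → Y = Y₀ ∧ σ = 1 := by
    intro σ h
    have := @Level.point_comp_injective q ζm ζp K ⟨Y, σ⟩ ⟨Y₀, 1⟩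
      (funext fun i => Subtype.ext (congrFun h i))
    exact ⟨congrArg Prod.fst this, congrArg Prod.snd this⟩
  have hz : ∀ σ : Equiv.Perm (Fin K), Y.particle ∘ σ ≠ Y₀.particle → f (Y.particle ∘ σ) = 0 :=
    fun σ => h0 _ fun i => Y.particle_mem_lattice (σ i)
  split_ifs with hY
  · subst hY
    rw [Finset.sum_eq_single 1]
    · exact h1
    · exact fun σ _ hσ => hz σ fun h => hσ (hinj σ h).2
    · simp
  · exact Finset.sum_eq_zero fun σ _ => hz σ fun h => hY (hinj σ h).1

theorem summable_mul_of_bound_on_support {ι : Type*} {D g : ι → ℝ} {B : ℝ}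
    (hD : Summable fun i => |D i|) (hg : ∀ i, D i ≠ 0 → |g i| ≤ B) :
    Summable (fun i => D i * g i) ∧ |∑' i, D i * g i| ≤ (∑' i, |D i|) * B := by
  have h : ∀ i, ‖D i * g i‖ ≤ |D i| * B := by
    intro i
    rw [Real.norm_eq_abs, abs_mul]
    by_cases hi : D i = 0
    · simp [hi]
    · exact mul_le_mul_of_nonneg_left (hg i hi) (abs_nonneg _)
  refine ⟨Summable.of_norm_bounded (hD.mul_right B) h, ?_⟩
  rw [← tsum_mul_right]
  exact tsum_of_norm_bounded (hD.mul_right B).hasSum h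

/-- A bump function at Y₀ is approximated on the cube by a polynomial P. The symmetrization of P is
a finite combination of alternant ratios, so its integral against D tends to 0, while it is
uniformly close to the indicator of Y₀ on the support of D. -/
theorem tendsto_zero_of_altRatio_moments (hq0 : 0 < q) (hq1 : q < 1) (hζm : ζm < 0) (hζp : 0 < ζp)
    (hK : 0 < K) {ι : Type*} {l : Filter ι} {D : ι → Level q ζm ζp K → ℝ} {R C : ℝ}
    (hsum : ∀ n, Summable fun Y => |D n Y|) (hC : ∀ n, ∑' Y, |D n Y| ≤ C)
    (hsupp : ∀ᶠ n in l, ∀ Y, D n Y ≠ 0 → ∀ y ∈ Y.1, |y| ≤ R)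
    (hmom : ∀ α : Fin K → ℕ, Tendsto (fun n => ∑' Y, D n Y * altRatio α Y.particle) l (𝓝 0))
    (Y₀ : Level q ζm ζp K) : Tendsto (fun n => D n Y₀) l (𝓝 0) := by
  classical
  obtain ⟨f, hf, hf1, hf0⟩ := exists_bump hq0 hq1 hζm hζp Y₀
  rw [Metric.tendsto_nhds]
  intro η hη
  -- Symmetrization adds K! errors of size ε, and the total variation is at most C; the error then
  -- stays below η/2.
  set ε : ℝ := η / (2 * ((|C| + 1) * (K.factorial : ℝ))) with hε
  have hfac : (0 : ℝ) < K.factorial := by exact_mod_cast K.factorial_pos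
  have hε0 : 0 < ε := by positivity
  obtain ⟨P, hP⟩ := exists_mvPolynomial_near (K := K) R hf hε0
  set Q : Level q ζm ζp K → ℝ := fun Y =>
    ∑ σ : Equiv.Perm (Fin K), MvPolynomial.eval (Y.particle ∘ σ) P with hQ
  have hQeq : ∀ Y, Q Y = ∑ d ∈ (vandermondePoly K * P).support,
      (vandermondePoly K * P).coeff d * altRatio d Y.particle := fun Y =>
    sum_perm_eval_eq Y.particle_strictMono.injective P
  have hlim : Tendsto (fun n => ∑ d ∈ (vandermondePoly K * P).support,
      (vandermondePoly K * P).coeff d * ∑' Y, D n Y * altRatio d Y.particle) l (𝓝 0) := by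
    have := tendsto_finsetSum (vandermondePoly K * P).support fun d _ =>
      (hmom d).const_mul ((vandermondePoly K * P).coeff d)
    simpa using this
  filter_upwards [hsupp, Metric.tendsto_nhds.1 hlim (η / 2) (by positivity)] with n hn hη2
  rw [dist_zero_right, Real.norm_eq_abs] at hη2 ⊢
  have hsumalt : ∀ d : Fin K →₀ ℕ, Summable fun Y => D n Y * altRatio d Y.particle := by
    intro d
    obtain ⟨B, hB⟩ := exists_bound_altRatio (q := q) (ζm := ζm) (ζp := ζp) hq0 hζm hζp hK d R
    exact (summable_mul_of_bound_on_support (hsum n) fun Y hY => hB Y (hn Y hY)).1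
  have hDQ : HasSum (fun Y => D n Y * Q Y) (∑ d ∈ (vandermondePoly K * P).support,
      (vandermondePoly K * P).coeff d * ∑' Y, D n Y * altRatio d Y.particle) := by
    refine hasSum_of_eq (hasSum_sum fun d (_ : d ∈ (vandermondePoly K * P).support) =>
      (hsumalt d).hasSum.mul_left ((vandermondePoly K * P).coeff d)) (fun Y => ?_) rfl
    rw [hQeq, Finset.mul_sum]
    exact Finset.sum_congr rfl fun d _ => by ring
  have hdiff : ∀ Y, D n Y ≠ 0 → |(if Y = Y₀ then 1 else 0) - Q Y| ≤ K.factorial * ε := by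
    intro Y hY
    have e := sum_perm_bump hf1 hf0 Y
    rw [← e, hQ, ← Finset.sum_sub_distrib]
    refine (Finset.abs_sum_le_sum_abs _ _).trans ((Finset.sum_le_card_nsmul _ _ ε ?_).trans ?_)
    · intro σ _
      rw [abs_sub_comm]
      exact (hP _ fun i => hn Y hY _ (Y.particle_mem (σ i))).le
    · rw [Finset.card_univ, Fintype.card_perm, Fintype.card_fin, nsmul_eq_mul]
  obtain ⟨h1, h2⟩ := summable_mul_of_bound_on_support (hsum n) hdiff
  have hsingle : HasSum (fun Y => D n Y * if Y = Y₀ then 1 else 0) (D n Y₀) := by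
    refine hasSum_of_eq (hasSum_ite_eq Y₀ (D n Y₀)) (fun Y => ?_) rfl
    split_ifs with h
    · rw [h, mul_one]
    · rw [mul_zero]
  have h3 : HasSum (fun Y => D n Y * ((if Y = Y₀ then 1 else 0) - Q Y)) _ :=
    hasSum_of_eq (hsingle.sub hDQ) (fun Y => mul_sub _ _ _) rfl
  rw [h3.tsum_eq] at h2
  have h4 : (∑' Y, |D n Y|) * (K.factorial * ε) < η / 2 := by
    have h5 : (∑' Y, |D n Y|) * (K.factorial * ε) ≤ |C| * (K.factorial * ε) :=
      mul_le_mul_of_nonneg_right ((hC n).trans (le_abs_self C)) (by positivity)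
    have h6 : (|C| + 1) * (K.factorial * ε) = η / 2 := by
      rw [hε]; field_simp
    have h7 : 0 < K.factorial * ε := by positivity
    nlinarith
  have h8 := abs_sub_abs_le_abs_sub (D n Y₀) (∑ d ∈ (vandermondePoly K * P).support,
      (vandermondePoly K * P).coeff d * ∑' Y, D n Y * altRatio d Y.particle)
  linarith

end Determinacy

/-! ### The variational series -/

theorem Precedes.trans {x y z : ℝ} (h1 : Precedes x y) (h2 : Precedes y z) : Precedes x z := by
  rcases h1 with h1 | ⟨h1, h1'⟩ <;> rcases h2 with h2 | ⟨h2, h2'⟩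
  · exact Or.inl (h2.trans h1)
  · exact Or.inl (h2 ▸ h1)
  · exact Or.inl (h1 ▸ h2)
  · exact Or.inr ⟨h1.trans h2, h2'.trans h1'⟩

theorem Precedes.irrefl (x : ℝ) : ¬ Precedes x x := by
  rintro (h | ⟨-, h⟩) <;> exact lt_irrefl _ h

theorem precedes_or_precedes {x y : ℝ} (h : x ≠ y) : Precedes x y ∨ Precedes y x := by
  rcases lt_trichotomy |x| |y| with h1 | h1 | h1
  · exact Or.inr (Or.inl h1)
  · rcases lt_or_gt_of_ne h with h2 | h2
    · exact Or.inr (Or.inr ⟨h1.symm, h2⟩)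
    · exact Or.inl (Or.inr ⟨h1, h2⟩)
  · exact Or.inl (Or.inl h1)

theorem Precedes.abs_le {x y : ℝ} (h : Precedes x y) : |y| ≤ |x| := by
  rcases h with h | ⟨h, -⟩
  · exact h.le
  · exact h.ge

theorem encard_preds_lt {Z : Set ℝ} {x y : ℝ} (hx : x ∈ Z) (hxy : Precedes x y)
    (hfin : {z ∈ Z | Precedes z y}.Finite) :
    {z ∈ Z | Precedes z x}.encard < {z ∈ Z | Precedes z y}.encard := by
  refine (hfin.subset ?_).encard_lt_encard ?_
  · exact fun z hz => ⟨hz.1, hz.2.trans hxy⟩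
  · refine ⟨fun z hz => ⟨hz.1, hz.2.trans hxy⟩, fun h => ?_⟩
    exact Precedes.irrefl x (h ⟨hx, hxy⟩).2

theorem varSeries_eq {Z : Set ℝ} {x : ℝ} {k : ℕ} (hx : x ∈ Z)
    (hk : {z ∈ Z | Precedes z x}.encard = k) : varSeries Z k = x := by
  have h : ∃ x ∈ Z, {y ∈ Z | Precedes y x}.encard = k := ⟨x, hx, hk⟩
  rw [varSeries, dif_pos h]
  obtain ⟨h1, h2⟩ := h.choose_spec
  by_contra hne
  have hfin : ∀ y, {z ∈ Z | Precedes z y}.encard = k → {z ∈ Z | Precedes z y}.Finite :=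
    fun y hy => Set.finite_of_encard_eq_coe hy
  rcases precedes_or_precedes hne with h3 | h3
  · have := encard_preds_lt h1 h3 (hfin _ hk)
    rw [h2, hk] at this
    exact lt_irrefl _ this
  · have := encard_preds_lt hx h3 (hfin _ h2)
    rw [h2, hk] at this
    exact lt_irrefl _ this

/-- Zero is the default value of `varSeries`, so a nonzero term is a genuine particle. -/
theorem varSeries_spec {Z : Set ℝ} {k : ℕ} (h : varSeries Z k ≠ 0) :
    varSeries Z k ∈ Z ∧ {z ∈ Z | Precedes z (varSeries Z k)}.encard = k := by
  by_cases hex : ∃ x ∈ Z, {y ∈ Z | Precedes y x}.encard = k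
  · rw [varSeries, dif_pos hex]
    exact hex.choose_spec
  · rw [varSeries, dif_neg hex] at h
    exact absurd rfl h

section Stabilization

variable {q ζm ζp : ℝ} {X : Set ℝ}

theorem InfConfig.finite_preds (hq0 : 0 < q) (hq1 : q < 1) (hζm : ζm < 0) (hζp : 0 < ζp)
    (hX : X ∈ InfConfig q ζm ζp) {x : ℝ} (hx : x ≠ 0) : {z ∈ X | Precedes z x}.Finite :=
  (InfConfig.finite_ge hq0 hq1 hζm hζp hX (abs_pos.2 hx)).subset fun _ hz => ⟨hz.1, hz.2.abs_le⟩

/-- Let x have k predecessors in X. Once the terms with index at most k agree, x has the same rank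
in X(N), and a predecessor of x in X(N) has some rank j < k, hence equals the corresponding term of
X. -/
theorem eventually_mem_of_precedes (hq0 : 0 < q) (hq1 : q < 1) (hζm : ζm < 0) (hζp : 0 < ζp)
    (hX : X ∈ InfConfig q ζm ζp) {Xs : (N : ℕ) → Level q ζm ζp N} (hXs : Stabilizes Xs X) {x : ℝ}
    (hx : x ∈ X) : ∀ᶠ N in atTop, x ∈ (Xs N).1 ∧ ∀ y ∈ (Xs N).1, Precedes y x → y ∈ X := by
  have hx0 := lattice_ne_zero hq0 hζm hζp (hX.1 hx)
  obtain ⟨k, hk⟩ := (InfConfig.finite_preds hq0 hq1 hζm hζp hX hx0).exists_encard_eq_coe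
  have hvx := varSeries_eq hx hk
  have hev : ∀ᶠ N in atTop, ∀ j ∈ Finset.range (k + 1),
      varSeries (Xs N).1 j = varSeries X j :=
    (Filter.eventually_all_finset _).2 fun j _ => hXs j
  filter_upwards [hev] with N hN
  have h1 := hN k (by simp)
  rw [hvx] at h1
  have h2 := varSeries_spec (Z := ((Xs N).1 : Set ℝ)) (k := k) (by rw [h1]; exact hx0)
  rw [h1] at h2
  refine ⟨h2.1, fun y hy hyx => ?_⟩
  have h3 := encard_preds_lt (Z := ((Xs N).1 : Set ℝ)) hy hyx (Set.finite_of_encard_eq_coe h2.2)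
  rw [h2.2] at h3
  obtain ⟨j, hj⟩ := (Set.finite_of_encard_le_coe h3.le).exists_encard_eq_coe
  rw [hj] at h3
  have hjk : j < k := by exact_mod_cast h3
  have h4 := varSeries_eq (Z := ((Xs N).1 : Set ℝ)) hy hj
  have h5 := hN j (by simp; omega)
  rw [h4] at h5
  rw [h5]
  refine (varSeries_spec ?_).1
  rw [← h5]
  exact lattice_ne_zero hq0 hζm hζp ((Xs N).2.1 hy)

theorem eventually_abs_le (hq0 : 0 < q) (hq1 : q < 1) (hζm : ζm < 0) (hζp : 0 < ζp)
    (hX : X ∈ InfConfig q ζm ζp) {Xs : (N : ℕ) → Level q ζm ζp N} (hXs : Stabilizes Xs X) {R : ℝ}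
    (hR : ∀ x ∈ X, |x| ≤ R) : ∀ᶠ N in atTop, ∀ y ∈ (Xs N).1, |y| ≤ R := by
  obtain ⟨x, hx⟩ := hX.2.1.nonempty
  filter_upwards [eventually_mem_of_precedes hq0 hq1 hζm hζp hX hXs hx] with N hN y hy
  by_cases h : y = x
  · exact hR y (h ▸ hx)
  · rcases precedes_or_precedes h with h | h
    · exact hR y (hN.2 y hy h)
    · exact h.abs_le.trans (hR x hx)

/-- If y is not in X, some x in X has smaller modulus. Then y precedes x, and its presence in X(N)
would eventually force y into X. -/
theorem eventually_mem_iff (hq0 : 0 < q) (hq1 : q < 1) (hζm : ζm < 0) (hζp : 0 < ζp)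
    (hX : X ∈ InfConfig q ζm ζp) {Xs : (N : ℕ) → Level q ζm ζp N} (hXs : Stabilizes Xs X) {y : ℝ}
    (hy : y ≠ 0) : ∀ᶠ N in atTop, y ∈ (Xs N).1 ↔ y ∈ X := by
  by_cases hyX : y ∈ X
  · filter_upwards [eventually_mem_of_precedes hq0 hq1 hζm hζp hX hXs hyX] with N hN
    exact iff_of_true hN.1 hyX
  · obtain ⟨x, hx, hxy⟩ := InfConfig.exists_lt hq0 hq1 hζm hζp hX (abs_pos.2 hy)
    filter_upwards [eventually_mem_of_precedes hq0 hq1 hζm hζp hX hXs hx] with N hN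
    exact iff_of_false (fun h => hyX (hN.2 y h (Or.inl hxy))) hyX

theorem tendsto_psums_of_stabilizes (hq0 : 0 < q) (hq1 : q < 1) (hζm : ζm < 0) (hζp : 0 < ζp)
    (hX : X ∈ InfConfig q ζm ζp) {Xs : (N : ℕ) → Level q ζm ζp N} (hXs : Stabilizes Xs X) :
    Tendsto (fun N => psums (Xs N).1) atTop (𝓝 (psumsInf X)) := by
  classical
  rw [tendsto_pi_nhds]
  intro k
  obtain ⟨R, hR0, hR⟩ := InfConfig.exists_bound hX
  have hlim := tendsto_tsum_of_dominated_convergence (𝓕 := (atTop : Filter ℕ))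
    (f := fun N (y : lattice q ζm ζp) => if (y : ℝ) ∈ (Xs N).1 then (y : ℝ) ^ (k + 1) else 0)
    (g := fun y : lattice q ζm ζp => if (y : ℝ) ∈ X then (y : ℝ) ^ (k + 1) else 0)
    ((summable_lattice_abs hq0 hq1 hζm hζp R).mul_left (R ^ k))
    (fun y => by
      refine tendsto_const_nhds.congr' ?_
      filter_upwards [eventually_mem_iff hq0 hq1 hζm hζp hX hXs
        (lattice_ne_zero hq0 hζm hζp y.2)] with N hN
      simp only [hN])
    (by
      filter_upwards [eventually_abs_le hq0 hq1 hζm hζp hX hXs hR] with N hN y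
      split_ifs with h1 h2 h2
      · rw [Real.norm_eq_abs, abs_pow, pow_succ]
        exact mul_le_mul_of_nonneg_right (pow_le_pow_left₀ (abs_nonneg _) h2 k) (abs_nonneg _)
      · exact absurd (hN y h1) h2
      · rw [norm_zero]; positivity
      · simp)
  have e1 : ∀ N, ∑' y : lattice q ζm ζp, (if (y : ℝ) ∈ (Xs N).1 then (y : ℝ) ^ (k + 1) else 0) =
      psums (Xs N).1 k := by
    intro N
    have h1 : ∀ y : ℝ, (if y ∈ (Xs N).1 then y ^ (k + 1) else 0) =
        ((Xs N).1 : Set ℝ).indicator (fun y => y ^ (k + 1)) y := fun y => by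
      rw [Set.indicator_apply]; rfl
    simp only [h1]
    rw [tsum_subtype (lattice q ζm ζp) (((Xs N).1 : Set ℝ).indicator fun y => y ^ (k + 1)),
      Set.indicator_indicator, Set.inter_eq_right.2 (Xs N).2.1, ← tsum_subtype, psums]
    exact Finset.tsum_subtype (Xs N).1 fun y : ℝ => y ^ (k + 1)
  have e2 : ∑' y : lattice q ζm ζp, (if (y : ℝ) ∈ X then (y : ℝ) ^ (k + 1) else 0) =
      psumsInf X k := by
    have h1 : ∀ y : ℝ, (if y ∈ X then y ^ (k + 1) else 0) =
        X.indicator (fun y => y ^ (k + 1)) y := fun y => by rw [Set.indicator_apply]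
    simp only [h1]
    rw [tsum_subtype (lattice q ζm ζp) (X.indicator fun y => y ^ (k + 1)),
      Set.indicator_indicator, Set.inter_eq_right.2 hX.1, ← tsum_subtype, psumsInf]
  rw [e2] at hlim
  exact hlim.congr e1

theorem exists_initial (hq0 : 0 < q) (hq1 : q < 1) (hζm : ζm < 0) (hζp : 0 < ζp)
    (hX : X ∈ InfConfig q ζm ζp) (n : ℕ) : ∃ F : Finset ℝ, (F : Set ℝ) ⊆ X ∧ F.card = n ∧
      ∀ x ∈ F, ∀ y ∈ X, Precedes y x → y ∈ F := by
  induction n with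
  | zero => exact ⟨∅, by simp, rfl, by simp⟩
  | succ n ih =>
    obtain ⟨F, hFX, hc, hF⟩ := ih
    obtain ⟨x, hx, hxF⟩ := hX.2.1.exists_notMem_finset F
    have hx0 := lattice_ne_zero hq0 hζm hζp (hX.1 hx)
    have hfin : {y ∈ X \ F | Precedes y x ∨ y = x}.Finite := by
      refine ((InfConfig.finite_preds hq0 hq1 hζm hζp hX hx0).union (Set.finite_singleton x)).subset
        ?_
      rintro y ⟨hy, h | h⟩
      · exact Or.inl ⟨hy.1, h⟩
      · exact Or.inr h
    -- The lexicographic key encodes `Precedes`, so m is the first point outside F; only the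
    -- finitely many candidates up to x need to be searched.
    obtain ⟨m, hm, hmin⟩ := hfin.toFinset.exists_min_image (fun y => toLex (-|y|, -y))
      ⟨x, hfin.mem_toFinset.2 ⟨⟨hx, hxF⟩, Or.inr rfl⟩⟩
    rw [hfin.mem_toFinset] at hm
    have hmm : ∀ y ∈ X, Precedes y m → y ∈ F := by
      intro y hy hym
      by_contra hyF
      have h1 := hmin y (hfin.mem_toFinset.2 ⟨⟨hy, hyF⟩, Or.inl (by
        rcases hm.2 with h | h
        · exact hym.trans h
        · exact h ▸ hym)⟩)
      rw [Prod.Lex.le_iff] at h1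
      simp only [ofLex_toLex, neg_lt_neg_iff, neg_inj, neg_le_neg_iff] at h1
      rcases hym with h | ⟨h, h'⟩ <;> rcases h1 with h1 | ⟨h1, h1'⟩ <;> linarith
    refine ⟨insert m F, ?_, ?_, ?_⟩
    · rw [Finset.coe_insert]
      exact Set.insert_subset hm.1.1 hFX
    · rw [Finset.card_insert_of_notMem hm.1.2, hc]
    · intro z hz y hy hyz
      rcases Finset.mem_insert.1 hz with rfl | hz
      · exact Finset.mem_insert_of_mem (hmm y hy hyz)
      · exact Finset.mem_insert_of_mem (hF z hz y hy hyz)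

theorem initial_subset {F G : Finset ℝ} (hFX : (F : Set ℝ) ⊆ X) (hGX : (G : Set ℝ) ⊆ X)
    (hF : ∀ x ∈ F, ∀ y ∈ X, Precedes y x → y ∈ F) (hG : ∀ x ∈ G, ∀ y ∈ X, Precedes y x → y ∈ G)
    (hFG : F.card ≤ G.card) : F ⊆ G := by
  intro x hx
  by_contra hxG
  have hsub : G ⊆ F.erase x := by
    intro y hy
    have hne : y ≠ x := fun h => hxG (h ▸ hy)
    refine Finset.mem_erase.2 ⟨hne, ?_⟩
    rcases precedes_or_precedes hne with h | h
    · exact hF x hx y (hGX hy) h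
    · exact absurd (hG y hy x (hFX hx) h) hxG
  have h1 := Finset.card_le_card hsub
  have h2 := Finset.card_pos.2 ⟨x, hx⟩
  rw [Finset.card_erase_of_mem hx] at h1
  omega

/-- Initial segments of the variational order are nested. Without such a sequence the limit
condition would be vacuous; uniqueness and positivity of the boundary measure both rest on it. -/
theorem exists_stabilizes (hq0 : 0 < q) (hq1 : q < 1) (hζm : ζm < 0) (hζp : 0 < ζp)
    (hX : X ∈ InfConfig q ζm ζp) : ∃ Xs : (N : ℕ) → Level q ζm ζp N, Stabilizes Xs X := by
  choose F hFX hc hF using exists_initial hq0 hq1 hζm hζp hX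
  refine ⟨fun N => ⟨F N, (hFX N).trans hX.1, hc N⟩, fun k => ?_⟩
  filter_upwards [eventually_ge_atTop (k + 1)] with N hN
  have hsub : ∀ a b, a ≤ b → F a ⊆ F b := fun a b hab =>
    initial_subset (hFX a) (hFX b) (hF a) (hF b) (by rw [hc, hc]; exact hab)
  -- The point m added at stage k + 1 has exactly k predecessors, both in X and in every later
  -- segment.
  obtain ⟨m, hm, hmk⟩ := Finset.exists_mem_notMem_of_card_lt_card
    (show (F k).card < (F (k + 1)).card by rw [hc, hc]; omega)
  have hins : insert m (F k) = F (k + 1) := by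
    refine Finset.eq_of_subset_of_card_le
      (Finset.insert_subset hm (hsub _ _ (by omega))) ?_
    rw [Finset.card_insert_of_notMem hmk, hc, hc]
  have hpred : ∀ y ∈ X, Precedes y m ↔ y ∈ F k := by
    intro y hy
    constructor
    · intro h
      have h1 := hF (k + 1) m hm y hy h
      rw [← hins, Finset.mem_insert] at h1
      rcases h1 with rfl | h1
      · exact absurd h (Precedes.irrefl y)
      · exact h1
    · intro h
      rcases precedes_or_precedes (fun h' : y = m => hmk (h' ▸ h)) with h1 | h1
      · exact h1
      · exact absurd (hF k y h m (hFX _ hm) h1) hmk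
  have hcard : ∀ Z : Set ℝ, Z ⊆ X → (F k : Set ℝ) ⊆ Z →
      {z ∈ Z | Precedes z m}.encard = k := by
    intro Z hZX hZ
    have : {z ∈ Z | Precedes z m} = F k := by
      ext z
      exact ⟨fun hz => (hpred z (hZX hz.1)).1 hz.2, fun hz => ⟨hZ hz, (hpred z (hFX k hz)).2 hz⟩⟩
    rw [this, Set.encard_coe_eq_coe_finsetCard, hc]
  rw [varSeries_eq (hFX _ hm) (hcard X subset_rfl (hFX k)),
    varSeries_eq (Z := (F N : Set ℝ)) (hsub _ _ hN hm)
      (hcard (F N) (hFX N) (hsub k N (by omega)))]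

end Stabilization

/-! ### Schur polynomials and Schur functions as ratios of alternants -/

section Schur

/-- The exponents `ν_{N - i} + i` of a Schur polynomial in increasing order. -/
def schurExp (ν : YoungDiagram) (N : ℕ) (i : Fin N) : ℕ := ν.rowLen (N - 1 - i) + i

theorem rowLen_eq_zero_of_length_le {ν : YoungDiagram} {i : ℕ} (h : length ν ≤ i) :
    ν.rowLen i = 0 := by
  by_contra hne
  have h1 : (i, 0) ∈ ν := YoungDiagram.mem_iff_lt_rowLen.2 (Nat.pos_of_ne_zero hne)
  have h2 := YoungDiagram.mem_iff_lt_colLen.1 h1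
  rw [length] at h
  omega

theorem schurExp_strictMono (ν : YoungDiagram) (N : ℕ) : StrictMono (schurExp ν N) := by
  intro i j hij
  have h1 : (i : ℕ) < j := hij
  have h2 := ν.rowLen_anti (N - 1 - j) (N - 1 - i) (by omega)
  unfold schurExp
  omega

theorem schurExp_succ {ν : YoungDiagram} {N : ℕ} (h : length ν ≤ N) :
    schurExp ν (N + 1) = shiftExp (schurExp ν N) := by
  ext i
  refine Fin.cases ?_ (fun i => ?_) i
  · simp [schurExp, shiftExp, rowLen_eq_zero_of_length_le h]
  · simp only [schurExp, shiftExp, Fin.cons_succ, Fin.val_succ]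
    rw [show N + 1 - 1 - ((i : ℕ) + 1) = N - 1 - i by omega]
    ring

theorem schurExp_add {ν : YoungDiagram} {K : ℕ} (h : length ν ≤ K) (d : ℕ) :
    schurExp ν (K + d) = iterShiftExp (schurExp ν K) d := by
  induction d with
  | zero => rfl
  | succ d ih =>
    rw [iterShiftExp, ← ih]
    exact schurExp_succ (h.trans (Nat.le_add_right K d))

/-- Reversing the order of the exponents multiplies numerator and denominator by the same sign. -/
theorem schurPoly_eq_altRatio {ν : YoungDiagram} {N : ℕ} (h : length ν ≤ N) (u : Fin N → ℝ) :
    schurPoly ν N u = altRatio (schurExp ν N) u := by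
  have hs : (((Fin.revPerm (n := N)).sign : ℤ) : ℝ) ≠ 0 := by
    rcases Int.units_eq_one_or (Fin.revPerm (n := N)).sign with h | h <;> simp [h]
  have h1 : (Matrix.of fun i j : Fin N => u j ^ (ν.rowLen i + (N - 1 - i))).det =
      (((Fin.revPerm (n := N)).sign : ℤ) : ℝ) *
        (Matrix.of fun i j : Fin N => u j ^ schurExp ν N i).det := by
    rw [← Matrix.det_permute]
    congr 1
    ext i j
    simp only [Matrix.of_apply, Matrix.submatrix_apply, Fin.revPerm_apply, schurExp, Fin.val_rev,
      id]
    congr 2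
    · congr 1; omega
    · omega
  have h2 : ∏ i : Fin N, ∏ j ∈ Finset.Ioi i, (u i - u j) =
      (((Fin.revPerm (n := N)).sign : ℤ) : ℝ) * vandermonde u := by
    have h3 := Matrix.det_projVandermonde (fun _ : Fin N => (1 : ℝ)) u
    simp only [one_mul] at h3
    rw [← h3, vandermonde_eq_det, ← Matrix.det_permute, ← Matrix.det_transpose]
    congr 1
    ext i j
    simp [Matrix.projVandermonde_apply]
  rw [schurPoly, if_pos h, h1, h2, altRatio, mul_div_mul_left _ _ hs]

/-- Once a finite subset has at least K points, stability reduces its Schur value to a K × K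
Jacobi–Trudi determinant, which is continuous in the power sums. -/
theorem tendsto_schurPartial {X : Set ℝ} (hinf : X.Infinite) (h0 : (0 : ℝ) ∉ X)
    (hp : Tendsto (fun F : Finset X => psums (F.map (Function.Embedding.subtype _))) atTop
      (𝓝 (psumsInf X))) {ν : YoungDiagram} {K : ℕ} (hK : 0 < K) (hν : length ν ≤ K) :
    Tendsto (schurPartial ν X) atTop (𝓝 (jacobiTrudi (psumsInf X) (schurExp ν K))) := by
  have : Infinite X := hinf.to_subtype
  have hcard : ∀ᶠ F : Finset X in atTop, K ≤ F.card := by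
    obtain ⟨G, hG⟩ := Infinite.exists_subset_card_eq X K
    filter_upwards [eventually_ge_atTop G] with F hF
    rw [← hG]
    exact Finset.card_le_card hF
  refine (((continuous_jacobiTrudi (schurExp ν K)).tendsto _).comp hp).congr' ?_
  filter_upwards [hcard] with F hF
  rw [Function.comp_apply, schurPartial]
  set G := F.map (Function.Embedding.subtype (· ∈ X)) with hG
  have hc : K ≤ G.card := by rwa [hG, Finset.card_map]
  have himg : Finset.univ.image (G.orderEmbOfFin rfl) = G := by
    apply Finset.coe_injective
    rw [Finset.coe_image, Finset.coe_univ, Set.image_univ, Finset.range_orderEmbOfFin]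
  rw [schurPoly_eq_altRatio (hν.trans hc), altRatio_eq_jacobiTrudi (hK.trans_le hc)
    (G.orderEmbOfFin rfl).injective, himg]
  · obtain ⟨d, hd⟩ := Nat.exists_eq_add_of_le hc
    rw [hd, schurExp_add hν, jacobiTrudi_iterShiftExp]
  · intro i hi
    have h1 := Finset.orderEmbOfFin_mem G rfl i
    rw [hi] at h1
    obtain ⟨z, -, hz⟩ := Finset.mem_map.1 h1
    exact h0 (hz ▸ z.2)

variable {q ζm ζp : ℝ} {X : Set ℝ}

theorem InfConfig.zero_notMem (hq0 : 0 < q) (hζm : ζm < 0) (hζp : 0 < ζp)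
    (hX : X ∈ InfConfig q ζm ζp) : (0 : ℝ) ∉ X := fun h =>
  lattice_ne_zero hq0 hζm hζp (hX.1 h) rfl

theorem schurFun_eq_jacobiTrudi (hq0 : 0 < q) (hq1 : q < 1) (hζm : ζm < 0) (hζp : 0 < ζp)
    (hX : X ∈ InfConfig q ζm ζp) {ν : YoungDiagram} {K : ℕ} (hK : 0 < K) (hν : length ν ≤ K) :
    schurFun ν X = jacobiTrudi (psumsInf X) (schurExp ν K) :=
  (tendsto_schurPartial hX.2.1 (InfConfig.zero_notMem hq0 hζm hζp hX)
    (tendsto_psums hq0 hq1 hζm hζp hX) hK hν).limUnder_eq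

theorem schurConverges_of_infConfig (hq0 : 0 < q) (hq1 : q < 1) (hζm : ζm < 0) (hζp : 0 < ζp)
    (hX : X ∈ InfConfig q ζm ζp) (ν : YoungDiagram) : SchurConverges ν X := by
  rw [SchurConverges, schurFun_eq_jacobiTrudi hq0 hq1 hζm hζp hX (length ν).succ_pos (by omega)]
  exact tendsto_schurPartial hX.2.1 (InfConfig.zero_notMem hq0 hζm hζp hX)
    (tendsto_psums hq0 hq1 hζm hζp hX) (length ν).succ_pos (by omega)

/-! ### Principal specialization -/

theorem geomSet_mem_infConfig (hq0 : 0 < q) (hq1 : q < 1) : geomSet q ∈ InfConfig q (-1) 1 := by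
  refine ⟨?_, ?_, 0, 1, ?_⟩
  · rintro _ ⟨n, rfl⟩
    exact Or.inr ⟨n, by simp⟩
  · exact Set.infinite_range_of_injective (pow_right_strictAnti₀ hq0 hq1).injective
  · rintro _ ⟨n, rfl⟩
    exact ⟨by positivity, pow_le_one₀ hq0.le hq1.le⟩

/-- The entries are powers of q whose exponents are products, so the alternant at a geometric
progression is itself a Vandermonde determinant in the q^{α_i}. -/
theorem altRatio_geom {N : ℕ} (α : Fin N → ℕ) :
    altRatio α (fun i : Fin N => q ^ (i : ℕ)) =
      vandermonde (fun i => q ^ α i) / vandermonde (fun i : Fin N => q ^ (i : ℕ)) := by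
  rw [altRatio, vandermonde_eq_det (fun i => q ^ α i), ← Matrix.det_transpose]
  congr 2
  ext i j
  simp only [Matrix.transpose_apply, Matrix.of_apply]
  rw [← pow_mul, ← pow_mul, mul_comm]

theorem geom_injective (hq0 : 0 < q) (hq1 : q < 1) (N : ℕ) :
    Function.Injective fun i : Fin N => q ^ (i : ℕ) := fun _ _ h =>
  Fin.ext ((pow_right_strictAnti₀ hq0 hq1).injective h)

theorem altRatio_geom_ne_zero (hq0 : 0 < q) (hq1 : q < 1) {N : ℕ} {α : Fin N → ℕ}
    (hα : Function.Injective α) : altRatio α (fun i : Fin N => q ^ (i : ℕ)) ≠ 0 := by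
  rw [altRatio_geom]
  exact div_ne_zero
    (vandermonde_ne_zero fun _ _ h => hα ((pow_right_strictAnti₀ hq0 hq1).injective h))
    (vandermonde_ne_zero (geom_injective hq0 hq1 N))

theorem vandermonde_shiftExp {N : ℕ} (β : Fin N → ℕ) :
    vandermonde (fun i => q ^ shiftExp β i) = (∏ j : Fin N, (q ^ (β j + 1) - 1)) *
      ((∏ i : Fin N, ∏ _j ∈ Finset.Ioi i, q) * vandermonde fun i => q ^ β i) := by
  rw [vandermonde, Fin.prod_univ_succ, Fin.prod_Ioi_zero]
  congr 1
  rw [vandermonde, ← Finset.prod_mul_distrib]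
  refine Finset.prod_congr rfl fun i _ => ?_
  rw [Fin.prod_Ioi_succ, ← Finset.prod_mul_distrib]
  refine Finset.prod_congr rfl fun j _ => ?_
  simp only [shiftExp, Fin.cons_succ]
  ring

/-- Both Vandermonde determinants on the larger level split off the node 1 and a common power of q.
The powers and signs cancel, and the remaining factors are inverse to `linkFactor`. -/
theorem linkFactor_mul_altRatio_geom (hq0 : 0 < q) (hq1 : q < 1) {N : ℕ} (β : Fin N → ℕ) :
    linkFactor q β * altRatio (shiftExp β) (fun i : Fin (N + 1) => q ^ (i : ℕ)) =
      altRatio β (fun i : Fin N => q ^ (i : ℕ)) := by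
  have h1 : (fun i : Fin (N + 1) => q ^ (i : ℕ)) =
      fun i => q ^ shiftExp (fun i : Fin N => (i : ℕ)) i := by
    have : shiftExp (fun i : Fin N => (i : ℕ)) = fun i : Fin (N + 1) => (i : ℕ) :=
      iterShiftExp_id N 1
    rw [this]
  rw [altRatio_geom, altRatio_geom, vandermonde_shiftExp, h1, vandermonde_shiftExp, linkFactor,
    Finset.prod_div_distrib]
  have e1 : ∀ γ : Fin N → ℕ, ∏ j, (q ^ (γ j + 1) - 1) =
      (∏ _j : Fin N, (-1)) * ∏ j, (1 - q ^ (γ j + 1)) := by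
    intro γ
    rw [← Finset.prod_mul_distrib]
    exact Finset.prod_congr rfl fun j _ => by ring
  have e2 : ∀ γ : Fin N → ℕ, ∏ j, (1 - q ^ (γ j + 1)) ≠ 0 := fun γ =>
    (Finset.prod_pos fun j _ => one_sub_pow_pos hq0 hq1 _).ne'
  have e3 : (∏ _j : Fin N, (-1 : ℝ)) ≠ 0 := Finset.prod_ne_zero_iff.2 fun _ _ => by norm_num
  have e4 : (∏ i : Fin N, ∏ _j ∈ Finset.Ioi i, q) ≠ 0 :=
    Finset.prod_ne_zero_iff.2 fun _ _ => Finset.prod_ne_zero_iff.2 fun _ _ => hq0.ne'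
  have e5 := vandermonde_ne_zero (geom_injective hq0 hq1 N)
  have e6 := e2 β
  have e7 := e2 fun i => (i : ℕ)
  rw [e1 β, e1 fun i => (i : ℕ)]
  field_simp

theorem iterLinkFactor_mul_altRatio_geom (hq0 : 0 < q) (hq1 : q < 1) {K : ℕ} (α : Fin K → ℕ)
    (d : ℕ) : iterLinkFactor q α d * altRatio (iterShiftExp α d)
      (fun i : Fin (K + d) => q ^ (i : ℕ)) = altRatio α (fun i : Fin K => q ^ (i : ℕ)) := by
  induction d with
  | zero => simp [iterLinkFactor, iterShiftExp]
  | succ d ih =>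
    rw [← ih, ← linkFactor_mul_altRatio_geom hq0 hq1 (iterShiftExp α d), iterLinkFactor,
      iterLinkFactor, Finset.prod_range_succ, mul_assoc]
    rfl

/-- Let d tend to infinity in `iterLinkFactor_mul_altRatio_geom`, whose right side is constant in d.
This also gives the nonvanishing of S_ν(1, q, q², …). -/
theorem limitFactor_mul_jacobiTrudi_geomSet (hq0 : 0 < q) (hq1 : q < 1) {K : ℕ} (hK : 0 < K)
    (α : Fin K → ℕ) : limitFactor q α * jacobiTrudi (psumsInf (geomSet q)) α =
      altRatio α (fun i : Fin K => q ^ (i : ℕ)) := by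
  have hinj := (pow_right_strictAnti₀ hq0 hq1).injective
  have hp : Tendsto (fun d => psums (Finset.univ.image fun i : Fin (K + d) => q ^ (i : ℕ))) atTop
      (𝓝 (psumsInf (geomSet q))) := by
    rw [tendsto_pi_nhds]
    intro k
    have h1 : psumsInf (geomSet q) k = ∑' n : ℕ, (q ^ n) ^ (k + 1) :=
      tsum_range (fun x : ℝ => x ^ (k + 1)) hinj
    have h2 : Summable fun n : ℕ => (q ^ n) ^ (k + 1) := by
      refine (summable_geometric_of_lt_one (pow_nonneg hq0.le (k + 1))
        (pow_lt_one₀ hq0.le hq1 k.succ_ne_zero)).congr fun n => ?_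
      rw [← pow_mul, ← pow_mul, mul_comm]
    have h3 := h2.hasSum.tendsto_sum_nat.comp (tendsto_add_atTop_nat K)
    rw [h1]
    refine h3.congr fun d => ?_
    rw [psums, Finset.sum_image fun a _ b _ h => geom_injective hq0 hq1 _ h, Function.comp_apply,
      add_comm d K, Finset.sum_range]
  have h1 := (tendsto_iterLinkFactor hq0 hq1 α).mul
    (((continuous_jacobiTrudi α).tendsto _).comp hp)
  refine tendsto_nhds_unique h1 (tendsto_const_nhds.congr fun d => ?_)
  rw [Function.comp_apply, ← jacobiTrudi_iterShiftExp _ α d,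
    ← altRatio_eq_jacobiTrudi (by omega) (geom_injective hq0 hq1 _)
      (fun i => (pow_pos hq0 _).ne'), iterLinkFactor_mul_altRatio_geom hq0 hq1]

theorem schurFun_geomSet (hq0 : 0 < q) (hq1 : q < 1) {ν : YoungDiagram} {K : ℕ} (hK : 0 < K)
    (hν : length ν ≤ K) : limitFactor q (schurExp ν K) * schurFun ν (geomSet q) =
      altRatio (schurExp ν K) (fun i : Fin K => q ^ (i : ℕ)) := by
  rw [schurFun_eq_jacobiTrudi hq0 hq1 (by norm_num) one_pos (geomSet_mem_infConfig hq0 hq1) hK hν,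
    limitFactor_mul_jacobiTrudi_geomSet hq0 hq1 hK]

theorem schurFun_geomSet_ne_zero (hq0 : 0 < q) (hq1 : q < 1) (ν : YoungDiagram) :
    schurFun ν (geomSet q) ≠ 0 := by
  intro h
  have h1 := schurFun_geomSet hq0 hq1 (ν := ν) (length ν).succ_pos (by omega)
  rw [h, mul_zero] at h1
  exact altRatio_geom_ne_zero hq0 hq1 (schurExp_strictMono ν _).injective h1.symm

theorem normSchurFun_eq (hq0 : 0 < q) (hq1 : q < 1) (hζm : ζm < 0) (hζp : 0 < ζp)
    (hX : X ∈ InfConfig q ζm ζp) {ν : YoungDiagram} {K : ℕ} (hK : 0 < K) (hν : length ν ≤ K) :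
    normSchurFun q ν X = limitFactor q (schurExp ν K) *
      jacobiTrudi (psumsInf X) (schurExp ν K) /
        altRatio (schurExp ν K) (fun i : Fin K => q ^ (i : ℕ)) := by
  rw [← schurFun_geomSet hq0 hq1 hK hν, normSchurFun,
    schurFun_eq_jacobiTrudi hq0 hq1 hζm hζp hX hK hν,
    mul_div_mul_left _ _ (limitFactor_pos hq0 hq1 _).ne']

theorem normSchurPoly_eq {ν : YoungDiagram} {K : ℕ} (hν : length ν ≤ K) (Y : Level q ζm ζp K) :
    normSchurPoly ν Y = altRatio (schurExp ν K) Y.particle /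
      altRatio (schurExp ν K) (fun i : Fin K => q ^ (i : ℕ)) := by
  rw [normSchurPoly, schurPoly_eq_altRatio hν, schurPoly_eq_altRatio hν]

/-! ### Exponents and partitions -/

theorem exists_youngDiagram {r : ℕ → ℕ} (hr : Antitone r) {K : ℕ} (hK : ∀ i, K ≤ i → r i = 0) :
    ∃ ν : YoungDiagram, length ν ≤ K ∧ ∀ i, ν.rowLen i = r i := by
  classical
  let ν : YoungDiagram :=
    { cells := (Finset.range K ×ˢ Finset.range (r 0)).filter fun c => c.2 < r c.1
      isLowerSet := by
        rintro ⟨a, b⟩ ⟨c, d⟩ ⟨hca, hdb⟩ h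
        simp only [Finset.coe_filter, Finset.mem_product, Finset.mem_range, Set.mem_ofPred_eq] at *
        have := hr hca
        omega }
  have hmem : ∀ i j, (i, j) ∈ ν ↔ j < r i := by
    intro i j
    rw [← YoungDiagram.mem_cells]
    simp only [ν, Finset.mem_filter, Finset.mem_product, Finset.mem_range]
    refine ⟨fun h => h.2, fun h => ⟨⟨?_, h.trans_le (hr (Nat.zero_le i))⟩, h⟩⟩
    by_contra hi
    rw [hK i (not_lt.1 hi)] at h
    omega
  refine ⟨ν, ?_, fun i => ?_⟩
  · by_contra h
    have h1 : (K, 0) ∈ ν := YoungDiagram.mem_iff_lt_colLen.2 (not_le.1 h)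
    rw [hmem, hK K le_rfl] at h1
    omega
  · refine eq_of_forall_lt_iff fun j => ?_
    rw [← YoungDiagram.mem_iff_lt_rowLen, hmem]

theorem exists_schurExp_eq {K : ℕ} {β : Fin K → ℕ} (hβ : StrictMono β) :
    ∃ ν : YoungDiagram, length ν ≤ K ∧ schurExp ν K = β := by
  -- Strict growth makes β_i - i weakly increasing and nonnegative, so the truncated subtractions
  -- below are exact.
  have hstep : ∀ (n : ℕ) (i j : Fin K), (j : ℕ) = i + n → β i + n ≤ β j := by
    intro n
    induction n with
    | zero => intro i j h; rw [Fin.ext (show (j : ℕ) = i from h)]; rfl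
    | succ n ih =>
      intro i j h
      have h1 := ih i ⟨i + n, by omega⟩ rfl
      have h2 : β ⟨i + n, by omega⟩ < β j := hβ (Fin.lt_def.2 (by simp; omega))
      omega
  have hle : ∀ i : Fin K, (i : ℕ) ≤ β i := by
    intro i
    have := hstep i ⟨0, i.pos⟩ i (Nat.zero_add _).symm
    omega
  obtain ⟨ν, h1, h2⟩ := exists_youngDiagram (K := K)
    (r := fun i => if h : i < K then β ⟨K - 1 - i, by omega⟩ - (K - 1 - i) else 0) (by
      intro i j hij
      simp only
      split_ifs with hj hi hi
      · have := hstep (j - i) ⟨K - 1 - j, by omega⟩ ⟨K - 1 - i, by omega⟩ (by simp; omega)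
        omega
      · omega
      · omega
      · omega) (fun i hi => dif_neg (by omega))
  refine ⟨ν, h1, funext fun i => ?_⟩
  rw [schurExp, h2, dif_pos (by omega)]
  have e : (⟨K - 1 - (K - 1 - (i : ℕ)), by omega⟩ : Fin K) = i := Fin.ext (by simp; omega)
  rw [e]
  have := hle i
  omega

theorem altRatio_comp_perm {K : ℕ} (α : Fin K → ℕ) (σ : Equiv.Perm (Fin K)) (u : Fin K → ℝ) :
    altRatio (α ∘ σ) u = ((σ.sign : ℤ) : ℝ) * altRatio α u := by
  rw [altRatio, altRatio, ← mul_div_assoc, ← Matrix.det_permute]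
  rfl

/-- Sort the exponents if they are distinct; otherwise two rows coincide. Hence the Schur relations
for partitions of length at most K control all alternant moments. -/
theorem altRatio_eq_zero_or {K : ℕ} (α : Fin K → ℕ) :
    (∀ u : Fin K → ℝ, altRatio α u = 0) ∨ ∃ (ν : YoungDiagram) (c : ℝ), length ν ≤ K ∧
      ∀ u : Fin K → ℝ, altRatio α u = c * altRatio (schurExp ν K) u := by
  by_cases hα : Function.Injective α
  · right
    have hs : StrictMono (α ∘ Tuple.sort α) :=
      (Tuple.monotone_sort α).strictMono_of_injective (hα.comp (Tuple.sort α).injective)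
    obtain ⟨ν, hν, hν'⟩ := exists_schurExp_eq hs
    refine ⟨ν, (((Tuple.sort α).sign : ℤ) : ℝ), hν, fun u => ?_⟩
    rw [hν', altRatio_comp_perm, ← mul_assoc]
    rcases Int.units_eq_one_or (Tuple.sort α).sign with h | h <;> simp [h]
  · left
    intro u
    simp only [Function.Injective, not_forall] at hα
    obtain ⟨a, b, hab, hne⟩ := hα
    rw [altRatio, Matrix.det_zero_of_row_eq hne (by ext j; simp [hab]), zero_div]

end Schur

/-! ### Convergence to the boundary measure and its characterization -/

/-- Scheffé's lemma. Equal total masses give ∑|μ - M| = 2 ∑ max(M - μ, 0), and the latter sum is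
dominated by M. -/
theorem tendsto_tsum_subtype_of_tendsto {ι : Type*} {μ : ℕ → ι → ℝ} {M : ι → ℝ}
    (hμ0 : ∀ n i, 0 ≤ μ n i) (hμ1 : ∀ n, HasSum (μ n) 1) (hM0 : ∀ i, 0 ≤ M i) (hM1 : HasSum M 1)
    (h : ∀ i, Tendsto (fun n => μ n i) atTop (𝓝 (M i))) (A : Set ι) :
    Tendsto (fun n => ∑' i : A, μ n i) atTop (𝓝 (∑' i : A, M i)) := by
  have h1 : Tendsto (fun n => ∑' i, max (M i - μ n i) 0) atTop (𝓝 (∑' _ : ι, (0 : ℝ))) := by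
    refine tendsto_tsum_of_dominated_convergence hM1.summable (fun i => ?_)
      (Eventually.of_forall fun n i => ?_)
    · have h2 := ((tendsto_const_nhds (x := M i)).sub (h i)).max (tendsto_const_nhds (x := (0 : ℝ)))
      simpa using h2
    · rw [Real.norm_eq_abs, abs_of_nonneg (le_max_right _ _)]
      exact max_le (by linarith [hμ0 n i]) (hM0 i)
  rw [tsum_zero] at h1
  rw [tendsto_iff_norm_sub_tendsto_zero]
  refine squeeze_zero (fun n => norm_nonneg _) (fun n => ?_)
    (by simpa using h1.const_mul 2 : Tendsto (fun n => 2 * ∑' i, max (M i - μ n i) 0) atTop (𝓝 0))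
  have hD : HasSum (fun i => μ n i - M i) (1 - 1) := (hμ1 n).sub hM1
  have hmax : Summable fun i => max (M i - μ n i) 0 :=
    Summable.of_nonneg_of_le (fun i => le_max_right _ _)
      (fun i => max_le (by linarith [hμ0 n i]) (hM0 i)) hM1.summable
  have habs : HasSum (fun i => |μ n i - M i|) (2 * ∑' i, max (M i - μ n i) 0) := by
    refine hasSum_of_eq ((hmax.hasSum.mul_left 2).add hD) (fun i => ?_) (by ring)
    rcases le_total (μ n i) (M i) with hle | hle
    · rw [abs_of_nonpos (by linarith), max_eq_left (by linarith)]; ring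
    · rw [abs_of_nonneg (by linarith), max_eq_right (by linarith)]; ring
  have hsub : ∑' i : A, μ n i - ∑' i : A, M i = ∑' i : A, (μ n i - M i) :=
    (((hμ1 n).summable.subtype A).tsum_sub (hM1.summable.subtype A)).symm
  rw [hsub, ← habs.tsum_eq]
  refine (norm_tsum_le_tsum_norm (hD.summable.subtype A).norm).trans ?_
  exact habs.summable.tsum_subtype_le (fun i => |μ n i - M i|) A fun i => abs_nonneg _

section Main

variable {q ζm ζp : ℝ} {X : Set ℝ} {K : ℕ}

theorem abs_le_of_boundaryMeasure_ne_zero (hq0 : 0 < q) (hq1 : q < 1) {R : ℝ}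
    (hR : ∀ x ∈ X, |x| ≤ R) {Y : Level q ζm ζp K} (h : boundaryMeasure X K Y ≠ 0) :
    ∀ y ∈ Y.1, |y| ≤ R := by
  intro y hy
  obtain ⟨x, hx, m, rfl⟩ := exists_eq_mul_pow_of_boundaryMeasure_ne_zero h y hy
  rw [abs_mul, abs_of_pos (pow_pos hq0 m)]
  exact (mul_le_of_le_one_right (abs_nonneg _) (pow_le_one₀ hq0.le hq1.le)).trans (hR x hx)

theorem tendsto_iterLink (hq0 : 0 < q) (hq1 : q < 1) (hζm : ζm < 0) (hζp : 0 < ζp)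
    (hX : X ∈ InfConfig q ζm ζp) (hK : 0 < K) {Xs : (N : ℕ) → Level q ζm ζp N}
    (hXs : Stabilizes Xs X) (Y : Level q ζm ζp K) :
    Tendsto (fun d => iterLink K d (Xs (K + d)) Y) atTop (𝓝 (boundaryMeasure X K Y)) := by
  obtain ⟨R, -, hR⟩ := InfConfig.exists_bound hX
  have hM := hasSum_boundaryMeasure hq0 hq1 hζm hζp hX K
  have hL := fun d => hasSum_iterLink hq0 hq1 hζm hζp hK d (Xs (K + d))
  have hadd : Tendsto (fun d => K + d) atTop atTop :=
    tendsto_atTop_mono (fun d => Nat.le_add_left d K) tendsto_id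
  have hle : ∀ d (Z : Level q ζm ζp K), |iterLink K d (Xs (K + d)) Z - boundaryMeasure X K Z| ≤
      iterLink K d (Xs (K + d)) Z + |boundaryMeasure X K Z| := fun d Z => by
    refine (abs_sub _ _).trans_eq ?_
    rw [abs_of_nonneg (iterLink_nonneg hq0 hq1 K d _ Z)]
  have hsum : ∀ d, Summable fun Z : Level q ζm ζp K =>
      |iterLink K d (Xs (K + d)) Z - boundaryMeasure X K Z| := fun d =>
    ((hL d).sub hM).summable.abs
  rw [← tendsto_sub_nhds_zero_iff]
  refine tendsto_zero_of_altRatio_moments hq0 hq1 hζm hζp hK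
    (D := fun d Z => iterLink K d (Xs (K + d)) Z - boundaryMeasure X K Z) (R := R)
    (C := 1 + ∑' Z : Level q ζm ζp K, |boundaryMeasure X K Z|) hsum (fun d => ?_) ?_
    (fun α => ?_) Y
  · exact hasSum_le (hle d) (hsum d).hasSum ((hL d).add hM.summable.abs.hasSum)
  · filter_upwards [hadd.eventually (eventually_abs_le hq0 hq1 hζm hζp hX hXs hR)] with d hd Z hZ
    by_cases h1 : iterLink K d (Xs (K + d)) Z = 0
    · refine abs_le_of_boundaryMeasure_ne_zero hq0 hq1 hR fun h2 => hZ ?_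
      rw [h1, h2, sub_zero]
    · exact abs_le_of_iterLink_ne_zero hd h1
  · have h1 := ((tendsto_iterLinkFactor hq0 hq1 α).mul
      (((continuous_jacobiTrudi α).tendsto _).comp
        ((tendsto_psums_of_stabilizes hq0 hq1 hζm hζp hX hXs).comp hadd)))
    have h2 := h1.sub_const (limitFactor q α * jacobiTrudi (psumsInf X) α)
    rw [sub_self] at h2
    refine h2.congr fun d => ?_
    have h3 := (hasSum_iterLink_mul_altRatio hq0 hq1 hζm hζp hK α d (Xs (K + d))).sub
      (hasSum_boundaryMeasure_mul_altRatio hq0 hq1 hζm hζp hX α)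
    refine h3.tsum_eq.symm.trans (tsum_congr fun Z => ?_)
    ring

/-- Positivity is inherited from the links as a pointwise limit. -/
theorem boundaryMeasure_nonneg (hq0 : 0 < q) (hq1 : q < 1) (hζm : ζm < 0) (hζp : 0 < ζp)
    (hX : X ∈ InfConfig q ζm ζp) (hK : 0 < K) (Y : Level q ζm ζp K) :
    0 ≤ boundaryMeasure X K Y := by
  obtain ⟨Xs, hXs⟩ := exists_stabilizes hq0 hq1 hζm hζp hX
  exact ge_of_tendsto' (tendsto_iterLink hq0 hq1 hζm hζp hX hK hXs Y)
    fun d => iterLink_nonneg hq0 hq1 K d _ Y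

theorem isProbability_boundaryMeasure (hq0 : 0 < q) (hq1 : q < 1) (hζm : ζm < 0) (hζp : 0 < ζp)
    (hX : X ∈ InfConfig q ζm ζp) (hK : 0 < K) :
    IsProbability (boundaryMeasure (q := q) (ζm := ζm) (ζp := ζp) X K) :=
  ⟨boundaryMeasure_nonneg hq0 hq1 hζm hζp hX hK, hasSum_boundaryMeasure hq0 hq1 hζm hζp hX K⟩

theorem isBoundaryMeasure_boundaryMeasure (hq0 : 0 < q) (hq1 : q < 1) (hζm : ζm < 0)
    (hζp : 0 < ζp) (hX : X ∈ InfConfig q ζm ζp) (hK : 0 < K) :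
    IsBoundaryMeasure X K (boundaryMeasure (q := q) (ζm := ζm) (ζp := ζp) X K) := by
  refine ⟨isProbability_boundaryMeasure hq0 hq1 hζm hζp hX hK, fun Xs hXs A => ?_⟩
  exact tendsto_tsum_subtype_of_tendsto (μ := fun d => iterLink K d (Xs (K + d)))
    (fun d => iterLink_nonneg hq0 hq1 K d _)
    (fun d => hasSum_iterLink hq0 hq1 hζm hζp hK d (Xs (K + d)))
    (boundaryMeasure_nonneg hq0 hq1 hζm hζp hX hK) (hasSum_boundaryMeasure hq0 hq1 hζm hζp hX K)
    (tendsto_iterLink hq0 hq1 hζm hζp hX hK hXs) A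

theorem IsBoundaryMeasure.unique (hq0 : 0 < q) (hq1 : q < 1) (hζm : ζm < 0) (hζp : 0 < ζp)
    (hX : X ∈ InfConfig q ζm ζp) {M M' : Level q ζm ζp K → ℝ} (h : IsBoundaryMeasure X K M)
    (h' : IsBoundaryMeasure X K M') : M = M' := by
  obtain ⟨Xs, hXs⟩ := exists_stabilizes hq0 hq1 hζm hζp hX
  ext Y
  have := tendsto_nhds_unique (h.2 Xs hXs {Y}) (h'.2 Xs hXs {Y})
  rwa [tsum_singleton Y M, tsum_singleton Y M'] at this

theorem hasSum_mul_normSchurPoly_iff {M : Level q ζm ζp K → ℝ} (hM : VanishesOutside X M)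
    (ν : YoungDiagram) {s : ℝ} :
    HasSum (fun Y : {Y : Level q ζm ζp K // segment (Y.1 : Set ℝ) ⊆ segment X} =>
      M Y.1 * normSchurPoly ν Y.1) s ↔ HasSum (fun Y => M Y * normSchurPoly ν Y) s := by
  refine hasSum_subtype_iff_of_support_subset (f := fun Y => M Y * normSchurPoly ν Y)
    (s := {Y : Level q ζm ζp K | segment (Y.1 : Set ℝ) ⊆ segment X}) ?_
  intro Y hY
  by_contra hne
  exact hY (by simp only; rw [hM Y hne, zero_mul])

theorem schurRelations_boundaryMeasure (hq0 : 0 < q) (hq1 : q < 1) (hζm : ζm < 0) (hζp : 0 < ζp)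
    (hX : X ∈ InfConfig q ζm ζp) (hK : 0 < K) :
    SchurRelations X (boundaryMeasure (q := q) (ζm := ζm) (ζp := ζp) X K) := by
  intro ν hν
  rw [hasSum_mul_normSchurPoly_iff (vanishesOutside_boundaryMeasure hq0 hq1 hζm hζp hX hK)]
  refine hasSum_of_eq ((hasSum_boundaryMeasure_mul_altRatio hq0 hq1 hζm hζp hX
    (schurExp ν K)).div_const (altRatio (schurExp ν K) fun i : Fin K => q ^ (i : ℕ)))
    (fun Y => ?_) (normSchurFun_eq hq0 hq1 hζm hζp hX hK hν)
  rw [normSchurPoly_eq hν, mul_div_assoc]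

theorem hasSum_mul_altRatio_of_schurRelations (hq0 : 0 < q) (hq1 : q < 1) (hζm : ζm < 0)
    (hζp : 0 < ζp) (hX : X ∈ InfConfig q ζm ζp) (hK : 0 < K) {M : Level q ζm ζp K → ℝ}
    (hM : VanishesOutside X M) (hS : SchurRelations X M) {ν : YoungDiagram} (hν : length ν ≤ K) :
    HasSum (fun Y => M Y * altRatio (schurExp ν K) Y.particle)
      (limitFactor q (schurExp ν K) * jacobiTrudi (psumsInf X) (schurExp ν K)) := by
  have h1 := (hasSum_mul_normSchurPoly_iff hM ν).1 (hS ν hν)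
  have h2 := altRatio_geom_ne_zero hq0 hq1 (schurExp_strictMono ν K).injective
  refine hasSum_of_eq (h1.mul_right (altRatio (schurExp ν K) fun i : Fin K => q ^ (i : ℕ)))
    (fun Y => ?_) ?_
  · rw [normSchurPoly_eq hν, mul_assoc, div_mul_cancel₀ _ h2]
  · rw [normSchurFun_eq hq0 hq1 hζm hζp hX hK hν, div_mul_cancel₀ _ h2]

/-- The difference of the two measures has bounded support and zero alternant moments; the
determinacy lemma applied to this constant family makes it vanish. -/
theorem eq_boundaryMeasure_of_schurRelations (hq0 : 0 < q) (hq1 : q < 1) (hζm : ζm < 0)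
    (hζp : 0 < ζp) (hX : X ∈ InfConfig q ζm ζp) (hK : 0 < K) {M : Level q ζm ζp K → ℝ}
    (hP : IsProbability M) (hM : VanishesOutside X M) (hS : SchurRelations X M) :
    M = boundaryMeasure X K := by
  obtain ⟨R, -, hR⟩ := InfConfig.exists_bound hX
  have hB := isProbability_boundaryMeasure (K := K) hq0 hq1 hζm hζp hX hK
  have hBV := vanishesOutside_boundaryMeasure (K := K) hq0 hq1 hζm hζp hX hK
  have hBS := schurRelations_boundaryMeasure (K := K) hq0 hq1 hζm hζp hX hK
  ext Y
  have h1 := tendsto_zero_of_altRatio_moments hq0 hq1 hζm hζp hK (l := (atTop : Filter ℕ))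
    (D := fun _ Z => M Z - boundaryMeasure X K Z) (R := R)
    (fun _ => (hP.2.sub hB.2).summable.abs) (fun _ => le_rfl)
    (Eventually.of_forall fun _ Z hZ => by
      refine abs_le_of_segment_subset hR hX.2.1.nonempty ?_
      by_contra hne
      exact hZ (by rw [hM Z hne, hBV Z hne, sub_zero]))
    (fun α => by
      have h2 : ∑' Z, (M Z - boundaryMeasure X K Z) * altRatio α Z.particle = 0 := by
        rcases altRatio_eq_zero_or α with h | ⟨ν, c, hν, h⟩
        · simp [h]
        · have h3 := (hasSum_mul_altRatio_of_schurRelations hq0 hq1 hζm hζp hX hK hM hS hν).sub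
            (hasSum_mul_altRatio_of_schurRelations hq0 hq1 hζm hζp hX hK hBV hBS hν)
          rw [sub_self] at h3
          refine (hasSum_of_eq (h3.mul_left c) (fun Z => ?_) (mul_zero c).symm).tsum_eq
          rw [h]
          ring
      simp only [h2]
      exact tendsto_const_nhds) Y
  exact sub_eq_zero.1 (tendsto_nhds_unique tendsto_const_nhds h1)

end Main

end QGT
end

theorem theorem3p2 (q ζm ζp : ℝ) (hq0 : 0 < q) (hq1 : q < 1) (hζm : ζm < 0) (hζp : 0 < ζp)
    (X : Set ℝ) (hX : X ∈ QGT.InfConfig q ζm ζp) (K : ℕ) (hK : 1 ≤ K) :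
    -- the measure `M^{(X)}_K` is well defined
    (∃! M : QGT.Level q ζm ζp K → ℝ, QGT.IsBoundaryMeasure X K M) ∧
    -- the normalized Schur functions `S̃_ν(X)` are well defined
    (∀ ν : YoungDiagram, QGT.SchurConverges ν X ∧ QGT.SchurConverges ν (QGT.geomSet q) ∧
      QGT.schurFun ν (QGT.geomSet q) ≠ 0) ∧
    -- `M^{(X)}_K` has the two properties and is the only probability distribution with them
    (∀ M : QGT.Level q ζm ζp K → ℝ, QGT.IsBoundaryMeasure X K M →
      QGT.VanishesOutside X M ∧ QGT.SchurRelations X M ∧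
      ∀ M' : QGT.Level q ζm ζp K → ℝ, QGT.IsProbability M' → QGT.VanishesOutside X M' →
        QGT.SchurRelations X M' → M' = M) := by
  have hB := QGT.isBoundaryMeasure_boundaryMeasure hq0 hq1 hζm hζp hX hK
  refine ⟨⟨_, hB, fun M hM => hM.unique hq0 hq1 hζm hζp hX hB⟩, fun ν => ⟨?_, ?_, ?_⟩,
    fun M hM => ?_⟩
  · exact QGT.schurConverges_of_infConfig hq0 hq1 hζm hζp hX ν
  · exact QGT.schurConverges_of_infConfig hq0 hq1 (by norm_num) one_pos
      (QGT.geomSet_mem_infConfig hq0 hq1) ν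
  · exact QGT.schurFun_geomSet_ne_zero hq0 hq1 ν
  · obtain rfl := hM.unique hq0 hq1 hζm hζp hX hB
    exact ⟨QGT.vanishesOutside_boundaryMeasure hq0 hq1 hζm hζp hX hK,
      QGT.schurRelations_boundaryMeasure hq0 hq1 hζm hζp hX hK,
      fun M' hP hV hS => QGT.eq_boundaryMeasure_of_schurRelations hq0 hq1 hζm hζp hX hK hP hV hS⟩
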